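/- Let $S^1=\mathbb R/\mathbb Z$ and let $\|\cdot\|$ be the $L^2$-norm on $S^1$; elements of $H^1(S^1,\mathbb R)$ are identified with their continuous representatives. For $z\in H^1(S^1,\mathbb R)$ with $\|z\|>0$ let $$t_z(\tau)=\frac1{\|z\|^2}\int_0^\tau z(\sigma)^2\,d\sigma ,$$ a surjective nondecreasing map $S^1\to S^1$ which is a homeomorphism if $z$ has only finitely many zeroes. Let $\tau_z$ be its inverse (any right inverse, if $t_z$ is not injective: $z$ vanishes on the nondegenerate fibres of $t_z$, so $z\circ\tau_z$ does not depend on the choice). The Levi-Civita transform of $z$ is $\mathcal L(z)(t):=z(\tau_z(t))^2$. Let $\mathcal H^1_{in}$ be the open set of all $(z_1,z_2)\in H^1(S^1,\mathbb R^2)$ such that $\|z_1\|>0$, $\|z_2\|>0$ and $z_1(\tau)^2-z_2\bigl(\tau_{z_2}(t_{z_1}(\tau))\bigr)^2>0$ for all $\tau\in S^1$, and let $\mathcal B_{in}:\mathcal H^1_{in}\to\mathbb R$, $$\mathcal B_{in}(z_1,z_2)=\mathcal Q(z_1)+\mathcal Q(z_2)+\mathcal I(z_1,z_2),\qquad \mathcal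 Q(z)=2\|z\|^2\|z'\|^2+\frac2{\|z\|^2},$$ $$\mathcal I(z_1,z_2)=-\frac1{\|z_1\|^2}\int_0^1\frac{z_1(\tau)^2}{z_1(\tau)^2-z_2\bigl(\tau_{z_2}(t_{z_1}(\tau))\bigr)^2}\,d\tau .$$ A critical point of $\mathcal B_{in}$ is a point of $\mathcal H^1_{in}$ at which the Fréchet differential of $\mathcal B_{in}$ (with respect to the $H^1$-norm) exists and vanishes. A generalized solution of the helium equations with instantaneous interaction $$\ddot q_1=-\frac2{q_1^2}+\frac1{(q_1-q_2)^2},\qquad \ddot q_2=-\frac2{q_2^2}-\frac1{(q_1-q_2)^2}$$ is a pair $(q_1,q_2)\in H^1(S^1,\mathbb R_{\ge0}\times\mathbb R_{\ge 0})$ such that 1. $q_1(t)>q_2(t)$ for all $t\in S^1$; 2. for $i=1,2$ the zero set $Z_i=q_i^{-1}(0)$ is finite with an even number of elements; 3. for $i=1,2$ the function $q_i$ is of class $C^2$ on $S^1\setminus Z_i$ and satisfies the $i$-th equation there, and $q_1,q_2$ are smooth on $S^1\setminus(Z_1\cup Z_2)$; 4. for $i=1,2$ the energy $E_i=\frac12\dot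 q_i^2-\frac2{q_i}$ on $S^1\setminus Z_i$ extends to a continuous function on $S^1$. **Theorem.** If $(z_1,z_2)$ is a critical point of $\mathcal B_{in}$, then $z_1$ and $z_2$ have only finitely many zeroes and $(\mathcal L(z_1),\mathcal L(z_2))$ is a generalized solution. Conversely, for every generalized solution $(q_1,q_2)$ there are exactly four critical points $(z_1,z_2)$ of $\mathcal B_{in}$ with $(\mathcal L(z_1),\mathcal L(z_2))=(q_1,q_2)$. That is, $(z_1,z_2)\mapsto(\mathcal L(z_1),\mathcal L(z_2))$ maps the critical points of $\mathcal B_{in}$ 4-to-1 onto the generalized solutions. -/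

import Mathlib

open scoped ContDiff

noncomputable section

namespace Helium

/-! Functions on the circle `S¹ = ℝ/ℤ` are represented by `1`-periodic functions `ℝ → ℝ`,
and pairs of them by elements of `(ℝ → ℝ) × (ℝ → ℝ)`. -/

/-- Membership in the Sobolev space `H¹(S¹, ℝ)`: `1`-periodic, absolutely continuous, with square
integrable (almost everywhere defined) derivative. Each `H¹`-class is represented by its unique
continuous representative. -/
def MemH1 (f : ℝ → ℝ) : Prop :=
  Function.Periodic f 1 ∧ AbsolutelyContinuousOnInterval f 0 1 ∧
    MeasureTheory.MemLp (deriv f) 2 (MeasureTheory.volume.restrict (Set.Ioc 0 1))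

/-- The squared `L²`-norm over one period. -/
def normSq (f : ℝ → ℝ) : ℝ := ∫ τ in (0 : ℝ)..1, f τ ^ 2

/-- The `H¹`-norm of a pair of functions. -/
def h1Norm (v : (ℝ → ℝ) × (ℝ → ℝ)) : ℝ :=
  Real.sqrt (normSq v.1 + normSq (deriv v.1) + normSq v.2 + normSq (deriv v.2))

/-- The set of zeroes on the circle, with `S¹` identified with `[0, 1)`. -/
def zeroSet (f : ℝ → ℝ) : Set ℝ := {t | t ∈ Set.Ico (0 : ℝ) 1 ∧ f t = 0}

/-- The time change `t_z(τ) = ‖z‖⁻² ∫₀^τ z(σ)² dσ`, lifted to `ℝ → ℝ`. -/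
def timeMap (z : ℝ → ℝ) (τ : ℝ) : ℝ := (normSq z)⁻¹ * ∫ σ in (0 : ℝ)..τ, z σ ^ 2

/-- The inverse time change `τ_z = t_z⁻¹`. If `z` is continuous, periodic and not identically
zero, then `t_z` is surjective and nondecreasing, and it is bijective if `z` has finitely many
zeroes on the circle. If `z` vanishes on intervals, then `τ_z` is a right inverse; as `z` is
zero on every nondegenerate fibre of `t_z`, the function `z ∘ τ_z` does not depend on its choice. -/
def invTimeMap (z : ℝ → ℝ) : ℝ → ℝ := Function.invFun (timeMap z)

/-- The Levi-Civita transform `q(t) = z(τ_z(t))²`. -/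
def leviCivita (z : ℝ → ℝ) (t : ℝ) : ℝ := z (invTimeMap z t) ^ 2

/-- The Levi-Civita transformations of both components, each with its own time change. -/
def leviCivita₂ (z : (ℝ → ℝ) × (ℝ → ℝ)) : (ℝ → ℝ) × (ℝ → ℝ) :=
  (leviCivita z.1, leviCivita z.2)

/-- The space `H¹_in`. -/
def Hin : Set ((ℝ → ℝ) × (ℝ → ℝ)) :=
  {z | MemH1 z.1 ∧ MemH1 z.2 ∧ 0 < normSq z.1 ∧ 0 < normSq z.2 ∧
    ∀ τ : ℝ, 0 < z.1 τ ^ 2 - z.2 (invTimeMap z.2 (timeMap z.1 τ)) ^ 2}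

/-- The functional `Q(z) = 2 ‖z‖² ‖z'‖² + 2 / ‖z‖²` (nuclear charge `2`). -/
def Q (z : ℝ → ℝ) : ℝ := 2 * normSq z * normSq (deriv z) + 2 / normSq z

/-- The instantaneous interaction `I(z₁, z₂)`. -/
def interaction (z : (ℝ → ℝ) × (ℝ → ℝ)) : ℝ :=
  -(1 / normSq z.1) * ∫ τ in (0 : ℝ)..1,
    z.1 τ ^ 2 / (z.1 τ ^ 2 - z.2 (invTimeMap z.2 (timeMap z.1 τ)) ^ 2)

/-- The functional `B_in(z₁, z₂) = Q(z₁) + Q(z₂) + I(z₁, z₂)`. -/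
def Bin (z : (ℝ → ℝ) × (ℝ → ℝ)) : ℝ := Q z.1 + Q z.2 + interaction z

/-- Critical points of `B_in` on the open subset `H¹_in` of the Hilbert space `H¹(S¹, ℝ²)`: the
Fréchet derivative with respect to the `H¹`-norm exists and is zero. -/
def IsCriticalPoint (z : (ℝ → ℝ) × (ℝ → ℝ)) : Prop :=
  z ∈ Hin ∧ ∀ ε : ℝ, 0 < ε → ∃ δ : ℝ, 0 < δ ∧
    ∀ v : (ℝ → ℝ) × (ℝ → ℝ), MemH1 v.1 → MemH1 v.2 → z + v ∈ Hin → h1Norm v < δ →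
      |Bin (z + v) - Bin z| ≤ ε * h1Norm v

/-- The energy `q̇² / 2 - 2 / q` (meaningful where `q ≠ 0`) extends to a continuous function on
the circle. -/
def EnergyExtends (q : ℝ → ℝ) : Prop :=
  ∃ E : ℝ → ℝ, Continuous E ∧ Function.Periodic E 1 ∧
    ∀ t : ℝ, q t ≠ 0 → E t = (deriv q t) ^ 2 / 2 - 2 / q t

/-- Generalized solutions `(q₁, q₂)` of the helium equations
`q̈₁ = -2 / q₁² + 1 / (q₁ - q₂)²`, `q̈₂ = -2 / q₂² - 1 / (q₁ - q₂)²`. -/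
structure IsGeneralizedSolution (q : (ℝ → ℝ) × (ℝ → ℝ)) : Prop where
  memH1_fst : MemH1 q.1
  memH1_snd : MemH1 q.2
  nonneg_fst : ∀ t, 0 ≤ q.1 t
  nonneg_snd : ∀ t, 0 ≤ q.2 t
  lt : ∀ t, q.2 t < q.1 t
  zeros_fst : (zeroSet q.1).Finite ∧ Even (zeroSet q.1).ncard
  zeros_snd : (zeroSet q.2).Finite ∧ Even (zeroSet q.2).ncard
  contDiff_fst : ContDiffOn ℝ 2 q.1 {t | q.1 t ≠ 0}
  contDiff_snd : ContDiffOn ℝ 2 q.2 {t | q.2 t ≠ 0}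
  smooth_fst : ContDiffOn ℝ ∞ q.1 {t | q.1 t ≠ 0 ∧ q.2 t ≠ 0}
  smooth_snd : ContDiffOn ℝ ∞ q.2 {t | q.1 t ≠ 0 ∧ q.2 t ≠ 0}
  eq_fst : ∀ t, q.1 t ≠ 0 →
    deriv (deriv q.1) t = -(2 / q.1 t ^ 2) + 1 / (q.1 t - q.2 t) ^ 2
  eq_snd : ∀ t, q.2 t ≠ 0 →
    deriv (deriv q.2) t = -(2 / q.2 t ^ 2) - 1 / (q.1 t - q.2 t) ^ 2
  energy_fst : EnergyExtends q.1
  energy_snd : EnergyExtends q.2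

end Helium

end

open Set Filter MeasureTheory Topology

noncomputable section

namespace Helium

/-! ### Elementary properties of `H¹`-functions -/

/-! Write `q = L(z)`. The substitution `t = t_z(τ)` turns the interaction into `-∫ dt / (q₁ - q₂)`,
which is symmetric in the two electrons and involves `z` only through `q₁`, `q₂` (`interaction_eq`).
The difficulty is that `z ↦ q` is not obviously differentiable: for `z` in `H¹` the function `q` is
continuous but need not be `C¹` in `t`.

Two facts together give Fréchet differentiability of `B_in`. For a fixed continuous weight `g`,
integration by parts replaces `g` by its `C¹` primitive, so that `∫ g q dt` is differentiable in `z`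
(`eventually_pairing_remainder_le`). Moreover `q` moves by only `o(‖v‖^{1/2})` uniformly in `t`
(`eventually_sq_leviCivita_sub_le`), so the Taylor remainder of `1 / (q₁ - q₂)`, quadratic in the
displacement, is `o(‖v‖)`.

Criticality then splits into one weak equation `z'' = b` per electron with `b` continuous, and the
du Bois-Reymond lemma makes it classical. The nonlocal right-hand side contains an energy `E` for
which `2‖z‖⁴ z'² - E z²` is constant on the unit interval; averaging shows that the constant is `2`
(`exists_velocity`). Hence `z' ≠ 0` at every zero of `z`: zeros are simple, finite in number on the
circle, and even in number by periodicity. It remains to see that `E` closes up after one period.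
For the outer electron, which never vanishes, this is read off from the energy identity; for the
inner one it follows because the potential `1 / (q₁ - q₂)` is periodic (`energyChange_snd_eq_zero`).
Changing time back gives the equations of motion.

Conversely, the energy bound makes `1/q` integrable, so `∫ dt/q` defines a time change that
regularizes the collisions. In the new time `q` is `C²` with second derivative positive at its
zeros, and since their number is even it has a periodic `C¹` square root that changes sign at each
of them (`IsComponent.exists_isClassical`). The transform determines the time change and the norm,
hence `z²`, and simplicity of zeros determines `z` up to a global sign (`IsClassical.eq_or_eq_neg`).
The two signs are independent, which gives four preimages. -/

theorem periodic_fract {α : Type*} {f : ℝ → α} (hp : Function.Periodic f 1) (x : ℝ) :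
    f (Int.fract x) = f x := by
  rw [show Int.fract x = x - ⌊x⌋ * 1 by rw [mul_one, Int.fract], hp.sub_int_mul_eq]

theorem continuous_of_periodic_of_continuousOn {f : ℝ → ℝ} (hp : Function.Periodic f 1)
    (hc : ContinuousOn f (Icc 0 1)) : Continuous f := by
  have : Fact ((0 : ℝ) < 1) := ⟨one_pos⟩
  have h := AddCircle.liftIco_continuous (p := (1 : ℝ)) (a := 0) (f := f) (hp 0).symm
    (by simpa using hc)
  have h2 : f = fun x : ℝ => AddCircle.liftIco (1 : ℝ) 0 f (x : AddCircle (1 : ℝ)) := by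
    funext x
    have hx : Int.fract x ∈ Ico (0 : ℝ) (0 + 1) :=
      ⟨Int.fract_nonneg x, by rw [zero_add]; exact Int.fract_lt_one x⟩
    have h3 := periodic_fract (f := fun y : ℝ => (y : AddCircle (1 : ℝ)))
      (fun y => AddCircle.coe_add_period 1 y) x
    rw [← h3, AddCircle.liftIco_coe_apply hx, periodic_fract hp]
  rw [h2]
  exact h.comp (AddCircle.continuous_mk' 1)

theorem periodic_deriv {f : ℝ → ℝ} {T : ℝ} (hp : Function.Periodic f T) :
    Function.Periodic (deriv f) T := by
  intro x
  have : (fun y => f (y + T)) = f := funext hp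
  rw [← deriv_comp_add_const, this]

namespace MemH1

variable {f g : ℝ → ℝ}

theorem continuous (hf : MemH1 f) : Continuous f :=
  continuous_of_periodic_of_continuousOn hf.1 (by simpa using hf.2.1.continuousOn)

theorem intervalIntegrable_deriv_sq (hf : MemH1 f) :
    IntervalIntegrable (fun τ => deriv f τ ^ 2) volume 0 1 := by
  rw [intervalIntegrable_iff_integrableOn_Ioc_of_le zero_le_one]
  exact (memLp_two_iff_integrable_sq hf.2.2.aestronglyMeasurable).1 hf.2.2

theorem intervalIntegrable_deriv (hf : MemH1 f) : IntervalIntegrable (deriv f) volume 0 1 :=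
  hf.2.1.intervalIntegrable_deriv

theorem intervalIntegrable_deriv' (hf : MemH1 f) (a b : ℝ) :
    IntervalIntegrable (deriv f) volume a b :=
  (periodic_deriv hf.1).intervalIntegrable₀ one_ne_zero hf.intervalIntegrable_deriv a b

theorem intervalIntegrable_deriv_sq' (hf : MemH1 f) (a b : ℝ) :
    IntervalIntegrable (fun τ => deriv f τ ^ 2) volume a b := by
  refine Function.Periodic.intervalIntegrable₀ (T := 1) (fun x => ?_) one_ne_zero
    hf.intervalIntegrable_deriv_sq a b
  simp only [periodic_deriv hf.1 x]

theorem intervalIntegrable_deriv_mul_deriv (hf : MemH1 f) (hg : MemH1 g) :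
    IntervalIntegrable (fun τ => deriv f τ * deriv g τ) volume 0 1 := by
  rw [intervalIntegrable_iff_integrableOn_Ioc_of_le zero_le_one]
  exact hf.2.2.integrable_mul hg.2.2

theorem ae_differentiableAt (hf : MemH1 f) : ∀ᵐ x, x ∈ Ioc (0 : ℝ) 1 → DifferentiableAt ℝ f x := by
  filter_upwards [hf.2.1.ae_differentiableAt] with x hx h
  exact hx (by simpa using Ioc_subset_Icc_self h)

theorem ae_restrict_differentiableAt (hf : MemH1 f) :
    ∀ᵐ x ∂(volume.restrict (Ioc (0 : ℝ) 1)), DifferentiableAt ℝ f x :=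
  (ae_restrict_iff' measurableSet_Ioc).2 hf.ae_differentiableAt

theorem deriv_add_ae (hf : MemH1 f) (hg : MemH1 g) :
    deriv (f + g) =ᵐ[volume.restrict (Ioc (0 : ℝ) 1)] deriv f + deriv g := by
  filter_upwards [hf.ae_restrict_differentiableAt, hg.ae_restrict_differentiableAt] with x h1 h2
  exact deriv_add h1 h2

theorem add (hf : MemH1 f) (hg : MemH1 g) : MemH1 (f + g) :=
  ⟨hf.1.add hg.1, hf.2.1.add hg.2.1, (hf.2.2.add hg.2.2).ae_eq (hf.deriv_add_ae hg).symm⟩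

theorem const_smul (hf : MemH1 f) (c : ℝ) : MemH1 (c • f) := by
  refine ⟨fun x => by simp [hf.1 x], hf.2.1.const_smul c, ?_⟩
  have : deriv (c • f) = c • deriv f := by
    funext x; exact deriv_const_smul_field c f
  rw [this]
  exact hf.2.2.const_smul c

theorem neg (hf : MemH1 f) : MemH1 (-f) := by
  simpa using hf.const_smul (-1)

theorem sub (hf : MemH1 f) (hg : MemH1 g) : MemH1 (f - g) := by
  simpa [sub_eq_add_neg] using hf.add hg.neg

theorem zero : MemH1 0 := by
  refine ⟨fun x => rfl, ?_, ?_⟩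
  · exact (contDiff_const (c := (0:ℝ))).contDiffOn.absolutelyContinuousOnInterval
  · have : deriv (0 : ℝ → ℝ) = 0 := by funext x; simp
    rw [this]; exact MemLp.zero

end MemH1

theorem memH1_of_absolutelyContinuousOn {f : ℝ → ℝ} (hp : Function.Periodic f 1)
    (hf : AbsolutelyContinuousOnInterval f 0 1)
    (hd : IntervalIntegrable (fun τ => deriv f τ ^ 2) volume 0 1) : MemH1 f := by
  refine ⟨hp, hf, (memLp_two_iff_integrable_sq (aestronglyMeasurable_deriv f _)).2 ?_⟩
  rwa [intervalIntegrable_iff_integrableOn_Ioc_of_le zero_le_one] at hd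

theorem memH1_of_hasDerivAt {f f' : ℝ → ℝ} (hp : Function.Periodic f 1)
    (hf : ∀ x, HasDerivAt f (f' x) x) (hc : Continuous f') : MemH1 f := by
  have h1 : deriv f = f' := funext fun x => (hf x).deriv
  have h2 : ContDiff ℝ 1 f := by
    rw [contDiff_one_iff_deriv, h1]
    exact ⟨fun x => (hf x).differentiableAt, hc⟩
  refine memH1_of_absolutelyContinuousOn hp h2.contDiffOn.absolutelyContinuousOnInterval ?_
  rw [h1]
  exact (hc.pow 2).intervalIntegrable _ _

/-! ### The `H¹`-norm -/

/-- The `H¹`-norm of a single function. -/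
def sobolevNorm (v : ℝ → ℝ) : ℝ := Real.sqrt (normSq v + normSq (deriv v))

theorem normSq_nonneg (f : ℝ → ℝ) : 0 ≤ normSq f :=
  intervalIntegral.integral_nonneg zero_le_one fun _ _ => sq_nonneg _

theorem sobolevNorm_nonneg (v : ℝ → ℝ) : 0 ≤ sobolevNorm v := Real.sqrt_nonneg _

theorem sq_sobolevNorm (v : ℝ → ℝ) : sobolevNorm v ^ 2 = normSq v + normSq (deriv v) :=
  Real.sq_sqrt (add_nonneg (normSq_nonneg _) (normSq_nonneg _))

theorem sobolevNorm_fst_le (v : (ℝ → ℝ) × (ℝ → ℝ)) : sobolevNorm v.1 ≤ h1Norm v :=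
  Real.sqrt_le_sqrt (by linarith [normSq_nonneg v.2, normSq_nonneg (deriv v.2)])

theorem sobolevNorm_snd_le (v : (ℝ → ℝ) × (ℝ → ℝ)) : sobolevNorm v.2 ≤ h1Norm v :=
  Real.sqrt_le_sqrt (by linarith [normSq_nonneg v.1, normSq_nonneg (deriv v.1)])

theorem normSq_const_smul (c : ℝ) (f : ℝ → ℝ) : normSq (c • f) = c ^ 2 * normSq f := by
  simp [normSq, mul_pow]

theorem deriv_const_smul_fun (c : ℝ) (f : ℝ → ℝ) : deriv (c • f) = c • deriv f := by
  funext x; exact deriv_const_smul_field c f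

theorem h1Norm_const_smul (c : ℝ) (v : (ℝ → ℝ) × (ℝ → ℝ)) : h1Norm (c • v) = |c| * h1Norm v := by
  simp only [h1Norm, Prod.smul_fst, Prod.smul_snd, deriv_const_smul_fun, normSq_const_smul]
  rw [← Real.sqrt_sq_eq_abs, ← Real.sqrt_mul (sq_nonneg c)]
  ring_nf

/-- The Cauchy–Schwarz inequality for interval integrals. -/
theorem sq_integral_mul_le {f g : ℝ → ℝ} {a b : ℝ} (hab : a ≤ b)
    (hf : IntervalIntegrable (fun x => f x ^ 2) volume a b)
    (hg : IntervalIntegrable (fun x => g x ^ 2) volume a b)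
    (hfg : IntervalIntegrable (fun x => f x * g x) volume a b) :
    (∫ x in a..b, f x * g x) ^ 2 ≤ (∫ x in a..b, f x ^ 2) * ∫ x in a..b, g x ^ 2 := by
  have h : ∀ s : ℝ, 0 ≤ (∫ x in a..b, f x ^ 2) * (s * s) + (2 * ∫ x in a..b, f x * g x) * s
      + ∫ x in a..b, g x ^ 2 := by
    intro s
    have h1 : 0 ≤ ∫ x in a..b, (s * f x + g x) ^ 2 :=
      intervalIntegral.integral_nonneg hab fun _ _ => sq_nonneg _
    have h2 : (fun x => (s * f x + g x) ^ 2) =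
        fun x => (s * s) * f x ^ 2 + (2 * s) * (f x * g x) + g x ^ 2 := by
      funext x; ring
    rw [h2, intervalIntegral.integral_add ((hf.const_mul _).add (hfg.const_mul _)) hg,
      intervalIntegral.integral_add (hf.const_mul _) (hfg.const_mul _),
      intervalIntegral.integral_const_mul, intervalIntegral.integral_const_mul] at h1
    linarith
  have := discrim_le_zero h
  rw [discrim] at this
  linarith

theorem MemH1.sq_integral_mul_deriv_le {u f : ℝ → ℝ} (hu : Continuous u) (hf : MemH1 f) {a b : ℝ}
    (hab : a ≤ b) : (∫ x in a..b, u x * deriv f x) ^ 2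
      ≤ (∫ x in a..b, u x ^ 2) * ∫ x in a..b, deriv f x ^ 2 :=
  sq_integral_mul_le hab ((hu.pow 2).intervalIntegrable _ _) (hf.intervalIntegrable_deriv_sq' _ _)
    ((hf.intervalIntegrable_deriv' _ _).continuousOn_mul hu.continuousOn)

theorem MemH1.integral_abs_deriv_le {v : ℝ → ℝ} (hv : MemH1 v) :
    ∫ x in (0 : ℝ)..1, |deriv v x| ≤ sobolevNorm v := by
  have h1 := sq_integral_mul_le (f := fun _ => 1) (g := fun x => |deriv v x|) zero_le_one
    (by simp) (by simpa using hv.intervalIntegrable_deriv_sq)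
    (by simpa using hv.intervalIntegrable_deriv.abs)
  simp only [one_mul, one_pow, sq_abs, intervalIntegral.integral_const, sub_zero, smul_eq_mul,
    mul_one] at h1
  refine le_trans (Real.le_sqrt_of_sq_le h1) (Real.sqrt_le_sqrt ?_)
  have := normSq_nonneg v
  simp only [normSq] at this ⊢
  linarith

theorem MemH1.sub_eq_integral {v : ℝ → ℝ} (hv : MemH1 v) {a b : ℝ} (ha : a ∈ Icc (0 : ℝ) 1)
    (hb : b ∈ Icc (0 : ℝ) 1) : ∫ x in a..b, deriv v x = v b - v a := by
  refine AbsolutelyContinuousOnInterval.integral_deriv_eq_sub (hv.2.1.mono ?_)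
  rw [uIcc_of_le (zero_le_one' ℝ)]
  exact uIcc_subset_Icc ha hb

theorem MemH1.abs_sub_le {v : ℝ → ℝ} (hv : MemH1 v) {a b : ℝ} (ha : a ∈ Icc (0 : ℝ) 1)
    (hb : b ∈ Icc (0 : ℝ) 1) : |v b - v a| ≤ sobolevNorm v := by
  wlog hab : a ≤ b generalizing a b
  · rw [abs_sub_comm]; exact this hb ha (le_of_not_ge hab)
  rw [← hv.sub_eq_integral ha hb]
  refine le_trans (intervalIntegral.abs_integral_le_integral_abs hab) (le_trans ?_
    hv.integral_abs_deriv_le)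
  exact intervalIntegral.integral_mono_interval ha.1 hab hb.2 (ae_of_all _ fun _ => abs_nonneg _)
    hv.intervalIntegrable_deriv.abs

/-- The factor `2` counts the Sobolev norm once for the oscillation of `v` and once for the mean of
`|v|`. -/
theorem MemH1.abs_le_Icc {v : ℝ → ℝ} (hv : MemH1 v) {τ : ℝ} (hτ : τ ∈ Icc (0 : ℝ) 1) :
    |v τ| ≤ 2 * sobolevNorm v := by
  have hi := hv.continuous.intervalIntegrable (μ := volume) 0 1
  have h0 : (|v τ| - sobolevNorm v) ≤ ∫ σ in (0 : ℝ)..1, |v σ| := by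
    have : ∫ σ in (0 : ℝ)..1, (|v τ| - sobolevNorm v) ≤ ∫ σ in (0 : ℝ)..1, |v σ| := by
      refine intervalIntegral.integral_mono_on zero_le_one (by simp) hi.abs fun x hx => ?_
      have h1 := hv.abs_sub_le hx hτ
      have h2 := abs_sub_abs_le_abs_sub (v τ) (v x)
      linarith
    simpa using this
  have h1 := sq_integral_mul_le (f := fun _ => 1) (g := fun x => |v x|) zero_le_one
    (by simp) (by simp only [sq_abs]; exact (hv.continuous.pow 2).intervalIntegrable 0 1)
    (by simpa using hi.abs)
  simp only [one_mul, one_pow, sq_abs, intervalIntegral.integral_const, sub_zero, smul_eq_mul,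
    mul_one] at h1
  have h2 : ∫ σ in (0 : ℝ)..1, |v σ| ≤ sobolevNorm v := by
    refine le_trans (Real.le_sqrt_of_sq_le h1) (Real.sqrt_le_sqrt ?_)
    have := normSq_nonneg (deriv v)
    simp only [normSq] at this ⊢
    linarith
  linarith

theorem MemH1.abs_le {v : ℝ → ℝ} (hv : MemH1 v) (τ : ℝ) : |v τ| ≤ 2 * sobolevNorm v := by
  rw [← periodic_fract hv.1]
  exact hv.abs_le_Icc ⟨Int.fract_nonneg τ, (Int.fract_lt_one τ).le⟩

/-! ### The time change and the Levi-Civita transform -/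

section TimeMap

variable {z : ℝ → ℝ}

theorem hasDerivAt_integral_of_continuous {f : ℝ → ℝ} (hf : Continuous f) (a x : ℝ) :
    HasDerivAt (fun y => ∫ s in a..y, f s) (f x) x :=
  intervalIntegral.integral_hasDerivAt_right (hf.intervalIntegrable _ _)
    hf.stronglyMeasurable.stronglyMeasurableAtFilter hf.continuousAt

theorem hasDerivAt_timeMap (hz : Continuous z) (τ : ℝ) :
    HasDerivAt (timeMap z) ((normSq z)⁻¹ * z τ ^ 2) τ :=
  (hasDerivAt_integral_of_continuous (hz.pow 2) 0 τ).const_mul _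

theorem continuous_timeMap (hz : Continuous z) : Continuous (timeMap z) :=
  continuous_iff_continuousAt.2 fun τ => (hasDerivAt_timeMap hz τ).continuousAt

theorem timeMap_zero : timeMap z 0 = 0 := by simp [timeMap]

theorem timeMap_one (hm : 0 < normSq z) : timeMap z 1 = 1 :=
  inv_mul_cancel₀ hm.ne'

theorem timeMap_sub (hz : Continuous z) (a b : ℝ) :
    timeMap z b - timeMap z a = (normSq z)⁻¹ * ∫ σ in a..b, z σ ^ 2 := by
  rw [timeMap, timeMap, ← mul_sub, intervalIntegral.integral_interval_sub_left] <;>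
    exact (hz.pow 2).intervalIntegrable _ _

theorem timeMap_mono (hz : Continuous z) : Monotone (timeMap z) := by
  intro a b hab
  have h := timeMap_sub hz a b
  have h1 : 0 ≤ ∫ σ in a..b, z σ ^ 2 :=
    intervalIntegral.integral_nonneg hab fun _ _ => sq_nonneg _
  have := mul_nonneg (inv_nonneg.2 (normSq_nonneg z)) h1
  linarith

theorem timeMap_add_one (hz : Continuous z) (hp : Function.Periodic z 1) (hm : 0 < normSq z)
    (τ : ℝ) : timeMap z (τ + 1) = timeMap z τ + 1 := by
  have h := timeMap_sub hz τ (τ + 1)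
  have hp2 : Function.Periodic (fun σ => z σ ^ 2) 1 := fun x => by simp only [hp x]
  rw [hp2.intervalIntegral_add_eq τ 0, zero_add] at h
  have : (normSq z)⁻¹ * ∫ σ in (0 : ℝ)..1, z σ ^ 2 = 1 := inv_mul_cancel₀ hm.ne'
  linarith

theorem surjective_of_continuous_of_add_one {T : ℝ → ℝ} (hT : Continuous T)
    (h1 : ∀ τ, T (τ + 1) = T τ + 1) : Function.Surjective T := by
  have hn : ∀ n : ℕ, ∀ τ, T (τ + n) = T τ + n := by
    intro n
    induction n with
    | zero => simp
    | succ k ih => intro τ; push_cast; rw [← add_assoc, h1, ih]; ring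
  have hn' : ∀ n : ℕ, T (-n) = T 0 - n := by
    intro n
    have := hn n (-n)
    rw [neg_add_cancel] at this
    linarith
  intro y
  obtain ⟨n, hn1⟩ := exists_nat_ge |y - T 0|
  have h2 := abs_le.1 hn1
  have h3 : y ∈ Icc (T (-n)) (T (0 + n)) := by
    rw [hn', hn]; constructor <;> linarith
  obtain ⟨x, -, hx⟩ := intermediate_value_Icc
    (by have : (0 : ℝ) ≤ n := n.cast_nonneg
        linarith) hT.continuousOn h3
  exact ⟨x, hx⟩

theorem timeMap_surjective (hz : Continuous z) (hp : Function.Periodic z 1) (hm : 0 < normSq z) :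
    Function.Surjective (timeMap z) :=
  surjective_of_continuous_of_add_one (continuous_timeMap hz) (timeMap_add_one hz hp hm)

theorem timeMap_mem_Icc (hz : Continuous z) (hm : 0 < normSq z) {τ : ℝ} (hτ : τ ∈ Icc (0 : ℝ) 1) :
    timeMap z τ ∈ Icc (0 : ℝ) 1 := by
  rw [← timeMap_one hm, ← timeMap_zero (z := z), timeMap_one hm]
  exact ⟨timeMap_mono hz hτ.1, (timeMap_mono hz hτ.2).trans_eq (timeMap_one hm)⟩

theorem exists_timeMap_eq (hz : Continuous z) (hm : 0 < normSq z) {t : ℝ}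
    (ht : t ∈ Icc (0 : ℝ) 1) : ∃ τ ∈ Icc (0 : ℝ) 1, timeMap z τ = t := by
  have h := intermediate_value_Icc (zero_le_one' ℝ) (continuous_timeMap hz).continuousOn
  rw [timeMap_zero, timeMap_one hm] at h
  exact h ht

theorem eq_zero_of_timeMap_eq (hz : Continuous z) (hm : 0 < normSq z) {a b : ℝ} (hab : a < b)
    (h : timeMap z a = timeMap z b) {x : ℝ} (hx : x ∈ Icc a b) : z x = 0 := by
  have h1 := timeMap_sub hz a b
  rw [h, sub_self] at h1
  by_contra hne
  have : 0 < ∫ σ in a..b, z σ ^ 2 :=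
    intervalIntegral.integral_pos hab (hz.pow 2).continuousOn (fun _ _ => sq_nonneg _)
      ⟨x, hx, by positivity⟩
  have := mul_pos (inv_pos.2 hm) this
  linarith

theorem sq_eq_sq_of_timeMap_eq (hz : Continuous z) (hm : 0 < normSq z) {a b : ℝ}
    (h : timeMap z a = timeMap z b) : z a ^ 2 = z b ^ 2 := by
  rcases lt_trichotomy a b with hab | rfl | hab
  · rw [eq_zero_of_timeMap_eq hz hm hab h (left_mem_Icc.2 hab.le),
      eq_zero_of_timeMap_eq hz hm hab h (right_mem_Icc.2 hab.le)]
  · rfl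
  · rw [eq_zero_of_timeMap_eq hz hm hab h.symm (left_mem_Icc.2 hab.le),
      eq_zero_of_timeMap_eq hz hm hab h.symm (right_mem_Icc.2 hab.le)]

/-- Two points of the same fibre of `timeMap z` have the same `z²`, so the arbitrary choice made by
`Function.invFun` is invisible here. Together with surjectivity this formula replaces any use of the
inverse as long as `z` may vanish on intervals. -/
theorem leviCivita_timeMap (hz : Continuous z) (hm : 0 < normSq z) (τ : ℝ) :
    leviCivita z (timeMap z τ) = z τ ^ 2 :=
  sq_eq_sq_of_timeMap_eq hz hm (Function.invFun_eq ⟨τ, rfl⟩)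

theorem leviCivita_periodic (hz : Continuous z) (hp : Function.Periodic z 1) (hm : 0 < normSq z) :
    Function.Periodic (leviCivita z) 1 := by
  intro t
  obtain ⟨τ, rfl⟩ := timeMap_surjective hz hp hm t
  rw [← timeMap_add_one hz hp hm, leviCivita_timeMap hz hm, leviCivita_timeMap hz hm, hp]

/-- The substitution `t = t_z(τ)`. -/
theorem integral_comp_timeMap (hz : Continuous z) (hm : 0 < normSq z) {f : ℝ → ℝ}
    (hf : Continuous f) :
    ∫ τ in (0 : ℝ)..1, f (timeMap z τ) * ((normSq z)⁻¹ * z τ ^ 2) = ∫ t in (0 : ℝ)..1, f t := by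
  have := intervalIntegral.integral_comp_mul_deriv (a := 0) (b := 1)
    (fun x _ => hasDerivAt_timeMap hz x) (by fun_prop) hf
  rwa [timeMap_zero, timeMap_one hm] at this

end TimeMap

theorem MemH1.integral_two_mul_deriv {z : ℝ → ℝ} (hz : MemH1 z) {a b : ℝ} (ha : a ∈ Icc (0 : ℝ) 1)
    (hb : b ∈ Icc (0 : ℝ) 1) : ∫ x in a..b, 2 * z x * deriv z x = z b ^ 2 - z a ^ 2 := by
  have hac : AbsolutelyContinuousOnInterval z a b := by
    refine hz.2.1.mono ?_
    rw [uIcc_of_le (zero_le_one' ℝ)]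
    exact uIcc_subset_Icc ha hb
  have h := hac.integral_mul_deriv_eq_deriv_mul hac
  have h2 : ∫ x in a..b, deriv z x * z x = ∫ x in a..b, z x * deriv z x := by
    simp only [mul_comm]
  simp only [mul_assoc, intervalIntegral.integral_const_mul]
  rw [h2] at h
  linarith

/-- Cauchy–Schwarz for `∫ 2 z z'`, where `∫ z²` is the elapsed new time multiplied by `normSq z`.
This is a `1/2`-Hölder estimate for `L(z)` whose constant is the local energy `∫ z'²`. -/
theorem MemH1.sq_sub_sq_le {z : ℝ → ℝ} (hz : MemH1 z) (hm : 0 < normSq z) {a b : ℝ}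
    (ha : a ∈ Icc (0 : ℝ) 1) (hb : b ∈ Icc (0 : ℝ) 1) (hab : a ≤ b) :
    (z b ^ 2 - z a ^ 2) ^ 2
      ≤ 4 * normSq z * (timeMap z b - timeMap z a) * ∫ x in a..b, deriv z x ^ 2 := by
  rw [← hz.integral_two_mul_deriv ha hb, timeMap_sub hz.continuous]
  refine (hz.sq_integral_mul_deriv_le (u := fun x => 2 * z x)
    (continuous_const.mul hz.continuous) hab).trans (le_of_eq ?_)
  have : (fun x => (2 * z x) ^ 2) = fun x => 4 * z x ^ 2 := by funext x; ring
  rw [this, intervalIntegral.integral_const_mul]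
  field_simp

theorem MemH1.integral_deriv_sq_mono {z : ℝ → ℝ} (hz : MemH1 z) {a b : ℝ}
    (ha : a ∈ Icc (0 : ℝ) 1) (hb : b ∈ Icc (0 : ℝ) 1) (hab : a ≤ b) :
    ∫ x in a..b, deriv z x ^ 2 ≤ normSq (deriv z) :=
  intervalIntegral.integral_mono_interval ha.1 hab hb.2 (ae_of_all _ fun _ => sq_nonneg _)
    hz.intervalIntegrable_deriv_sq

/-- The energy `∫ z'²` over an interval is small if the interval is short in the new time. -/
theorem MemH1.exists_integral_deriv_sq_lt {z : ℝ → ℝ} (hz : MemH1 z) (hm : 0 < normSq z) {ε : ℝ}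
    (hε : 0 < ε) : ∃ η > 0, ∀ a ∈ Icc (0 : ℝ) 1, ∀ b ∈ Icc (0 : ℝ) 1, a ≤ b →
      timeMap z b - timeMap z a < η → ∫ x in a..b, deriv z x ^ 2 < ε := by
  let F : ℝ × ℝ → ℝ := fun p => ∫ x in p.1..p.2, deriv z x ^ 2
  have hF : Continuous F := by
    have h0 : Continuous fun b => ∫ x in (0 : ℝ)..b, deriv z x ^ 2 :=
      intervalIntegral.continuous_primitive hz.intervalIntegrable_deriv_sq' 0
    have : F = fun p => (∫ x in (0 : ℝ)..p.2, deriv z x ^ 2) - ∫ x in (0 : ℝ)..p.1, deriv z x ^ 2 := by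
      funext p
      rw [intervalIntegral.integral_interval_sub_left] <;>
        exact hz.intervalIntegrable_deriv_sq' _ _
    rw [this]
    exact (h0.comp continuous_snd).sub (h0.comp continuous_fst)
  -- The intervals carrying energy at least `ε` form a compact set, on which the elapsed time
  -- attains a minimum. The minimum is positive: on an interval of zero elapsed time `z` vanishes,
  -- so it carries no energy.
  let S : Set (ℝ × ℝ) := (Icc 0 1 ×ˢ Icc 0 1) ∩ ({p | p.1 ≤ p.2} ∩ {p | ε ≤ F p})
  have hS : IsCompact S := (isCompact_Icc.prod isCompact_Icc).inter_right
    ((isClosed_le continuous_fst continuous_snd).inter (isClosed_le continuous_const hF))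
  have hct := continuous_timeMap hz.continuous
  rcases S.eq_empty_or_nonempty with he | hne
  · refine ⟨1, one_pos, fun a ha b hb hab _ => ?_⟩
    by_contra hlt
    have : (a, b) ∈ S := ⟨⟨ha, hb⟩, hab, not_lt.1 hlt⟩
    rw [he] at this
    exact this
  · obtain ⟨p, hp, hmin⟩ := hS.exists_isMinOn hne
      (f := fun p => timeMap z p.2 - timeMap z p.1) (by fun_prop)
    refine ⟨timeMap z p.2 - timeMap z p.1, ?_, fun a ha b hb hab hlt => ?_⟩
    · obtain ⟨⟨h1, h2⟩, h3, h4⟩ := hp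
      have h3' : p.1 ≤ p.2 := h3
      have h4' : ε ≤ ∫ x in p.1..p.2, deriv z x ^ 2 := h4
      rcases h3'.eq_or_lt with h | h
      · rw [h, intervalIntegral.integral_same] at h4'
        linarith
      refine sub_pos.2 (lt_of_le_of_ne (timeMap_mono hz.continuous h3') fun heq => ?_)
      have hzero : ∀ x ∈ Icc p.1 p.2, z x = 0 := fun x hx =>
        eq_zero_of_timeMap_eq hz.continuous hm h heq hx
      have : ∫ x in p.1..p.2, deriv z x ^ 2 = 0 := by
        rw [intervalIntegral.integral_of_le h3', integral_Ioc_eq_integral_Ioo]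
        refine setIntegral_eq_zero_of_forall_eq_zero fun x hx => ?_
        have : z =ᶠ[𝓝 x] fun _ => 0 := by
          filter_upwards [Ioo_mem_nhds hx.1 hx.2] with y hy
          exact hzero y (Ioo_subset_Icc_self hy)
        rw [this.deriv_eq]
        simp
      linarith
    · by_contra hge
      exact absurd (hmin (show (a, b) ∈ S from ⟨⟨ha, hb⟩, hab, not_lt.1 hge⟩)) (not_le.2 hlt)

theorem MemH1.continuous_leviCivita {z : ℝ → ℝ} (hz : MemH1 z) (hm : 0 < normSq z) :
    Continuous (leviCivita z) := by
  refine continuous_of_periodic_of_continuousOn (leviCivita_periodic hz.continuous hz.1 hm) ?_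
  have key : ∀ s ∈ Icc (0 : ℝ) 1, ∀ t ∈ Icc (0 : ℝ) 1, (leviCivita z t - leviCivita z s) ^ 2
      ≤ (4 * normSq z * normSq (deriv z)) * |t - s| := by
    intro s hs t ht
    wlog hst : s ≤ t generalizing s t
    · have := this t ht s hs (le_of_not_ge hst)
      rwa [abs_sub_comm, ← neg_sub, neg_sq] at this
    rcases hst.eq_or_lt with rfl | hlt
    · simp
    obtain ⟨a, ha, rfl⟩ := exists_timeMap_eq hz.continuous hm hs
    obtain ⟨b, hb, rfl⟩ := exists_timeMap_eq hz.continuous hm ht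
    have hab : a ≤ b := le_of_not_gt fun h => absurd (timeMap_mono hz.continuous h.le) (not_le.2 hlt)
    rw [leviCivita_timeMap hz.continuous hm, leviCivita_timeMap hz.continuous hm,
      abs_of_nonneg (by linarith)]
    refine (hz.sq_sub_sq_le hm ha hb hab).trans ?_
    have h1 := hz.integral_deriv_sq_mono ha hb hab
    have h2 : 0 ≤ 4 * normSq z * (timeMap z b - timeMap z a) := by
      have : 0 ≤ timeMap z b - timeMap z a := by linarith
      positivity
    nlinarith [mul_le_mul_of_nonneg_left h1 h2]
  intro s hs
  have h0 : Tendsto (fun t => (leviCivita z t - leviCivita z s) ^ 2) (𝓝[Icc 0 1] s) (𝓝 0) := by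
    refine tendsto_of_tendsto_of_tendsto_of_le_of_le' tendsto_const_nhds
      (h := fun t => (4 * normSq z * normSq (deriv z)) * |t - s|) ?_
      (Eventually.of_forall fun _ => sq_nonneg _)
      (eventually_nhdsWithin_of_forall fun t ht => key s hs t ht)
    have : ContinuousAt (fun t => (4 * normSq z * normSq (deriv z)) * |t - s|) s := by fun_prop
    have h := this.tendsto
    simp only [sub_self, abs_zero, mul_zero] at h
    exact h.mono_left nhdsWithin_le_nhds
  have h1 := (Real.continuous_sqrt.tendsto 0).comp h0
  simp only [Function.comp_def, Real.sqrt_sq_eq_abs, Real.sqrt_zero] at h1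
  exact tendsto_sub_nhds_zero_iff.1 ((tendsto_zero_iff_abs_tendsto_zero _).2 h1)

theorem leviCivita_nonneg (z : ℝ → ℝ) (t : ℝ) : 0 ≤ leviCivita z t := sq_nonneg _

/-- Surjectivity of `timeMap z.1` allows the separation condition to be stated in physical time,
where both electrons play the same role. -/
theorem mem_Hin_iff {z : (ℝ → ℝ) × (ℝ → ℝ)} : z ∈ Hin ↔ MemH1 z.1 ∧ MemH1 z.2 ∧ 0 < normSq z.1 ∧
    0 < normSq z.2 ∧ ∀ t, leviCivita z.2 t < leviCivita z.1 t := by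
  refine ⟨fun ⟨h1, h2, h3, h4, h5⟩ => ⟨h1, h2, h3, h4, fun t => ?_⟩,
    fun ⟨h1, h2, h3, h4, h5⟩ => ⟨h1, h2, h3, h4, fun τ => ?_⟩⟩
  · obtain ⟨τ, rfl⟩ := timeMap_surjective h1.continuous h1.1 h3 t
    rw [leviCivita_timeMap h1.continuous h3]
    exact sub_pos.1 (h5 τ)
  · have := h5 (timeMap z.1 τ)
    rw [leviCivita_timeMap h1.continuous h3] at this
    exact sub_pos.2 this

theorem interaction_eq {z : (ℝ → ℝ) × (ℝ → ℝ)} (hz : z ∈ Hin) :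
    interaction z = -∫ t in (0 : ℝ)..1, 1 / (leviCivita z.1 t - leviCivita z.2 t) := by
  obtain ⟨h1, h2, h3, h4, h5⟩ := mem_Hin_iff.1 hz
  have hc : Continuous fun t => 1 / (leviCivita z.1 t - leviCivita z.2 t) :=
    continuous_const.div ((h1.continuous_leviCivita h3).sub (h2.continuous_leviCivita h4))
      fun t => (sub_pos.2 (h5 t)).ne'
  rw [← integral_comp_timeMap h1.continuous h3 hc, interaction, neg_mul,
    ← intervalIntegral.integral_const_mul]
  congr 1
  refine intervalIntegral.integral_congr fun τ _ => ?_
  simp only [leviCivita_timeMap h1.continuous h3]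
  simp only [leviCivita]
  ring

/-! ### Small `H¹`-perturbations -/

/-- The neighbourhood filter of zero in `H¹(S¹, ℝ)`. -/
def h1Filter : Filter (ℝ → ℝ) := comap sobolevNorm (𝓝 0) ⊓ 𝓟 {v | MemH1 v}

theorem eventually_memH1 : ∀ᶠ v in h1Filter, MemH1 v :=
  (mem_inf_of_right (mem_principal_self _) : {v | MemH1 v} ∈ h1Filter)

theorem tendsto_sobolevNorm : Tendsto sobolevNorm h1Filter (𝓝 0) :=
  tendsto_comap.mono_left inf_le_left

theorem eventually_sobolevNorm_lt {δ : ℝ} (hδ : 0 < δ) : ∀ᶠ v in h1Filter, sobolevNorm v < δ :=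
  tendsto_sobolevNorm.eventually (gt_mem_nhds hδ)

theorem sq_add_sub_sq_le {z v : ℝ → ℝ} (hz : MemH1 z) (hv : MemH1 v) (h1 : sobolevNorm v ≤ 1)
    (τ : ℝ) : |(z + v) τ ^ 2 - z τ ^ 2| ≤ (8 * sobolevNorm z + 4) * sobolevNorm v := by
  have h2 := hz.abs_le τ
  have h3 := hv.abs_le τ
  have h4 : (z + v) τ ^ 2 - z τ ^ 2 = (2 * z τ + v τ) * v τ := by simp only [Pi.add_apply]; ring
  rw [h4, abs_mul]
  have h5 : |2 * z τ + v τ| ≤ 4 * sobolevNorm z + 2 := by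
    refine (abs_add_le _ _).trans ?_
    rw [abs_mul, abs_two]
    linarith
  calc _ ≤ (4 * sobolevNorm z + 2) * (2 * sobolevNorm v) :=
        mul_le_mul h5 h3 (abs_nonneg _) (by linarith [sobolevNorm_nonneg z])
    _ = _ := by ring

theorem abs_integral_le_of_Icc {f : ℝ → ℝ} {C τ : ℝ} (hf : ∀ x, |f x| ≤ C)
    (hτ : τ ∈ Icc (0 : ℝ) 1) : |∫ x in (0 : ℝ)..τ, f x| ≤ C := by
  have h := intervalIntegral.norm_integral_le_of_norm_le_const (a := 0) (b := τ) (f := f) (C := C)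
    (fun x _ => hf x)
  rw [sub_zero, abs_of_nonneg hτ.1, Real.norm_eq_abs] at h
  have hC : 0 ≤ C := (abs_nonneg _).trans (hf 0)
  nlinarith [hτ.2]

/-- The derivative of `z ↦ t_z(τ)` in direction `v`. -/
def timeMapDeriv (z v : ℝ → ℝ) (τ : ℝ) : ℝ :=
  (normSq z)⁻¹ * (2 * ∫ σ in (0 : ℝ)..τ, z σ * v σ) -
    (normSq z)⁻¹ * (2 * ∫ σ in (0 : ℝ)..1, z σ * v σ) * timeMap z τ

theorem integral_sq_add {z v : ℝ → ℝ} (hz : Continuous z) (hv : Continuous v) (τ : ℝ) :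
    ∫ σ in (0 : ℝ)..τ, (z + v) σ ^ 2 = (∫ σ in (0 : ℝ)..τ, z σ ^ 2)
      + (2 * ∫ σ in (0 : ℝ)..τ, z σ * v σ) + ∫ σ in (0 : ℝ)..τ, v σ ^ 2 := by
  have : (fun σ => (z + v) σ ^ 2) = fun σ => z σ ^ 2 + 2 * (z σ * v σ) + v σ ^ 2 := by
    funext σ; simp only [Pi.add_apply]; ring
  rw [this, intervalIntegral.integral_add, intervalIntegral.integral_add,
    intervalIntegral.integral_const_mul]
  all_goals exact Continuous.intervalIntegrable (by fun_prop) _ _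

theorem abs_integral_mul_le {z v : ℝ → ℝ} (hz : MemH1 z) (hv : MemH1 v) {τ : ℝ}
    (hτ : τ ∈ Icc (0 : ℝ) 1) :
    |∫ σ in (0 : ℝ)..τ, z σ * v σ| ≤ 4 * sobolevNorm z * sobolevNorm v := by
  refine abs_integral_le_of_Icc (fun x => ?_) hτ
  rw [abs_mul]
  calc _ ≤ (2 * sobolevNorm z) * (2 * sobolevNorm v) :=
        mul_le_mul (hz.abs_le x) (hv.abs_le x) (abs_nonneg _) (by linarith [sobolevNorm_nonneg z])
    _ = _ := by ring

theorem abs_integral_sq_le {v : ℝ → ℝ} (hv : MemH1 v) {τ : ℝ}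
    (hτ : τ ∈ Icc (0 : ℝ) 1) : |∫ σ in (0 : ℝ)..τ, v σ ^ 2| ≤ 4 * sobolevNorm v ^ 2 := by
  have := abs_integral_mul_le hv hv hτ
  simp only [← sq] at this
  linarith

theorem normSq_add {z v : ℝ → ℝ} (hz : Continuous z) (hv : Continuous v) :
    normSq (z + v) = normSq z + (2 * ∫ σ in (0 : ℝ)..1, z σ * v σ) + normSq v :=
  integral_sq_add hz hv 1

theorem eventually_normSq_add_gt {z : ℝ → ℝ} (hz : MemH1 z) (hm : 0 < normSq z) :
    ∀ᶠ v in h1Filter, normSq z / 2 < normSq (z + v) := by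
  have hδ : 0 < normSq z / 2 / (8 * sobolevNorm z + 1) := by
    have := sobolevNorm_nonneg z
    positivity
  filter_upwards [eventually_memH1, eventually_sobolevNorm_lt hδ] with v hv hlt
  rw [normSq_add hz.continuous hv.continuous]
  have h1 := abs_le.1 (abs_integral_mul_le hz hv (right_mem_Icc.2 zero_le_one))
  have h2 := normSq_nonneg v
  have h3 := sobolevNorm_nonneg z
  rw [lt_div_iff₀ (by linarith)] at hlt
  nlinarith [sobolevNorm_nonneg v]

theorem exists_abs_timeMapDeriv_le {z : ℝ → ℝ} (hz : MemH1 z) (hm : 0 < normSq z) :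
    ∃ C, 0 ≤ C ∧ ∀ v, MemH1 v → ∀ τ ∈ Icc (0 : ℝ) 1, |timeMapDeriv z v τ| ≤ C * sobolevNorm v := by
  refine ⟨(normSq z)⁻¹ * (16 * sobolevNorm z), ?_, fun v hv τ hτ => ?_⟩
  · have := sobolevNorm_nonneg z
    positivity
  have h1 := abs_integral_mul_le hz hv hτ
  have h2 := abs_integral_mul_le hz hv (right_mem_Icc.2 zero_le_one)
  have h3 := timeMap_mem_Icc hz.continuous hm hτ
  rw [timeMapDeriv, mul_assoc, ← mul_sub, abs_mul, abs_of_pos (inv_pos.2 hm),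
    mul_assoc _ (16 * sobolevNorm z)]
  refine mul_le_mul_of_nonneg_left ?_ (inv_pos.2 hm).le
  refine (abs_sub _ _).trans ?_
  rw [abs_mul, abs_mul, abs_mul, abs_two, abs_of_nonneg h3.1]
  nlinarith [h3.2, abs_nonneg (∫ σ in (0 : ℝ)..1, z σ * v σ), h3.1]

theorem exists_abs_timeMap_sub_le {z : ℝ → ℝ} (hz : MemH1 z) (hm : 0 < normSq z) :
    ∃ C, 0 ≤ C ∧ ∀ᶠ v in h1Filter, ∀ τ ∈ Icc (0 : ℝ) 1,
      |timeMap (z + v) τ - timeMap z τ - timeMapDeriv z v τ| ≤ C * sobolevNorm v ^ 2 := by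
  set m := normSq z with hmdef
  set Z := sobolevNorm z with hZ
  have hZ0 : 0 ≤ Z := sobolevNorm_nonneg z
  -- The bracket bounds the numerator in `key` divided by `n ^ 2`; the factor `2 / m ^ 3` comes from
  -- the denominator, which is at least `m ^ 3 / 2`.
  refine ⟨2 / m ^ 3 * (8 * m ^ 2 + (8 * Z + 4) * (16 * m * Z)), by positivity, ?_⟩
  filter_upwards [eventually_memH1, eventually_sobolevNorm_lt one_pos,
    eventually_normSq_add_gt hz hm] with v hv h1 h2 τ hτ
  set n := sobolevNorm v with hn
  have hn0 : 0 ≤ n := sobolevNorm_nonneg v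
  have hM := normSq_add hz.continuous hv.continuous
  have e1 := integral_sq_add hz.continuous hv.continuous τ
  have b1 := abs_integral_mul_le hz hv hτ
  have b2 := abs_integral_mul_le hz hv (right_mem_Icc.2 zero_le_one)
  have b3 := abs_integral_sq_le hv hτ
  have b4 : |normSq v| ≤ 4 * n ^ 2 := abs_integral_sq_le hv (right_mem_Icc.2 zero_le_one)
  have b5 := timeMap_mem_Icc hz.continuous hm hτ
  simp only [timeMapDeriv, timeMap] at b5 ⊢
  rw [e1, hM]
  rw [hM] at h2
  rw [← hmdef] at *
  set A := ∫ σ in (0 : ℝ)..τ, z σ ^ 2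
  set α := ∫ σ in (0 : ℝ)..τ, z σ * v σ
  set a := ∫ σ in (0 : ℝ)..1, z σ * v σ
  set β := ∫ σ in (0 : ℝ)..τ, v σ ^ 2
  set b := normSq v
  have hM0 : 0 < m + 2 * a + b := by linarith
  have hA : |m⁻¹ * A| ≤ 1 := abs_le.2 ⟨by linarith [b5.1], b5.2⟩
  have hA' : |A| ≤ m := by
    rw [abs_mul, abs_of_pos (inv_pos.2 hm), inv_mul_le_iff₀ hm, mul_one] at hA
    exact hA
  -- Exact remainder of a quotient of quadratic expressions in `v`: every term of the numerator is
  -- of second order.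
  have key : (m + 2 * a + b)⁻¹ * (A + 2 * α + β) - m⁻¹ * A -
      (m⁻¹ * (2 * α) - m⁻¹ * (2 * a) * (m⁻¹ * A)) =
      (m ^ 2 * β - m * A * b - (2 * a + b) * (m * (2 * α) - 2 * a * A))
        / (m ^ 2 * (m + 2 * a + b)) := by
    field_simp
    ring
  rw [key, abs_div, abs_of_pos (by positivity : 0 < m ^ 2 * (m + 2 * a + b)),
    div_le_iff₀ (by positivity)]
  have t1 : |m ^ 2 * β| ≤ m ^ 2 * (4 * n ^ 2) := by
    rw [abs_mul, abs_of_nonneg (sq_nonneg m)]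
    exact mul_le_mul_of_nonneg_left b3 (sq_nonneg m)
  have t2 : |m * A * b| ≤ m * m * (4 * n ^ 2) := by
    rw [abs_mul, abs_mul, abs_of_pos hm]
    exact mul_le_mul (mul_le_mul_of_nonneg_left hA' hm.le) b4 (abs_nonneg _) (by positivity)
  have t3 : |(2 * a + b) * (m * (2 * α) - 2 * a * A)|
      ≤ ((8 * Z + 4) * n) * (16 * m * Z * n) := by
    rw [abs_mul]
    refine mul_le_mul ?_ ?_ (abs_nonneg _) (by positivity)
    · refine (abs_add_le _ _).trans ?_
      rw [abs_mul, abs_two]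
      nlinarith
    · refine (abs_sub _ _).trans ?_
      rw [abs_mul, abs_mul, abs_mul, abs_mul, abs_two, abs_of_pos hm]
      have s1 : |a| * |A| ≤ 4 * Z * n * m := mul_le_mul b2 hA' (abs_nonneg _) (by positivity)
      have s2 : m * |α| ≤ m * (4 * Z * n) := mul_le_mul_of_nonneg_left b1 hm.le
      nlinarith
  have t4 : |m ^ 2 * β - m * A * b - (2 * a + b) * (m * (2 * α) - 2 * a * A)|
      ≤ (8 * m ^ 2 + (8 * Z + 4) * (16 * m * Z)) * n ^ 2 := by
    refine (abs_sub _ _).trans ((add_le_add ((abs_sub _ _).trans (add_le_add t1 t2)) t3).trans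
      (le_of_eq ?_))
    ring
  refine t4.trans ?_
  have t5 : m ^ 3 / 2 ≤ m ^ 2 * (m + 2 * a + b) := by nlinarith [sq_nonneg m]
  have t6 : 0 ≤ 2 / m ^ 3 * (8 * m ^ 2 + (8 * Z + 4) * (16 * m * Z)) * n ^ 2 := by positivity
  refine le_trans (le_of_eq ?_) (mul_le_mul_of_nonneg_left t5 t6)
  field_simp

theorem exists_abs_timeMap_sub_timeMap_le {z : ℝ → ℝ} (hz : MemH1 z) (hm : 0 < normSq z) :
    ∃ C, 0 ≤ C ∧ ∀ᶠ v in h1Filter, ∀ τ ∈ Icc (0 : ℝ) 1,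
      |timeMap (z + v) τ - timeMap z τ| ≤ C * sobolevNorm v := by
  obtain ⟨C₁, h1, hC₁⟩ := exists_abs_timeMapDeriv_le hz hm
  obtain ⟨C₂, h2, hC₂⟩ := exists_abs_timeMap_sub_le hz hm
  refine ⟨C₁ + C₂, by positivity, ?_⟩
  filter_upwards [eventually_memH1, hC₂, eventually_sobolevNorm_lt one_pos] with v hv h3 h4 τ hτ
  have h5 := hC₁ v hv τ hτ
  have h6 := h3 τ hτ
  have h7 := sobolevNorm_nonneg v
  have h8 := abs_add_le (timeMap (z + v) τ - timeMap z τ - timeMapDeriv z v τ) (timeMapDeriv z v τ)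
  rw [sub_add_cancel] at h8
  have h9 : C₂ * sobolevNorm v ^ 2 ≤ C₂ * sobolevNorm v :=
    mul_le_mul_of_nonneg_left (by nlinarith) h2
  linarith

/-- The Levi-Civita transform is better than `1/2`-Hölder continuous in `z`. -/
theorem eventually_sq_leviCivita_sub_le {z : ℝ → ℝ} (hz : MemH1 z) (hm : 0 < normSq z) {ε : ℝ}
    (hε : 0 < ε) : ∀ᶠ v in h1Filter, ∀ t,
      (leviCivita (z + v) t - leviCivita z t) ^ 2 ≤ ε * sobolevNorm v := by
  obtain ⟨C, hC0, hC⟩ := exists_abs_timeMap_sub_timeMap_le hz hm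
  set D := 8 * sobolevNorm z + 4 with hD
  have hD0 : 0 < D := by linarith [sobolevNorm_nonneg z]
  -- Global energy alone would give a bound `O(‖v‖)`. The two parameters with the same time `t` are
  -- separated by a short time only, so the local energy supplies the small factor. The bound on it
  -- makes this contribution at most `ε / 4 * ‖v‖`.
  obtain ⟨η, hη, hlt⟩ := hz.exists_integral_deriv_sq_lt hm
    (show 0 < ε / (16 * normSq z * (C + 1)) by positivity)
  have hδ₁ : 0 < ε / (4 * D ^ 2) := by positivity
  have hδ₂ : 0 < η / (C + 1) := by positivity
  filter_upwards [eventually_memH1, hC, eventually_sobolevNorm_lt one_pos,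
    eventually_sobolevNorm_lt hδ₁, eventually_sobolevNorm_lt hδ₂,
    eventually_normSq_add_gt hz hm] with v hv h1 h2 h3 h4 h5
  have hm' : 0 < normSq (z + v) := by linarith
  have hzv := hz.add hv
  have hn0 := sobolevNorm_nonneg v
  have key : ∀ t ∈ Icc (0 : ℝ) 1,
      (leviCivita (z + v) t - leviCivita z t) ^ 2 ≤ ε * sobolevNorm v := by
    intro t ht
    obtain ⟨a, ha, hat⟩ := exists_timeMap_eq hzv.continuous hm' ht
    obtain ⟨b, hb, hbt⟩ := exists_timeMap_eq hz.continuous hm ht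
    have e1 : leviCivita (z + v) t = (z + v) a ^ 2 := by
      rw [← hat, leviCivita_timeMap hzv.continuous hm']
    have e2 : leviCivita z t = z b ^ 2 := by rw [← hbt, leviCivita_timeMap hz.continuous hm]
    have e3 := sq_add_sub_sq_le hz hv h2.le a
    have e4 : |timeMap z b - timeMap z a| ≤ C * sobolevNorm v := by
      rw [hbt, ← hat]; exact h1 a ha
    have e5 : (z b ^ 2 - z a ^ 2) ^ 2 ≤ ε / 4 * sobolevNorm v := by
      have main : ∀ a ∈ Icc (0 : ℝ) 1, ∀ b ∈ Icc (0 : ℝ) 1, a ≤ b →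
          |timeMap z b - timeMap z a| ≤ C * sobolevNorm v →
          (z b ^ 2 - z a ^ 2) ^ 2 ≤ ε / 4 * sobolevNorm v := by
        intro a ha b hb hab h
        have h0 : 0 ≤ timeMap z b - timeMap z a := sub_nonneg.2 (timeMap_mono hz.continuous hab)
        rw [abs_of_nonneg h0] at h
        refine (hz.sq_sub_sq_le hm ha hb hab).trans ?_
        have h6 : timeMap z b - timeMap z a < η := by
          rw [lt_div_iff₀ (by linarith)] at h4
          nlinarith
        have h7 := (hlt a ha b hb hab h6).le
        have h8 : 0 ≤ ∫ x in a..b, deriv z x ^ 2 :=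
          intervalIntegral.integral_nonneg hab fun _ _ => sq_nonneg _
        calc _ ≤ 4 * normSq z * ((C + 1) * sobolevNorm v) * (ε / (16 * normSq z * (C + 1))) := by
              refine mul_le_mul (mul_le_mul_of_nonneg_left (by nlinarith) (by positivity)) h7 h8
                (by positivity)
          _ = _ := by field_simp; ring
      rcases le_total a b with hab | hab
      · exact main a ha b hb hab e4
      · rw [← neg_sub, neg_sq]
        exact main b hb a ha hab (by rwa [abs_sub_comm])
    rw [e1, e2]
    -- The other contribution, the change of `z²` at a fixed parameter, is even `O(‖v‖²)` after
    -- squaring. The two quarters combine to `ε` by `(x + y)² ≤ 2x² + 2y²`.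
    have e6 : ((z + v) a ^ 2 - z a ^ 2) ^ 2 ≤ ε / 4 * sobolevNorm v := by
      rw [← sq_abs]
      have h7 : |(z + v) a ^ 2 - z a ^ 2| ^ 2 ≤ (D * sobolevNorm v) ^ 2 :=
        pow_le_pow_left₀ (abs_nonneg _) e3 2
      refine h7.trans ?_
      rw [lt_div_iff₀ (by positivity)] at h3
      nlinarith
    nlinarith [sq_nonneg (((z + v) a ^ 2 - z a ^ 2) + (z b ^ 2 - z a ^ 2))]
  intro t
  rw [← periodic_fract (leviCivita_periodic hzv.continuous hzv.1 hm') t,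
    ← periodic_fract (leviCivita_periodic hz.continuous hz.1 hm) t]
  exact key _ ⟨Int.fract_nonneg t, (Int.fract_lt_one t).le⟩

/-! ### Differentiability of `z ↦ ∫ g(t) L(z)(t) dt` -/

theorem absolutelyContinuousOnInterval_of_hasDerivAt {f f' : ℝ → ℝ}
    (hf : ∀ x, HasDerivAt f (f' x) x) (hc : Continuous f') (a b : ℝ) :
    AbsolutelyContinuousOnInterval f a b := by
  have h1 : deriv f = f' := funext fun x => (hf x).deriv
  have h2 : ContDiff ℝ 1 f := by
    rw [contDiff_one_iff_deriv, h1]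
    exact ⟨fun x => (hf x).differentiableAt, hc⟩
  exact h2.contDiffOn.absolutelyContinuousOnInterval

/-- Integration by parts for a `C¹`-function and an `H¹`-function. -/
theorem MemH1.integral_mul_deriv_eq {u u' f : ℝ → ℝ} (hf : MemH1 f)
    (hu : ∀ x, HasDerivAt u (u' x) x) (hc : Continuous u') :
    ∫ x in (0 : ℝ)..1, u x * deriv f x
      = u 1 * f 1 - u 0 * f 0 - ∫ x in (0 : ℝ)..1, u' x * f x := by
  have := (absolutelyContinuousOnInterval_of_hasDerivAt hu hc 0 1).integral_mul_deriv_eq_deriv_mul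
    hf.2.1
  rwa [show deriv u = u' from funext fun x => (hu x).deriv] at this

/-- Integration by parts for a `C¹`-function and a product of `H¹`-functions. -/
theorem MemH1.integral_mul_deriv_mul_eq {u u' f v : ℝ → ℝ} (hf : MemH1 f) (hv : MemH1 v)
    (hu : ∀ x, HasDerivAt u (u' x) x) (hc : Continuous u') :
    ∫ x in (0 : ℝ)..1, u x * (deriv f x * v x + f x * deriv v x)
      = u 1 * (f 1 * v 1) - u 0 * (f 0 * v 0) - ∫ x in (0 : ℝ)..1, u' x * (f x * v x) := by
  have := (absolutelyContinuousOnInterval_of_hasDerivAt hu hc 0 1).integral_mul_deriv_eq_deriv_mul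
    (hf.2.1.fun_mul hv.2.1)
  rw [show deriv u = u' from funext fun x => (hu x).deriv] at this
  rw [← this]
  refine intervalIntegral.integral_congr_ae ?_
  rw [uIoc_of_le zero_le_one]
  filter_upwards [hf.ae_differentiableAt, hv.ae_differentiableAt] with x h1 h2 hx
  rw [((h1 hx).hasDerivAt.fun_mul (h2 hx).hasDerivAt).deriv]

theorem hasDerivAt_primitive_comp_timeMap {g z : ℝ → ℝ} (hg : Continuous g) (hz : Continuous z)
    (τ : ℝ) : HasDerivAt (fun τ => ∫ s in (0 : ℝ)..timeMap z τ, g s)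
      (g (timeMap z τ) * ((normSq z)⁻¹ * z τ ^ 2)) τ :=
  (hasDerivAt_integral_of_continuous hg 0 _).comp τ (hasDerivAt_timeMap hz τ)

/-- After integration by parts the time change enters only through the primitive of `g`, which is
`C¹`. This is what makes the pairing differentiable in `z` although `g` is merely continuous. -/
theorem integral_mul_leviCivita {g z : ℝ → ℝ} (hg : Continuous g) (hz : MemH1 z)
    (hm : 0 < normSq z) : ∫ t in (0 : ℝ)..1, g t * leviCivita z t =
      (∫ s in (0 : ℝ)..1, g s) * z 0 ^ 2 -
        ∫ τ in (0 : ℝ)..1, (∫ s in (0 : ℝ)..timeMap z τ, g s) * (2 * z τ * deriv z τ) := by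
  have hc := hz.continuous
  have hct := continuous_timeMap hc
  have h := hz.integral_mul_deriv_mul_eq hz (hasDerivAt_primitive_comp_timeMap hg hc)
    (by fun_prop)
  rw [timeMap_one hm, timeMap_zero, intervalIntegral.integral_same, zero_mul, sub_zero] at h
  rw [← integral_comp_timeMap hc hm (f := fun t => g t * leviCivita z t)
    (hg.mul (hz.continuous_leviCivita hm))]
  have e1 : ∀ τ, (deriv z τ * z τ + z τ * deriv z τ) = 2 * z τ * deriv z τ := fun τ => by ring
  simp only [e1] at h
  have hp : z 1 = z 0 := by simpa using hz.1 0
  have e2 : ∀ τ, g (timeMap z τ) * z τ ^ 2 * ((normSq z)⁻¹ * z τ ^ 2) =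
      g (timeMap z τ) * ((normSq z)⁻¹ * z τ ^ 2) * (z τ * z τ) := fun τ => by ring
  rw [h, hp]
  simp only [leviCivita_timeMap hc hm, e2]
  ring

/-- The change of energy `∫ g(t) dq` along `q = L(z)`, as a function of the new time. -/
def energyChange (g z : ℝ → ℝ) (τ : ℝ) : ℝ :=
  ∫ σ in (0 : ℝ)..τ, g (timeMap z σ) * (2 * z σ * deriv z σ)

/-- The weighted mean of `energyChange`. -/
def energyMean (g z : ℝ → ℝ) : ℝ :=
  (normSq z)⁻¹ * ∫ τ in (0 : ℝ)..1, energyChange g z τ * z τ ^ 2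

/-- The `L²`-gradient of `z ↦ ∫ g(t) L(z)(t) dt`. -/
def pairingGrad (g z : ℝ → ℝ) (τ : ℝ) : ℝ :=
  2 * (normSq z)⁻¹ * (g (timeMap z τ) * z τ ^ 3 + (energyChange g z τ - energyMean g z) * z τ)

theorem MemH1.intervalIntegrable_mul_deriv {z : ℝ → ℝ} (hz : MemH1 z) {u : ℝ → ℝ}
    (hu : Continuous u) (a b : ℝ) :
    IntervalIntegrable (fun σ => u σ * deriv z σ) volume a b :=
  (hz.intervalIntegrable_deriv' a b).continuousOn_mul hu.continuousOn

theorem MemH1.intervalIntegrable_energy {g z : ℝ → ℝ} (hg : Continuous g) (hz : MemH1 z)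
    (a b : ℝ) :
    IntervalIntegrable (fun σ => g (timeMap z σ) * (2 * z σ * deriv z σ)) volume a b := by
  have hc := hz.continuous
  have hct := continuous_timeMap hc
  have := hz.intervalIntegrable_mul_deriv (u := fun σ => g (timeMap z σ) * (2 * z σ))
    (by fun_prop) a b
  simpa only [mul_assoc] using this

theorem continuous_energyChange {g z : ℝ → ℝ} (hg : Continuous g) (hz : MemH1 z) :
    Continuous (energyChange g z) :=
  intervalIntegral.continuous_primitive (hz.intervalIntegrable_energy hg) 0

theorem hasDerivAt_timeMapDeriv {z v : ℝ → ℝ} (hz : Continuous z) (hv : Continuous v) (τ : ℝ) :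
    HasDerivAt (timeMapDeriv z v) ((normSq z)⁻¹ * (2 * (z τ * v τ)) -
      (normSq z)⁻¹ * (2 * ∫ σ in (0 : ℝ)..1, z σ * v σ) * ((normSq z)⁻¹ * z τ ^ 2)) τ :=
  (((hasDerivAt_integral_of_continuous (hz.mul hv) 0 τ).const_mul _).const_mul _).sub
    ((hasDerivAt_timeMap hz τ).const_mul _)

/-- Integration by parts against `energyChange`; the boundary terms vanish because `timeMapDeriv` is
zero at `1` and `energyChange` at `0`. The part of `timeMapDeriv` that keeps the total time equal to
`1` produces `energyMean`. -/
theorem integral_energy_mul_timeMapDeriv {g z v : ℝ → ℝ} (hg : Continuous g) (hz : MemH1 z)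
    (hm : 0 < normSq z) (hv : MemH1 v) :
    ∫ τ in (0 : ℝ)..1, timeMapDeriv z v τ * (g (timeMap z τ) * (2 * z τ * deriv z τ))
      = -∫ τ in (0 : ℝ)..1,
        2 * (normSq z)⁻¹ * ((energyChange g z τ - energyMean g z) * z τ) * v τ := by
  have hc := hz.continuous
  have hcv := hv.continuous
  have hct := continuous_timeMap hc
  have hK := continuous_energyChange hg hz
  have h := (absolutelyContinuousOnInterval_of_hasDerivAt (hasDerivAt_timeMapDeriv hc hcv)
    (by fun_prop) 0 1).integral_mul_deriv_eq_deriv_mul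
    ((hz.intervalIntegrable_energy hg 0 1).absolutelyContinuousOnInterval_intervalIntegral
      (c := 0) (by simp))
  rw [show deriv (timeMapDeriv z v) = _ from
    funext fun x => (hasDerivAt_timeMapDeriv hc hcv x).deriv] at h
  have h0 : timeMapDeriv z v 1 = 0 := by
    rw [timeMapDeriv, timeMap_one hm]; ring
  rw [h0, intervalIntegral.integral_same, zero_mul, mul_zero, sub_zero, zero_sub] at h
  have h1 : ∫ τ in (0 : ℝ)..1, timeMapDeriv z v τ * (g (timeMap z τ) * (2 * z τ * deriv z τ))
      = ∫ τ in (0 : ℝ)..1, timeMapDeriv z v τ * deriv (fun x => ∫ σ in (0 : ℝ)..x,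
          g (timeMap z σ) * (2 * z σ * deriv z σ)) τ := by
    refine intervalIntegral.integral_congr_ae ?_
    filter_upwards [(hz.intervalIntegrable_energy hg 0 1).ae_hasDerivAt_integral] with x hx hx'
    rw [(hx (uIoc_subset_uIcc hx') 0 (by simp)).deriv]
  rw [h1, h, neg_inj]
  change ∫ τ in (0 : ℝ)..1, _ * energyChange g z τ = _
  set a := ∫ σ in (0 : ℝ)..1, z σ * v σ with ha
  have e1 : ∀ τ, ((normSq z)⁻¹ * (2 * (z τ * v τ)) - (normSq z)⁻¹ * (2 * a) *
      ((normSq z)⁻¹ * z τ ^ 2)) * energyChange g z τ =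
      2 * (normSq z)⁻¹ * (energyChange g z τ * z τ * v τ) - 2 * (normSq z)⁻¹ * a * (normSq z)⁻¹ *
        (energyChange g z τ * z τ ^ 2) := fun τ => by ring
  have e2 : ∀ τ, 2 * (normSq z)⁻¹ * ((energyChange g z τ - energyMean g z) * z τ) * v τ =
      2 * (normSq z)⁻¹ * (energyChange g z τ * z τ * v τ) -
        2 * (normSq z)⁻¹ * energyMean g z * (z τ * v τ) := fun τ => by ring
  simp only [e1, e2]
  rw [intervalIntegral.integral_sub, intervalIntegral.integral_sub,
    intervalIntegral.integral_const_mul, intervalIntegral.integral_const_mul,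
    intervalIntegral.integral_const_mul, ← ha, energyMean]
  · ring
  all_goals exact Continuous.intervalIntegrable (by fun_prop) _ _

theorem continuous_pairingGrad {g z : ℝ → ℝ} (hg : Continuous g) (hz : MemH1 z) :
    Continuous (pairingGrad g z) := by
  have hc := hz.continuous
  have hct := continuous_timeMap hc
  have hK := continuous_energyChange hg hz
  unfold pairingGrad
  fun_prop

/-- The right-hand side is the formal derivative, in direction `v`, of the formula in
`integral_mul_leviCivita`; it is the form in which the remainder can be computed. -/
theorem integral_pairingGrad_mul {g z v : ℝ → ℝ} (hg : Continuous g) (hz : MemH1 z)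
    (hm : 0 < normSq z) (hv : MemH1 v) :
    ∫ τ in (0 : ℝ)..1, pairingGrad g z τ * v τ = (∫ s in (0 : ℝ)..1, g s) * (2 * (z 0 * v 0))
      - (∫ τ in (0 : ℝ)..1, (∫ s in (0 : ℝ)..timeMap z τ, g s) *
        (2 * (deriv z τ * v τ + z τ * deriv v τ)))
      - ∫ τ in (0 : ℝ)..1, timeMapDeriv z v τ * (g (timeMap z τ) * (2 * z τ * deriv z τ)) := by
  have hc := hz.continuous
  have hcv := hv.continuous
  have hct := continuous_timeMap hc
  have hK := continuous_energyChange hg hz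
  have h := hz.integral_mul_deriv_mul_eq hv (hasDerivAt_primitive_comp_timeMap hg hc)
    (by fun_prop)
  rw [timeMap_one hm, timeMap_zero, intervalIntegral.integral_same, zero_mul, sub_zero] at h
  have hp : z 1 = z 0 := by simpa using hz.1 0
  have hp' : v 1 = v 0 := by simpa using hv.1 0
  rw [integral_energy_mul_timeMapDeriv hg hz hm hv]
  have e1 : ∀ τ, (∫ s in (0 : ℝ)..timeMap z τ, g s) * (2 * (deriv z τ * v τ + z τ * deriv v τ))
    = 2 * ((∫ s in (0 : ℝ)..timeMap z τ, g s) * (deriv z τ * v τ + z τ * deriv v τ)) :=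
    fun τ => by ring
  simp only [e1]
  rw [intervalIntegral.integral_const_mul, h, hp, hp']
  have e2 : ∀ τ, pairingGrad g z τ * v τ =
      2 * (g (timeMap z τ) * ((normSq z)⁻¹ * z τ ^ 2) * (z τ * v τ)) +
      2 * (normSq z)⁻¹ * ((energyChange g z τ - energyMean g z) * z τ) * v τ := fun τ => by
    rw [pairingGrad]; ring
  simp only [e2]
  rw [intervalIntegral.integral_add, intervalIntegral.integral_const_mul]
  · ring
  all_goals exact Continuous.intervalIntegrable (by fun_prop) _ _

/-! ### First-order expansion of the pairing with a fixed weight. -/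

theorem continuous_primitive_of_continuous {g : ℝ → ℝ} (hg : Continuous g) (a : ℝ) :
    Continuous fun t => ∫ s in a..t, g s :=
  intervalIntegral.continuous_primitive (fun _ _ => hg.intervalIntegrable _ _) a

theorem exists_bound_primitive_sub {g : ℝ → ℝ} (hg : Continuous g) :
    ∃ M, 0 ≤ M ∧ (∀ t ∈ Icc (0 : ℝ) 1, |g t| ≤ M) ∧
      ∀ s ∈ Icc (0 : ℝ) 1, ∀ t ∈ Icc (0 : ℝ) 1, |∫ x in s..t, g x| ≤ M * |t - s| := by
  obtain ⟨M, hM⟩ := isCompact_Icc.exists_bound_of_continuousOn (s := Icc (0 : ℝ) 1)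
    hg.continuousOn
  refine ⟨M, (norm_nonneg _).trans (hM 0 (by simp)), hM, fun s hs t ht => ?_⟩
  exact intervalIntegral.norm_integral_le_of_norm_le_const (f := g) fun x hx =>
    hM x (uIcc_subset_Icc hs ht (uIoc_subset_uIcc hx))

theorem exists_primitive_sub_linear_le {g : ℝ → ℝ} (hg : Continuous g) {ε : ℝ} (hε : 0 < ε) :
    ∃ δ > 0, ∀ s ∈ Icc (0 : ℝ) 1, ∀ t ∈ Icc (0 : ℝ) 1, |t - s| < δ →
      |(∫ x in s..t, g x) - g s * (t - s)| ≤ ε * |t - s| := by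
  have hu := isCompact_Icc.uniformContinuousOn_of_continuous (s := Icc (0 : ℝ) 1) hg.continuousOn
  obtain ⟨δ, hδ, h⟩ := Metric.uniformContinuousOn_iff.1 hu ε hε
  refine ⟨δ, hδ, fun s hs t ht hst => ?_⟩
  have e : (∫ x in s..t, g x) - g s * (t - s) = ∫ x in s..t, (g x - g s) := by
    rw [intervalIntegral.integral_sub (hg.intervalIntegrable _ _) (by simp)]
    simp [mul_comm]
  rw [e]
  refine intervalIntegral.norm_integral_le_of_norm_le_const (f := fun x => g x - g s)
    fun x hx => ?_
  have hx' := uIoc_subset_uIcc hx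
  refine (h x (uIcc_subset_Icc hs ht hx') s hs ?_).le
  rw [Real.dist_eq]
  exact (abs_sub_left_of_mem_uIcc hx').trans_lt hst

theorem abs_integral_deriv_combination_le {z v F : ℝ → ℝ} (hz : MemH1 z) (hv : MemH1 v)
    {c₁ c₂ : ℝ} (h1 : 0 ≤ c₁) (h2 : 0 ≤ c₂)
    (hF : ∀ x ∈ Icc (0 : ℝ) 1, |F x| ≤ c₁ * |deriv z x| + c₂ * |deriv v x|) :
    |∫ x in (0 : ℝ)..1, F x| ≤ c₁ * sobolevNorm z + c₂ * sobolevNorm v := by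
  have i1 := hz.intervalIntegrable_deriv.abs.const_mul c₁
  have i2 := hv.intervalIntegrable_deriv.abs.const_mul c₂
  have h := intervalIntegral.norm_integral_le_of_norm_le (f := F) (zero_le_one' ℝ)
    (ae_of_all _ fun t ht => hF t (Ioc_subset_Icc_self ht)) (i1.add i2)
  rw [intervalIntegral.integral_add i1 i2, intervalIntegral.integral_const_mul,
    intervalIntegral.integral_const_mul] at h
  exact h.trans (add_le_add (mul_le_mul_of_nonneg_left hz.integral_abs_deriv_le h1)
    (mul_le_mul_of_nonneg_left hv.integral_abs_deriv_le h2))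

/-- The remainder in the first order expansion of `z ↦ ∫ g(t) L(z)(t) dt`. -/
theorem pairing_remainder_eq {g z v : ℝ → ℝ} (hg : Continuous g) (hz : MemH1 z)
    (hm : 0 < normSq z) (hv : MemH1 v) (hm' : 0 < normSq (z + v)) :
    (∫ t in (0 : ℝ)..1, g t * leviCivita (z + v) t) - (∫ t in (0 : ℝ)..1, g t * leviCivita z t)
      - ∫ τ in (0 : ℝ)..1, pairingGrad g z τ * v τ =
    (∫ s in (0 : ℝ)..1, g s) * v 0 ^ 2 - ∫ τ in (0 : ℝ)..1,
      (((∫ s in (0 : ℝ)..timeMap (z + v) τ, g s) - (∫ s in (0 : ℝ)..timeMap z τ, g s)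
          - timeMapDeriv z v τ * g (timeMap z τ)) * (2 * z τ * deriv z τ)
        + ((∫ s in (0 : ℝ)..timeMap (z + v) τ, g s) - ∫ s in (0 : ℝ)..timeMap z τ, g s)
          * (2 * (deriv z τ * v τ + z τ * deriv v τ))
        + (∫ s in (0 : ℝ)..timeMap (z + v) τ, g s) * (2 * v τ * deriv v τ)) := by
  have hzv := hz.add hv
  have hc := hz.continuous
  have hcv := hv.continuous
  have hct := continuous_timeMap hc
  have hct' := continuous_timeMap hzv.continuous
  have hG := continuous_primitive_of_continuous hg 0
  have hG1 := hG.comp hct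
  have hG2 := hG.comp hct'
  simp only [Function.comp_def] at hG1 hG2
  have hδ : Continuous (timeMapDeriv z v) :=
    continuous_iff_continuousAt.2 fun x => (hasDerivAt_timeMapDeriv hc hcv x).continuousAt
  rw [integral_mul_leviCivita hg hz hm, integral_mul_leviCivita hg hzv hm',
    integral_pairingGrad_mul hg hz hm hv]
  have e1 : ∫ τ in (0 : ℝ)..1, (∫ s in (0 : ℝ)..timeMap (z + v) τ, g s) *
        (2 * (z + v) τ * deriv (z + v) τ) =
      ∫ τ in (0 : ℝ)..1, (∫ s in (0 : ℝ)..timeMap (z + v) τ, g s) *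
        (2 * (z + v) τ * (deriv z τ + deriv v τ)) := by
    refine intervalIntegral.integral_congr_ae ?_
    rw [uIoc_of_le zero_le_one]
    filter_upwards [hz.ae_differentiableAt, hv.ae_differentiableAt] with x h1 h2 hx
    rw [deriv_add (h1 hx) (h2 hx)]
  rw [e1]
  set G₁ := fun τ => ∫ s in (0 : ℝ)..timeMap z τ, g s with hG₁
  set G₂ := fun τ => ∫ s in (0 : ℝ)..timeMap (z + v) τ, g s with hG₂
  have e2 : ∫ τ in (0 : ℝ)..1, G₂ τ * (2 * (z + v) τ * (deriv z τ + deriv v τ)) =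
      ∫ τ in (0 : ℝ)..1, (((G₂ τ - G₁ τ - timeMapDeriv z v τ * g (timeMap z τ))
        * (2 * z τ * deriv z τ) + (G₂ τ - G₁ τ) * (2 * (deriv z τ * v τ + z τ * deriv v τ))
        + G₂ τ * (2 * v τ * deriv v τ)) + G₁ τ * (2 * z τ * deriv z τ)
        + G₁ τ * (2 * (deriv z τ * v τ + z τ * deriv v τ))
        + timeMapDeriv z v τ * (g (timeMap z τ) * (2 * z τ * deriv z τ))) :=
    intervalIntegral.integral_congr fun τ _ => by simp only [Pi.add_apply]; ring
  have iz : ∀ u : ℝ → ℝ, Continuous u →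
      IntervalIntegrable (fun τ => u τ * (2 * z τ * deriv z τ)) volume 0 1 := fun u hu => by
    simpa only [mul_assoc] using
      hz.intervalIntegrable_mul_deriv (u := fun τ => u τ * (2 * z τ)) (by fun_prop) 0 1
  have iv : ∀ u : ℝ → ℝ, Continuous u →
      IntervalIntegrable (fun τ => u τ * (2 * v τ * deriv v τ)) volume 0 1 := fun u hu => by
    simpa only [mul_assoc] using
      hv.intervalIntegrable_mul_deriv (u := fun τ => u τ * (2 * v τ)) (by fun_prop) 0 1
  have izv : ∀ u : ℝ → ℝ, Continuous u → IntervalIntegrable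
      (fun τ => u τ * (2 * (deriv z τ * v τ + z τ * deriv v τ))) volume 0 1 := fun u hu => by
    have h1 := hz.intervalIntegrable_mul_deriv (u := fun τ => u τ * 2 * v τ) (by fun_prop) 0 1
    have h2 := hv.intervalIntegrable_mul_deriv (u := fun τ => u τ * 2 * z τ) (by fun_prop) 0 1
    refine (h1.add h2).congr fun τ _ => ?_
    ring
  have iR := ((iz (fun τ => G₂ τ - G₁ τ - timeMapDeriv z v τ * g (timeMap z τ))
    (by fun_prop)).add (izv (fun τ => G₂ τ - G₁ τ) (by fun_prop))).add (iv G₂ hG2)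
  have iT : IntervalIntegrable (fun τ => timeMapDeriv z v τ *
      (g (timeMap z τ) * (2 * z τ * deriv z τ))) volume 0 1 := by
    simpa only [mul_assoc] using iz (fun τ => timeMapDeriv z v τ * g (timeMap z τ)) (by fun_prop)
  rw [e2, intervalIntegral.integral_add ((iR.add (iz G₁ hG1)).add (izv G₁ hG1)) iT,
    intervalIntegral.integral_add (iR.add (iz G₁ hG1)) (izv G₁ hG1),
    intervalIntegral.integral_add iR (iz G₁ hG1)]
  simp only [Pi.add_apply]
  ring

/-- In `pairing_remainder_eq` all terms are quadratic in `v` except the first one under the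
integral. That one is `o(‖v‖)` because the primitive of `g` is uniformly differentiable on the unit
interval and `timeMapDeriv` approximates the change of time to second order. -/
theorem eventually_pairing_remainder_le {g z : ℝ → ℝ} (hg : Continuous g) (hz : MemH1 z)
    (hm : 0 < normSq z) {ε : ℝ} (hε : 0 < ε) : ∀ᶠ v in h1Filter,
    |(∫ t in (0 : ℝ)..1, g t * leviCivita (z + v) t) - (∫ t in (0 : ℝ)..1, g t * leviCivita z t)
      - ∫ τ in (0 : ℝ)..1, pairingGrad g z τ * v τ| ≤ ε * sobolevNorm v := by
  obtain ⟨M, hM0, hM, hMG⟩ := exists_bound_primitive_sub hg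
  obtain ⟨C, hC0, hC⟩ := exists_abs_timeMap_sub_timeMap_le hz hm
  obtain ⟨C₂, hC₂0, hC₂⟩ := exists_abs_timeMap_sub_le hz hm
  set Z := sobolevNorm z with hZ
  have hZ0 : 0 ≤ Z := sobolevNorm_nonneg z
  obtain ⟨δ, hδ, hlin⟩ := exists_primitive_sub_linear_le hg
    (show 0 < ε / (8 * (Z ^ 2 * C + 1)) by positivity)
  -- `B` collects the coefficients of `n ^ 2` in the final estimate. The only term linear in `n` is
  -- `4 * (Z ^ 2 * C * ε₁) * n`, at most `ε / 2 * n` by the choice of the linearization error.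
  set B := 4 * M + 4 * Z ^ 2 * M * C₂ + 8 * M * C * Z + 4 * M with hB
  have hB0 : 0 ≤ B := by positivity
  have hδ₁ : 0 < δ / (C + 1) := by positivity
  have hδ₂ : 0 < ε / (2 * (B + 1)) := by positivity
  filter_upwards [eventually_memH1, hC, hC₂, eventually_sobolevNorm_lt one_pos,
    eventually_sobolevNorm_lt hδ₁, eventually_sobolevNorm_lt hδ₂,
    eventually_normSq_add_gt hz hm] with v hv h1 h2 h3 h4 h5 h6
  have hm' : 0 < normSq (z + v) := by linarith
  have hzv := hz.add hv
  set n := sobolevNorm v with hn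
  have hn0 : 0 ≤ n := sobolevNorm_nonneg v
  rw [lt_div_iff₀ (by positivity)] at h4 h5
  rw [pairing_remainder_eq hg hz hm hv hm']
  set ε₁ := ε / (8 * (Z ^ 2 * C + 1)) with hε₁
  have hε₁0 : 0 < ε₁ := by positivity
  have bound := abs_integral_deriv_combination_le (F := fun τ =>
      (((∫ s in (0 : ℝ)..timeMap (z + v) τ, g s) - (∫ s in (0 : ℝ)..timeMap z τ, g s)
          - timeMapDeriv z v τ * g (timeMap z τ)) * (2 * z τ * deriv z τ)
        + ((∫ s in (0 : ℝ)..timeMap (z + v) τ, g s) - ∫ s in (0 : ℝ)..timeMap z τ, g s)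
          * (2 * (deriv z τ * v τ + z τ * deriv v τ))
        + (∫ s in (0 : ℝ)..timeMap (z + v) τ, g s) * (2 * v τ * deriv v τ))) hz hv
    (c₁ := (ε₁ * (C * n) + M * (C₂ * n ^ 2)) * (4 * Z) + M * (C * n) * (4 * n))
    (c₂ := M * (C * n) * (4 * Z) + M * (4 * n)) (by positivity) (by positivity) (by
      intro τ hτ
      have ht := timeMap_mem_Icc hz.continuous hm hτ
      have ht' := timeMap_mem_Icc hzv.continuous hm' hτ
      have a1 := h1 τ hτ
      have a2 := h2 τ hτ
      have a3 : (∫ s in (0 : ℝ)..timeMap (z + v) τ, g s) - (∫ s in (0 : ℝ)..timeMap z τ, g s)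
          = ∫ s in timeMap z τ..timeMap (z + v) τ, g s :=
        intervalIntegral.integral_interval_sub_left (hg.intervalIntegrable _ _)
          (hg.intervalIntegrable _ _)
      have a4 := hMG _ ht _ ht'
      have a5 := hlin _ ht _ ht' (by nlinarith)
      have a6 := hMG 0 (by simp) _ ht'
      rw [sub_zero, abs_of_nonneg ht'.1] at a6
      have a6' : |∫ s in (0 : ℝ)..timeMap (z + v) τ, g s| ≤ M := by nlinarith [ht'.2]
      rw [a3]
      set ρ := ∫ s in timeMap z τ..timeMap (z + v) τ, g s
      set θ := timeMap (z + v) τ - timeMap z τ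
      have a7 := hM _ ht
      have zb := hz.abs_le τ
      have vb := hv.abs_le τ
      have b1 : |ρ| ≤ M * (C * n) := a4.trans (mul_le_mul_of_nonneg_left a1 hM0)
      have b2 : |ρ - timeMapDeriv z v τ * g (timeMap z τ)| ≤ ε₁ * (C * n) + M * (C₂ * n ^ 2) := by
        have e : ρ - timeMapDeriv z v τ * g (timeMap z τ) =
          (ρ - g (timeMap z τ) * θ) + g (timeMap z τ) * (θ - timeMapDeriv z v τ) := by ring
        rw [e]
        refine (abs_add_le _ _).trans (add_le_add ?_ ?_)
        · exact a5.trans (mul_le_mul_of_nonneg_left a1 hε₁0.le)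
        · rw [abs_mul]
          exact mul_le_mul a7 a2 (abs_nonneg _) hM0
      have c1 : |2 * z τ * deriv z τ| ≤ 4 * Z * |deriv z τ| := by
        rw [abs_mul, abs_mul, abs_two]
        exact mul_le_mul_of_nonneg_right (by linarith) (abs_nonneg _)
      have c2 : |2 * (deriv z τ * v τ + z τ * deriv v τ)|
          ≤ 4 * n * |deriv z τ| + 4 * Z * |deriv v τ| := by
        rw [abs_mul, abs_two]
        have := abs_add_le (deriv z τ * v τ) (z τ * deriv v τ)
        rw [abs_mul, abs_mul] at this
        have d1 := mul_le_mul_of_nonneg_left vb (abs_nonneg (deriv z τ))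
        have d2 := mul_le_mul_of_nonneg_right zb (abs_nonneg (deriv v τ))
        linarith
      have c3 : |2 * v τ * deriv v τ| ≤ 4 * n * |deriv v τ| := by
        rw [abs_mul, abs_mul, abs_two]
        exact mul_le_mul_of_nonneg_right (by linarith) (abs_nonneg _)
      refine (abs_add_le _ _).trans ((add_le_add_left (abs_add_le _ _) _).trans ?_)
      have f1 := mul_le_mul b2 c1 (abs_nonneg _) (by positivity)
      have f2 := mul_le_mul b1 c2 (abs_nonneg _) (by positivity)
      have f3 := mul_le_mul a6' c3 (abs_nonneg _) hM0
      rw [← abs_mul] at f1 f2 f3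
      linarith)
  have hv0 : |(∫ s in (0 : ℝ)..1, g s) * v 0 ^ 2| ≤ M * (4 * n ^ 2) := by
    have a1 := hMG 0 (by simp) 1 (by simp)
    rw [sub_zero, abs_one, mul_one] at a1
    have a2 := hv.abs_le 0
    rw [abs_mul, abs_of_nonneg (sq_nonneg (v 0))]
    refine mul_le_mul a1 ?_ (sq_nonneg _) hM0
    rw [← sq_abs]
    have := pow_le_pow_left₀ (abs_nonneg (v 0)) a2 2
    linarith
  refine (abs_sub _ _).trans ((add_le_add hv0 bound).trans ?_)
  have e : M * (4 * n ^ 2) + (((ε₁ * (C * n) + M * (C₂ * n ^ 2)) * (4 * Z) + M * (C * n) * (4 * n)) * Z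
      + (M * (C * n) * (4 * Z) + M * (4 * n)) * n) =
      4 * (Z ^ 2 * C * ε₁) * n + B * n * n := by rw [hB]; ring
  rw [e]
  have g1 : Z ^ 2 * C * ε₁ ≤ ε / 8 := by
    have : (Z ^ 2 * C + 1) * ε₁ = ε / 8 := by rw [hε₁]; field_simp
    linarith
  have g2 : B * n ≤ ε / 2 := by nlinarith
  nlinarith [mul_le_mul_of_nonneg_right g1 hn0, mul_le_mul_of_nonneg_right g2 hn0]

/-! ### The differential of `B_in` -/

/-- The differential of `Q`. -/
def QDeriv (z v : ℝ → ℝ) : ℝ :=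
  4 * normSq (deriv z) * (∫ τ in (0 : ℝ)..1, z τ * v τ) +
    4 * normSq z * (∫ τ in (0 : ℝ)..1, deriv z τ * deriv v τ) -
    4 / normSq z ^ 2 * ∫ τ in (0 : ℝ)..1, z τ * v τ

theorem normSq_deriv_add {z v : ℝ → ℝ} (hz : MemH1 z) (hv : MemH1 v) :
    normSq (deriv (z + v)) = normSq (deriv z) +
      (2 * ∫ τ in (0 : ℝ)..1, deriv z τ * deriv v τ) + normSq (deriv v) := by
  have : normSq (deriv (z + v)) = ∫ τ in (0 : ℝ)..1,
      (deriv z τ ^ 2 + 2 * (deriv z τ * deriv v τ) + deriv v τ ^ 2) := by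
    refine intervalIntegral.integral_congr_ae ?_
    rw [uIoc_of_le zero_le_one]
    filter_upwards [hz.ae_differentiableAt, hv.ae_differentiableAt] with x h1 h2 hx
    rw [deriv_add (h1 hx) (h2 hx)]
    ring
  have i1 := hz.intervalIntegrable_deriv_sq
  have i2 := hv.intervalIntegrable_deriv_sq
  have i3 := (hz.intervalIntegrable_deriv_mul_deriv hv).const_mul 2
  rw [this, intervalIntegral.integral_add (i1.add i3) i2, intervalIntegral.integral_add i1 i3,
    intervalIntegral.integral_const_mul]
  rfl

theorem normSq_le_sq_sobolevNorm (v : ℝ → ℝ) : normSq v ≤ sobolevNorm v ^ 2 := by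
  rw [sq_sobolevNorm]; linarith [normSq_nonneg (deriv v)]

theorem normSq_deriv_le_sq_sobolevNorm (v : ℝ → ℝ) : normSq (deriv v) ≤ sobolevNorm v ^ 2 := by
  rw [sq_sobolevNorm]; linarith [normSq_nonneg v]

theorem abs_integral_deriv_mul_deriv_le {z v : ℝ → ℝ} (hz : MemH1 z) (hv : MemH1 v) :
    |∫ τ in (0 : ℝ)..1, deriv z τ * deriv v τ| ≤ sobolevNorm z * sobolevNorm v := by
  have h := sq_integral_mul_le zero_le_one hz.intervalIntegrable_deriv_sq
    hv.intervalIntegrable_deriv_sq (hz.intervalIntegrable_deriv_mul_deriv hv)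
  refine abs_le_of_sq_le_sq (h.trans ?_)
    (mul_nonneg (sobolevNorm_nonneg _) (sobolevNorm_nonneg _))
  rw [mul_pow]
  exact mul_le_mul (normSq_deriv_le_sq_sobolevNorm z) (normSq_deriv_le_sq_sobolevNorm v)
    (normSq_nonneg _) (sq_nonneg _)

theorem exists_Q_remainder_le {z : ℝ → ℝ} (hz : MemH1 z) (hm : 0 < normSq z) :
    ∃ C, 0 ≤ C ∧ ∀ᶠ v in h1Filter, |Q (z + v) - Q z - QDeriv z v| ≤ C * sobolevNorm v ^ 2 := by
  have hZ0 : 0 ≤ sobolevNorm z := sobolevNorm_nonneg z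
  set m := normSq z with hmd
  set k := normSq (deriv z) with hk
  have hk0 : 0 ≤ k := normSq_nonneg _
  set Z := sobolevNorm z with hZ
  refine ⟨2 * m + 2 * k + 2 * ((8 * Z + 1) * (2 * Z + 1)) + 2 * (8 * Z + 1) ^ 2 / (m ^ 2 * (m / 2))
    + 2 / m ^ 2, by positivity, ?_⟩
  filter_upwards [eventually_memH1, eventually_sobolevNorm_lt one_pos,
    eventually_normSq_add_gt hz hm] with v hv h1 h2
  have e1 := normSq_add hz.continuous hv.continuous
  have e2 := normSq_deriv_add hz hv
  have b1 := abs_integral_mul_le hz hv (right_mem_Icc.2 zero_le_one)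
  have b2 := abs_integral_deriv_mul_deriv_le hz hv
  have b3 := normSq_le_sq_sobolevNorm v
  have b4 := normSq_deriv_le_sq_sobolevNorm v
  have b5 := normSq_nonneg v
  have b6 := normSq_nonneg (deriv v)
  rw [e1] at h2
  simp only [Q, QDeriv]
  rw [e1, e2]
  rw [← hmd] at *
  set p := ∫ τ in (0 : ℝ)..1, z τ * v τ
  set p' := ∫ τ in (0 : ℝ)..1, deriv z τ * deriv v τ
  set n := sobolevNorm v with hn
  have hn0 : 0 ≤ n := sobolevNorm_nonneg v
  set w := normSq v
  set w' := normSq (deriv v)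
  have hM : 0 < m + 2 * p + w := by linarith
  -- Exact second-order remainder: `p`, `p'` are linear and `w`, `w'` quadratic in `v`.
  have key : 2 * (m + 2 * p + w) * (k + 2 * p' + w') + 2 / (m + 2 * p + w) - (2 * m * k + 2 / m)
      - (4 * k * p + 4 * m * p' - 4 / m ^ 2 * p) =
      2 * m * w' + 2 * k * w + 2 * ((2 * p + w) * (2 * p' + w'))
        + 2 * (2 * p + w) ^ 2 / (m ^ 2 * (m + 2 * p + w)) - 2 / m ^ 2 * w := by
    field_simp
    ring
  rw [key]
  have c1 : |2 * p + w| ≤ (8 * Z + 1) * n := by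
    refine (abs_add_le _ _).trans ?_
    rw [abs_mul, abs_two, abs_of_nonneg b5]
    nlinarith
  have c2 : |2 * p' + w'| ≤ (2 * Z + 1) * n := by
    refine (abs_add_le _ _).trans ?_
    rw [abs_mul, abs_two, abs_of_nonneg b6]
    nlinarith
  have d1 : |2 * m * w'| ≤ 2 * m * n ^ 2 := by
    rw [abs_of_nonneg (by positivity)]
    exact mul_le_mul_of_nonneg_left b4 (by positivity)
  have d2 : |2 * k * w| ≤ 2 * k * n ^ 2 := by
    rw [abs_of_nonneg (by positivity)]
    exact mul_le_mul_of_nonneg_left b3 (by positivity)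
  have d3 : |2 * ((2 * p + w) * (2 * p' + w'))| ≤ 2 * (((8 * Z + 1) * n) * ((2 * Z + 1) * n)) := by
    rw [abs_mul, abs_mul, abs_two]
    exact mul_le_mul_of_nonneg_left (mul_le_mul c1 c2 (abs_nonneg _) (by positivity)) zero_le_two
  have d4 : |2 * (2 * p + w) ^ 2 / (m ^ 2 * (m + 2 * p + w))|
      ≤ 2 * ((8 * Z + 1) * n) ^ 2 / (m ^ 2 * (m / 2)) := by
    rw [abs_of_nonneg (by positivity), ← sq_abs]
    gcongr
  have d5 : |2 / m ^ 2 * w| ≤ 2 / m ^ 2 * n ^ 2 := by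
    rw [abs_of_nonneg (by positivity)]
    exact mul_le_mul_of_nonneg_left b3 (by positivity)
  refine (abs_sub _ _).trans ((add_le_add ((abs_add_le _ _).trans (add_le_add
    ((abs_add_le _ _).trans (add_le_add ((abs_add_le _ _).trans (add_le_add d1 d2)) d3)) d4))
    d5).trans (le_of_eq ?_))
  field_simp

theorem eventually_Q_remainder_le {z : ℝ → ℝ} (hz : MemH1 z) (hm : 0 < normSq z) {ε : ℝ}
    (hε : 0 < ε) : ∀ᶠ v in h1Filter, |Q (z + v) - Q z - QDeriv z v| ≤ ε * sobolevNorm v := by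
  obtain ⟨C, hC0, hC⟩ := exists_Q_remainder_le hz hm
  filter_upwards [hC, eventually_sobolevNorm_lt (show 0 < ε / (C + 1) by positivity)] with v h1 h2
  rw [lt_div_iff₀ (by positivity)] at h2
  have := sobolevNorm_nonneg v
  refine h1.trans ?_
  rw [sq, ← mul_assoc]
  exact mul_le_mul_of_nonneg_right (by linarith) this

/-- The squared reciprocal distance `1 / (q₁ - q₂)²`. -/
def repulsion (z : (ℝ → ℝ) × (ℝ → ℝ)) (t : ℝ) : ℝ :=
  1 / (leviCivita z.1 t - leviCivita z.2 t) ^ 2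

/-- The partial differential of `B_in`, with `σ = 1` for the outer and `σ = -1` for the inner
electron. -/
def componentDeriv (σ : ℝ) (g z v : ℝ → ℝ) : ℝ :=
  QDeriv z v + σ * ∫ τ in (0 : ℝ)..1, pairingGrad g z τ * v τ

/-- The differential of `B_in`. -/
def BinDeriv (z v : (ℝ → ℝ) × (ℝ → ℝ)) : ℝ :=
  componentDeriv 1 (repulsion z) z.1 v.1 + componentDeriv (-1) (repulsion z) z.2 v.2

/-- The neighbourhood filter of zero in `H¹(S¹, ℝ²)`. -/
def h1Filter₂ : Filter ((ℝ → ℝ) × (ℝ → ℝ)) :=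
  comap h1Norm (𝓝 0) ⊓ 𝓟 {v | MemH1 v.1 ∧ MemH1 v.2}

theorem h1Norm_nonneg (v : (ℝ → ℝ) × (ℝ → ℝ)) : 0 ≤ h1Norm v := Real.sqrt_nonneg _

theorem eventually_memH1₂ : ∀ᶠ v in h1Filter₂, MemH1 v.1 ∧ MemH1 v.2 :=
  (mem_inf_of_right (mem_principal_self _) : {v | MemH1 v.1 ∧ MemH1 v.2} ∈ h1Filter₂)

theorem tendsto_h1Norm : Tendsto h1Norm h1Filter₂ (𝓝 0) :=
  tendsto_comap.mono_left inf_le_left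

theorem eventually_h1Norm_lt {δ : ℝ} (hδ : 0 < δ) : ∀ᶠ v in h1Filter₂, h1Norm v < δ :=
  tendsto_h1Norm.eventually (gt_mem_nhds hδ)

theorem tendsto_fst_h1Filter₂ : Tendsto Prod.fst h1Filter₂ h1Filter := by
  refine tendsto_inf.2 ⟨tendsto_comap_iff.2 ?_, tendsto_principal.2
    (eventually_memH1₂.mono fun v hv => hv.1)⟩
  exact squeeze_zero (fun v => sobolevNorm_nonneg _) sobolevNorm_fst_le tendsto_h1Norm

theorem tendsto_snd_h1Filter₂ : Tendsto Prod.snd h1Filter₂ h1Filter := by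
  refine tendsto_inf.2 ⟨tendsto_comap_iff.2 ?_, tendsto_principal.2
    (eventually_memH1₂.mono fun v hv => hv.2)⟩
  exact squeeze_zero (fun v => sobolevNorm_nonneg _) sobolevNorm_snd_le tendsto_h1Norm

/-! ### Fréchet differentiability of the functional and the weak form of criticality. -/

section Differentiability

variable {z : (ℝ → ℝ) × (ℝ → ℝ)}

theorem continuous_sub_leviCivita (hz : z ∈ Hin) :
    Continuous fun t => leviCivita z.1 t - leviCivita z.2 t := by
  obtain ⟨h1, h2, h3, h4, h5⟩ := mem_Hin_iff.1 hz
  exact (h1.continuous_leviCivita h3).sub (h2.continuous_leviCivita h4)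

theorem sub_leviCivita_pos (hz : z ∈ Hin) (t : ℝ) : 0 < leviCivita z.1 t - leviCivita z.2 t :=
  sub_pos.2 ((mem_Hin_iff.1 hz).2.2.2.2 t)

theorem continuous_repulsion (hz : z ∈ Hin) : Continuous (repulsion z) :=
  continuous_const.div ((continuous_sub_leviCivita hz).pow 2)
    fun t => (pow_pos (sub_leviCivita_pos hz t) 2).ne'

theorem exists_le_sub_leviCivita (hz : z ∈ Hin) :
    ∃ d > 0, ∀ t, d ≤ leviCivita z.1 t - leviCivita z.2 t := by
  obtain ⟨h1, h2, h3, h4, h5⟩ := mem_Hin_iff.1 hz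
  obtain ⟨t, -, ht⟩ := isCompact_Icc.exists_isMinOn (s := Icc (0 : ℝ) 1) ⟨0, by simp⟩
    (continuous_sub_leviCivita hz).continuousOn
  refine ⟨_, sub_leviCivita_pos hz t, fun s => ?_⟩
  rw [← periodic_fract (leviCivita_periodic h1.continuous h1.1 h3) s,
    ← periodic_fract (leviCivita_periodic h2.continuous h2.1 h4) s]
  exact ht ⟨Int.fract_nonneg s, (Int.fract_lt_one s).le⟩

/-- Openness of `Hin` with a uniform gap: once `‖v‖ < (d / 4) ^ 2`, each transform moves by at most
`d / 4`. -/
theorem eventually_sub_leviCivita (hz : z ∈ Hin) {d : ℝ} (hd : 0 < d)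
    (h : ∀ t, d ≤ leviCivita z.1 t - leviCivita z.2 t) :
    ∀ᶠ v in h1Filter₂, z + v ∈ Hin ∧
      ∀ t, d / 2 ≤ leviCivita (z + v).1 t - leviCivita (z + v).2 t := by
  obtain ⟨h1, h2, h3, h4, h5⟩ := mem_Hin_iff.1 hz
  filter_upwards [eventually_memH1₂,
    tendsto_fst_h1Filter₂.eventually (eventually_sq_leviCivita_sub_le h1 h3 one_pos),
    tendsto_snd_h1Filter₂.eventually (eventually_sq_leviCivita_sub_le h2 h4 one_pos),
    tendsto_fst_h1Filter₂.eventually (eventually_normSq_add_gt h1 h3),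
    tendsto_snd_h1Filter₂.eventually (eventually_normSq_add_gt h2 h4),
    eventually_h1Norm_lt (show 0 < (d / 4) ^ 2 by positivity)] with v hv e1 e2 e3 e4 e5
  have key : ∀ t, d / 2 ≤ leviCivita (z + v).1 t - leviCivita (z + v).2 t := by
    intro t
    have a1 := abs_le.1 (abs_le_of_sq_le_sq (a := leviCivita (z.1 + v.1) t - leviCivita z.1 t)
      (by have := e1 t; have := sobolevNorm_fst_le v; linarith) (show 0 ≤ d / 4 by positivity))
    have a2 := abs_le.1 (abs_le_of_sq_le_sq (a := leviCivita (z.2 + v.2) t - leviCivita z.2 t)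
      (by have := e2 t; have := sobolevNorm_snd_le v; linarith) (show 0 ≤ d / 4 by positivity))
    have a3 := h t
    simp only [Prod.fst_add, Prod.snd_add]
    linarith [a1.1, a2.2]
  refine ⟨mem_Hin_iff.2 ⟨h1.add hv.1, h2.add hv.2, by simpa using by linarith,
    by simpa using by linarith, fun t => ?_⟩, key⟩
  have := key t
  linarith

theorem eventually_interaction_remainder_le (hz : z ∈ Hin) {ε : ℝ} (hε : 0 < ε) :
    ∀ᶠ v in h1Filter₂, |interaction (z + v) - interaction z -
      ((∫ τ in (0 : ℝ)..1, pairingGrad (repulsion z) z.1 τ * v.1 τ) -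
        ∫ τ in (0 : ℝ)..1, pairingGrad (repulsion z) z.2 τ * v.2 τ)| ≤ ε * h1Norm v := by
  obtain ⟨h1, h2, h3, h4, h5⟩ := mem_Hin_iff.1 hz
  obtain ⟨d, hd, hdle⟩ := exists_le_sub_leviCivita hz
  have hg := continuous_repulsion hz
  have hε₁ : 0 < ε / 4 := by positivity
  -- With this bound on each squared displacement the numerator of `R` is at most `ε * d ^ 3 / 4 *
  -- ‖v‖`, while its denominator is at least `d ^ 3 / 2`.
  have hε₂ : 0 < ε * d ^ 3 / 16 := by positivity
  filter_upwards [eventually_sub_leviCivita hz hd hdle,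
    tendsto_fst_h1Filter₂.eventually (eventually_pairing_remainder_le hg h1 h3 hε₁),
    tendsto_snd_h1Filter₂.eventually (eventually_pairing_remainder_le hg h2 h4 hε₁),
    tendsto_fst_h1Filter₂.eventually (eventually_sq_leviCivita_sub_le h1 h3 hε₂),
    tendsto_snd_h1Filter₂.eventually (eventually_sq_leviCivita_sub_le h2 h4 hε₂)]
    with v hv e1 e2 e3 e4
  have n1 := sobolevNorm_fst_le v
  have n2 := sobolevNorm_snd_le v
  have hn := h1Norm_nonneg v
  obtain ⟨k1, k2, k3, k4, -⟩ := mem_Hin_iff.1 hv.1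
  rw [interaction_eq hz, interaction_eq hv.1]
  have c1 := h1.continuous_leviCivita h3
  have c2 := h2.continuous_leviCivita h4
  have c3 := k1.continuous_leviCivita k3
  have c4 := k2.continuous_leviCivita k4
  simp only [Prod.fst_add, Prod.snd_add] at c3 c4 hv ⊢
  have p1 := fun t => sub_leviCivita_pos hz t
  have p2 : ∀ t, 0 < leviCivita (z.1 + v.1) t - leviCivita (z.2 + v.2) t := fun t => by
    have := hv.2 t; linarith
  -- Exact expansion `1/b = 1/a - (b - a)/a² + (b - a)²/(a² b)` with `a`, `b` the old and new
  -- distances. The linear term is a pairing with the fixed weight `repulsion z`, so `L` itself is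
  -- never differentiated.
  set R := fun t => ((leviCivita (z.1 + v.1) t - leviCivita (z.2 + v.2) t) -
    (leviCivita z.1 t - leviCivita z.2 t)) ^ 2 / ((leviCivita z.1 t - leviCivita z.2 t) ^ 2 *
      (leviCivita (z.1 + v.1) t - leviCivita (z.2 + v.2) t)) with hR
  have cR : Continuous R := by
    refine Continuous.div (by fun_prop) (by fun_prop) fun t => ?_
    have := p1 t; have := p2 t; positivity
  have cI1 : Continuous fun t => 1 / (leviCivita z.1 t - leviCivita z.2 t) :=
    continuous_const.div (by fun_prop) fun t => (p1 t).ne'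
  have bR : |∫ t in (0 : ℝ)..1, R t| ≤ ε / 2 * h1Norm v := by
    refine abs_integral_le_of_Icc (fun t => ?_) (right_mem_Icc.2 zero_le_one)
    have q1 := p1 t
    have q2 := p2 t
    have q3 := hdle t
    have q4 := hv.2 t
    have a1 := e3 t
    have a2 := e4 t
    rw [hR, abs_of_nonneg (by positivity), div_le_iff₀ (by positivity)]
    have a3 : d ^ 2 * (d / 2) ≤ (leviCivita z.1 t - leviCivita z.2 t) ^ 2 *
      (leviCivita (z.1 + v.1) t - leviCivita (z.2 + v.2) t) := by gcongr
    have a4 : ε / 2 * h1Norm v * (d ^ 2 * (d / 2)) ≤ ε / 2 * h1Norm v *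
        ((leviCivita z.1 t - leviCivita z.2 t) ^ 2 *
        (leviCivita (z.1 + v.1) t - leviCivita (z.2 + v.2) t)) :=
      mul_le_mul_of_nonneg_left a3 (by positivity)
    refine le_trans ?_ a4
    have a5 : ε * d ^ 3 / 16 * sobolevNorm v.1 ≤ ε * d ^ 3 / 16 * h1Norm v :=
      mul_le_mul_of_nonneg_left n1 hε₂.le
    have a6 : ε * d ^ 3 / 16 * sobolevNorm v.2 ≤ ε * d ^ 3 / 16 * h1Norm v :=
      mul_le_mul_of_nonneg_left n2 hε₂.le
    nlinarith [sq_nonneg ((leviCivita (z.1 + v.1) t - leviCivita z.1 t) +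
      (leviCivita (z.2 + v.2) t - leviCivita z.2 t))]
  have e0 : ∫ t in (0 : ℝ)..1, 1 / (leviCivita (z.1 + v.1) t - leviCivita (z.2 + v.2) t) =
      ∫ t in (0 : ℝ)..1, (1 / (leviCivita z.1 t - leviCivita z.2 t)
        - repulsion z t * leviCivita (z.1 + v.1) t + repulsion z t * leviCivita z.1 t
        + repulsion z t * leviCivita (z.2 + v.2) t - repulsion z t * leviCivita z.2 t + R t) := by
    refine intervalIntegral.integral_congr fun t _ => ?_
    have q1 := (p1 t).ne'
    have q2 := (p2 t).ne'
    simp only [hR, repulsion]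
    field_simp
    ring
  rw [intervalIntegral.integral_add, intervalIntegral.integral_sub,
    intervalIntegral.integral_add, intervalIntegral.integral_add,
    intervalIntegral.integral_sub] at e0
  rotate_left
  iterate 10 exact Continuous.intervalIntegrable (by fun_prop) _ _
  rw [e0]
  have a5 : ε / 4 * sobolevNorm v.1 ≤ ε / 4 * h1Norm v := mul_le_mul_of_nonneg_left n1 hε₁.le
  have a6 : ε / 4 * sobolevNorm v.2 ≤ ε / 4 * h1Norm v := mul_le_mul_of_nonneg_left n2 hε₁.le
  have b1 := abs_le.1 e1
  have b2 := abs_le.1 e2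
  have b3 := abs_le.1 bR
  rw [abs_le]
  constructor <;> linarith [b1.1, b1.2, b2.1, b2.2, b3.1, b3.2]

/-- `B_in` is Fréchet differentiable on `H¹_in`. -/
theorem eventually_Bin_remainder_le (hz : z ∈ Hin) {ε : ℝ} (hε : 0 < ε) :
    ∀ᶠ v in h1Filter₂, |Bin (z + v) - Bin z - BinDeriv z v| ≤ ε * h1Norm v := by
  obtain ⟨h1, h2, h3, h4, h5⟩ := mem_Hin_iff.1 hz
  have hε₁ : 0 < ε / 3 := by positivity
  filter_upwards [eventually_interaction_remainder_le hz hε₁,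
    tendsto_fst_h1Filter₂.eventually (eventually_Q_remainder_le h1 h3 hε₁),
    tendsto_snd_h1Filter₂.eventually (eventually_Q_remainder_le h2 h4 hε₁)] with v e1 e2 e3
  have a5 := mul_le_mul_of_nonneg_left (sobolevNorm_fst_le v) hε₁.le
  have a6 := mul_le_mul_of_nonneg_left (sobolevNorm_snd_le v) hε₁.le
  have b1 := abs_le.1 e1
  have b2 := abs_le.1 e2
  have b3 := abs_le.1 e3
  simp only [Bin, BinDeriv, componentDeriv, Prod.fst_add, Prod.snd_add]
  rw [abs_le]
  constructor <;> linarith [b1.1, b1.2, b2.1, b2.2, b3.1, b3.2]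

theorem componentDeriv_const_smul (σ c : ℝ) (g u v : ℝ → ℝ) :
    componentDeriv σ g u (c • v) = c * componentDeriv σ g u v := by
  have e : ∀ f w : ℝ → ℝ, ∫ τ in (0 : ℝ)..1, f τ * (c • w) τ = c * ∫ τ in (0 : ℝ)..1, f τ * w τ := by
    intro f w
    rw [← intervalIntegral.integral_const_mul]
    refine intervalIntegral.integral_congr fun τ _ => ?_
    simp only [Pi.smul_apply, smul_eq_mul]
    ring
  simp only [componentDeriv, QDeriv, deriv_const_smul_fun, e]
  ring

theorem componentDeriv_zero (σ : ℝ) (g u : ℝ → ℝ) : componentDeriv σ g u 0 = 0 := by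
  simpa using componentDeriv_const_smul σ 0 g u 0

theorem h1Filter₂_hasBasis : h1Filter₂.HasBasis (fun δ : ℝ => 0 < δ)
    fun δ => {v | (MemH1 v.1 ∧ MemH1 v.2) ∧ h1Norm v < δ} := by
  have h := ((nhds_basis_abs_sub_lt (0 : ℝ)).comap h1Norm).inf_principal
    {v | MemH1 v.1 ∧ MemH1 v.2}
  refine h.to_hasBasis (fun δ hδ => ⟨δ, hδ, fun v hv => ⟨?_, hv.1⟩⟩)
    (fun δ hδ => ⟨δ, hδ, fun v hv => ⟨hv.2, ?_⟩⟩)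
  · have := hv.2
    simpa [abs_of_nonneg (h1Norm_nonneg v)] using this
  · have := hv.1
    simpa [abs_of_nonneg (h1Norm_nonneg v)] using this

/-- The differential is homogeneous in the direction, so evaluation along rays `s • v` with `s`
tending to `0` from above shows that it vanishes; directions with one zero component separate the
two electrons. -/
theorem isCriticalPoint_iff : IsCriticalPoint z ↔ z ∈ Hin ∧
    (∀ v, MemH1 v → componentDeriv 1 (repulsion z) z.1 v = 0) ∧
    (∀ v, MemH1 v → componentDeriv (-1) (repulsion z) z.2 v = 0) := by
  refine ⟨fun ⟨hz, hcrit⟩ => ?_, fun ⟨hz, hd1, hd2⟩ => ⟨hz, fun ε hε => ?_⟩⟩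
  · have key : ∀ v : (ℝ → ℝ) × (ℝ → ℝ), MemH1 v.1 → MemH1 v.2 → BinDeriv z v = 0 := by
      intro v hv1 hv2
      have bound : ∀ ε : ℝ, 0 < ε → |BinDeriv z v| ≤ 2 * ε * h1Norm v := by
        intro ε hε
        obtain ⟨δ, hδ, hcr⟩ := hcrit ε hε
        obtain ⟨d, hd, hdle⟩ := exists_le_sub_leviCivita hz
        have hev := (eventually_Bin_remainder_le hz hε).and
          ((eventually_sub_leviCivita hz hd hdle).and (eventually_h1Norm_lt hδ))
        have hs : Tendsto (fun s : ℝ => s • v) (𝓝[>] 0) h1Filter₂ := by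
          refine tendsto_inf.2 ⟨tendsto_comap_iff.2 ?_, tendsto_principal.2
            (Eventually.of_forall fun s => ⟨hv1.const_smul s, hv2.const_smul s⟩)⟩
          have : h1Norm ∘ (fun s : ℝ => s • v) = fun s => |s| * h1Norm v :=
            funext fun s => h1Norm_const_smul s v
          rw [this]
          have h : Tendsto (fun s : ℝ => |s| * h1Norm v) (𝓝 0) (𝓝 (|0| * h1Norm v)) :=
            Continuous.tendsto (by fun_prop) 0
          rw [abs_zero, zero_mul] at h
          exact h.mono_left nhdsWithin_le_nhds
        obtain ⟨s, ⟨e1, ⟨e2, -⟩, e3⟩, hs0⟩ := ((hs.eventually hev).and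
          (self_mem_nhdsWithin : ∀ᶠ s : ℝ in 𝓝[>] 0, s ∈ Ioi 0)).exists
        have hs0' : 0 < s := hs0
        have e4 := hcr (s • v) (hv1.const_smul s) (hv2.const_smul s) e2 e3
        have e5 : BinDeriv z (s • v) = s * BinDeriv z v := by
          simp only [BinDeriv, Prod.smul_fst, Prod.smul_snd, componentDeriv_const_smul]
          ring
        rw [e5, h1Norm_const_smul, abs_of_pos hs0'] at e1
        rw [h1Norm_const_smul, abs_of_pos hs0'] at e4
        have e6 : |s * BinDeriv z v| ≤ 2 * (ε * (s * h1Norm v)) := by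
          have b1 := abs_le.1 e1
          have b2 := abs_le.1 e4
          rw [abs_le]
          constructor <;> linarith [b1.1, b1.2, b2.1, b2.2]
        rw [abs_mul, abs_of_pos hs0'] at e6
        refine le_of_mul_le_mul_left ?_ hs0'
        linarith
      by_contra hne
      have hpos : 0 < |BinDeriv z v| := abs_pos.2 hne
      have hn := h1Norm_nonneg v
      have h := bound (|BinDeriv z v| / (4 * (h1Norm v + 1))) (by positivity)
      have h2 : 2 * (|BinDeriv z v| / (4 * (h1Norm v + 1))) * h1Norm v < |BinDeriv z v| := by
        rw [mul_div_assoc', div_mul_eq_mul_div, div_lt_iff₀ (by positivity)]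
        nlinarith
      linarith
    refine ⟨hz, fun v hv => ?_, fun v hv => ?_⟩
    · have := key (v, 0) hv MemH1.zero
      simpa [BinDeriv, componentDeriv_zero] using this
    · have := key (0, v) MemH1.zero hv
      simpa [BinDeriv, componentDeriv_zero] using this
  · obtain ⟨δ, hδ, h⟩ := h1Filter₂_hasBasis.eventually_iff.1 (eventually_Bin_remainder_le hz hε)
    refine ⟨δ, hδ, fun v hv1 hv2 _ hlt => ?_⟩
    have := h ⟨⟨hv1, hv2⟩, hlt⟩
    rwa [BinDeriv, hd1 _ hv1, hd2 _ hv2, add_zero, sub_zero] at this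

end Differentiability

/-! ### The Euler-Lagrange equation -/

theorem hasDerivAt_eq_zero_const {f : ℝ → ℝ} {a b : ℝ} (hab : a ≤ b) (hf : ContinuousOn f (Icc a b))
    (hd : ∀ x ∈ Ioo a b, HasDerivAt f 0 x) : f b = f a := by
  have := integral_eq_of_hasDerivAt_off_countable f (fun _ => 0) (a := a) (b := b)
    countable_empty (by rwa [uIcc_of_le hab])
    (by rw [min_eq_left hab, max_eq_right hab]; exact fun x hx => hd x hx.1) (by simp)
  simp only [intervalIntegral.integral_zero] at this
  linarith

theorem eq_of_hasDerivAt_eq_zero {f : ℝ → ℝ} (hd : ∀ x, HasDerivAt f 0 x) (x y : ℝ) : f x = f y :=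
  is_const_of_deriv_eq_zero (fun x => (hd x).differentiableAt) (fun x => (hd x).deriv) x y

theorem continuous_comp_fract {f : ℝ → ℝ} (hf : Continuous f) (h : f 0 = f 1) :
    Continuous fun x => f (Int.fract x) := by
  refine continuous_of_periodic_of_continuousOn (fun x => by simp) ?_
  refine hf.continuousOn.congr fun x hx => ?_
  rcases hx.2.lt_or_eq with h1 | rfl
  · rw [Int.fract_eq_self.2 ⟨hx.1, h1⟩]
  · simpa using h

theorem integral_comp_fract {f : ℝ → ℝ} {τ : ℝ} (hτ : τ ∈ Icc (0 : ℝ) 1) :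
    ∫ x in (0 : ℝ)..τ, f (Int.fract x) = ∫ x in (0 : ℝ)..τ, f x := by
  rw [intervalIntegral.integral_of_le hτ.1, intervalIntegral.integral_of_le hτ.1,
    integral_Ioc_eq_integral_Ioo, integral_Ioc_eq_integral_Ioo]
  refine setIntegral_congr_fun measurableSet_Ioo fun x hx => ?_
  simp only [Int.fract_eq_self.2 ⟨hx.1.le, hx.2.trans_le hτ.2⟩]

/-- The primitive of a continuous periodic function with mean zero is in `H¹`. -/
theorem memH1_primitive {f : ℝ → ℝ} (hf : Continuous f) (hp : Function.Periodic f 1)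
    (h0 : ∫ x in (0 : ℝ)..1, f x = 0) : MemH1 fun x => ∫ s in (0 : ℝ)..x, f s := by
  refine memH1_of_hasDerivAt (fun x => ?_) (hasDerivAt_integral_of_continuous hf 0) hf
  rw [← intervalIntegral.integral_add_adjacent_intervals (hf.intervalIntegrable 0 x)
    (hf.intervalIntegrable x (x + 1)), hp.intervalIntegral_add_eq x 0, zero_add, h0, add_zero]

/-- The du Bois-Reymond lemma: a weak solution of `z'' = b` with continuous right hand side is a
classical one. -/
theorem MemH1.exists_of_weak {z b : ℝ → ℝ} (hz : MemH1 z) (hb : Continuous b)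
    (h : ∀ v, MemH1 v → (∫ τ in (0 : ℝ)..1, deriv z τ * deriv v τ)
      + (∫ τ in (0 : ℝ)..1, b τ * v τ) = 0) :
    ∃ w, (∀ τ, HasDerivAt w (b τ) τ) ∧ w 1 = w 0 ∧
      ∀ τ ∈ Icc (0 : ℝ) 1, z τ = z 0 + ∫ σ in (0 : ℝ)..τ, w σ := by
  set β : ℝ → ℝ := fun τ => ∫ σ in (0 : ℝ)..τ, b σ with hβ
  have hβd : ∀ τ, HasDerivAt β (b τ) τ := hasDerivAt_integral_of_continuous hb 0
  have hβc : Continuous β := continuous_primitive_of_continuous hb 0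
  have hβ0 : β 0 = 0 := intervalIntegral.integral_same
  -- The constant test function shows that `b` has mean zero.
  have hβ1 : β 1 = 0 := by
    have hone : MemH1 fun _ => 1 :=
      memH1_of_hasDerivAt (fun _ => rfl) (fun x => hasDerivAt_const x 1) continuous_const
    have := h _ hone
    simpa using this
  set c := ∫ τ in (0 : ℝ)..1, β τ with hc
  have hfc := continuous_comp_fract hβc (hβ0.trans hβ1.symm)
  -- `b` is not assumed periodic, so `β` is extended periodically from the unit interval,
  -- continuously since its end values agree. Subtracting the mean `c` makes the primitive `ψ`
  -- periodic and `z - ψ` an admissible test function.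
  set ψ : ℝ → ℝ := fun x => ∫ s in (0 : ℝ)..x, (β (Int.fract s) - c) with hψ
  have hψd : ∀ x, HasDerivAt ψ (β (Int.fract x) - c) x :=
    hasDerivAt_integral_of_continuous (hfc.sub continuous_const) 0
  have hψm : MemH1 ψ := by
    refine memH1_primitive (hfc.sub continuous_const) (fun x => by simp) ?_
    rw [intervalIntegral.integral_sub (hfc.intervalIntegrable _ _) (by simp),
      integral_comp_fract (right_mem_Icc.2 zero_le_one)]
    simp [hc]
  have hv := hz.sub hψm
  set v := z - ψ with hvdef
  have hvd : ∀ᵐ x, x ∈ Ioc (0 : ℝ) 1 → deriv v x = deriv z x - β x + c := by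
    have h1 : ∀ᵐ x : ℝ, x ≠ 1 := by simp [ae_iff]
    filter_upwards [hz.ae_differentiableAt, h1] with x hx hx1 hx2
    rw [hvdef, deriv_sub (hx hx2) (hψd x).differentiableAt, (hψd x).deriv,
      Int.fract_eq_self.2 ⟨hx2.1.le, lt_of_le_of_ne hx2.2 hx1⟩]
    ring
  have hv01 : v 1 = v 0 := by simpa using hv.1 0
  have e1 := hv.integral_mul_deriv_eq hβd hb
  rw [hβ0, hβ1, zero_mul, zero_mul, sub_zero, zero_sub] at e1
  have e2 := h v hv
  have e3 : ∫ τ in (0 : ℝ)..1, deriv v τ = 0 := by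
    rw [hv.sub_eq_integral (by simp) (by simp), hv01, sub_self]
  -- As `v' = z' - β + c` almost everywhere, `∫ v'²` splits into `∫ z' v'` and `∫ β v'`, which agree
  -- by the weak equation and integration by parts, and `c ∫ v' = 0`.
  have e4 : ∫ τ in (0 : ℝ)..1, deriv v τ ^ 2 = 0 := by
    have i1 := hz.intervalIntegrable_deriv_mul_deriv hv
    have i2 := hv.intervalIntegrable_mul_deriv hβc 0 1
    have i3 := hv.intervalIntegrable_deriv.const_mul c
    have : ∫ τ in (0 : ℝ)..1, deriv v τ ^ 2 = ∫ τ in (0 : ℝ)..1,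
        (deriv z τ * deriv v τ - β τ * deriv v τ + c * deriv v τ) := by
      refine intervalIntegral.integral_congr_ae ?_
      rw [uIoc_of_le zero_le_one]
      filter_upwards [hvd] with x hx hx2
      rw [sq]
      nth_rewrite 1 [hx hx2]
      ring
    rw [this, intervalIntegral.integral_add (i1.sub i2) i3, intervalIntegral.integral_sub i1 i2,
      intervalIntegral.integral_const_mul, e3, e1]
    linarith
  have hconst : ∀ τ ∈ Icc (0 : ℝ) 1, v τ = v 0 := by
    intro τ hτ
    have a1 := sq_integral_mul_le (f := fun _ => 1) (g := deriv v) hτ.1 (by simp)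
      (hv.intervalIntegrable_deriv_sq' _ _) (by simpa using hv.intervalIntegrable_deriv' _ _)
    have a2 := hv.integral_deriv_sq_mono (left_mem_Icc.2 zero_le_one) hτ hτ.1
    simp only [one_mul, hv.sub_eq_integral (left_mem_Icc.2 zero_le_one) hτ, one_pow,
      intervalIntegral.integral_const, sub_zero, smul_eq_mul, mul_one] at a1
    have a3 : normSq (deriv v) = 0 := e4
    have a4 : 0 ≤ ∫ x in (0 : ℝ)..τ, deriv v x ^ 2 :=
      intervalIntegral.integral_nonneg hτ.1 fun _ _ => sq_nonneg _
    have a5 : ∫ x in (0 : ℝ)..τ, deriv v x ^ 2 = 0 := le_antisymm (a2.trans_eq a3) a4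
    rw [a5, mul_zero] at a1
    have := pow_eq_zero_iff (two_ne_zero) |>.1 (le_antisymm a1 (sq_nonneg (v τ - v 0)))
    linarith
  refine ⟨fun τ => β τ - c, fun τ => (hβd τ).sub_const c, by simp only [hβ0, hβ1], fun τ hτ => ?_⟩
  have a1 := hconst τ hτ
  have a2 : ψ τ = ∫ σ in (0 : ℝ)..τ, (β σ - c) :=
    integral_comp_fract (f := fun x => β x - c) hτ
  have a3 : ψ 0 = 0 := intervalIntegral.integral_same
  simp only [hvdef, Pi.sub_apply, a2, a3] at a1
  linarith

/-- The energy of the Levi-Civita transform of a critical point, as a function of the new time. -/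
def energyFun (σ : ℝ) (g z : ℝ → ℝ) (τ : ℝ) : ℝ :=
  2 * normSq z * normSq (deriv z) - 2 / normSq z + σ * (energyChange g z τ - energyMean g z)

theorem continuous_energyFun {g z : ℝ → ℝ} (σ : ℝ) (hg : Continuous g) (hz : MemH1 z) :
    Continuous (energyFun σ g z) := by
  have := continuous_energyChange hg hz
  unfold energyFun
  fun_prop

/-- Subtracting `energyMean` removes the interaction from the weighted mean of the energy. The
remaining value fixes the constant in the conservation law. -/
theorem integral_energyFun_mul {g z : ℝ → ℝ} (σ : ℝ) (hg : Continuous g) (hz : MemH1 z)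
    (hm : 0 < normSq z) : ∫ τ in (0 : ℝ)..1, energyFun σ g z τ * z τ ^ 2 =
      2 * normSq z ^ 2 * normSq (deriv z) - 2 := by
  have hK := continuous_energyChange hg hz
  have hc := hz.continuous
  have e : ∀ τ, energyFun σ g z τ * z τ ^ 2 = (2 * normSq z * normSq (deriv z) - 2 / normSq z
      - σ * energyMean g z) * z τ ^ 2 + σ * (energyChange g z τ * z τ ^ 2) := fun τ => by
    rw [energyFun]; ring
  simp only [e]
  rw [intervalIntegral.integral_add, intervalIntegral.integral_const_mul,
    intervalIntegral.integral_const_mul]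
  · change _ * normSq z + _ = _
    rw [energyMean]
    field_simp
    ring
  all_goals exact Continuous.intervalIntegrable (by fun_prop) _ _

/-- The right hand side of the Euler-Lagrange equation `z'' = …`. -/
def eulerLagrange (σ : ℝ) (g z : ℝ → ℝ) (τ : ℝ) : ℝ :=
  (energyFun σ g z τ * z τ + σ * g (timeMap z τ) * z τ ^ 3) / (2 * normSq z ^ 2)

theorem continuous_eulerLagrange {g z : ℝ → ℝ} (σ : ℝ) (hg : Continuous g) (hz : MemH1 z) :
    Continuous (eulerLagrange σ g z) := by
  have h1 := continuous_energyFun σ hg hz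
  have h2 := hz.continuous
  have h3 := continuous_timeMap h2
  unfold eulerLagrange
  fun_prop

theorem componentDeriv_eq {g z v : ℝ → ℝ} (σ : ℝ) (hg : Continuous g) (hz : MemH1 z)
    (hm : 0 < normSq z) (hv : MemH1 v) :
    componentDeriv σ g z v = 4 * normSq z * ((∫ τ in (0 : ℝ)..1, deriv z τ * deriv v τ)
      + ∫ τ in (0 : ℝ)..1, eulerLagrange σ g z τ * v τ) := by
  have e : ∀ τ, eulerLagrange σ g z τ * v τ =
      (normSq (deriv z) / normSq z - 1 / normSq z ^ 3) * (z τ * v τ)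
        + σ / (4 * normSq z) * (pairingGrad g z τ * v τ) := fun τ => by
    rw [eulerLagrange, energyFun, pairingGrad]
    field_simp
    ring
  have hc := hz.continuous
  have hcv := hv.continuous
  have hP := continuous_pairingGrad hg hz
  simp only [e]
  rw [intervalIntegral.integral_add, intervalIntegral.integral_const_mul,
    intervalIntegral.integral_const_mul, componentDeriv, QDeriv]
  · field_simp
    ring
  all_goals exact Continuous.intervalIntegrable (by fun_prop) _ _

/-- Regularity and conservation of energy on `[0, 1]`. -/
theorem exists_velocity {σ : ℝ} {g z : ℝ → ℝ} (hg : Continuous g) (hz : MemH1 z)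
    (hm : 0 < normSq z) (h : ∀ v, MemH1 v → componentDeriv σ g z v = 0) :
    ∃ w, (∀ τ, HasDerivAt w (eulerLagrange σ g z τ) τ) ∧ w 1 = w 0 ∧
      (∀ τ ∈ Icc (0 : ℝ) 1, z τ = z 0 + ∫ s in (0 : ℝ)..τ, w s) ∧
      (∀ τ ∈ Icc (0 : ℝ) 1, energyChange g z τ
        = ∫ s in (0 : ℝ)..τ, g (timeMap z s) * (2 * z s * w s)) ∧
      ∀ τ ∈ Icc (0 : ℝ) 1, 2 * normSq z ^ 2 * w τ ^ 2 - energyFun σ g z τ * z τ ^ 2 = 2 := by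
  obtain ⟨w, hw, hw1, hzw⟩ := hz.exists_of_weak (continuous_eulerLagrange σ hg hz) fun v hv => by
    have := h v hv
    rw [componentDeriv_eq σ hg hz hm hv] at this
    exact (mul_eq_zero.1 this).resolve_left (by positivity)
  have hwc : Continuous w := continuous_iff_continuousAt.2 fun x => (hw x).continuousAt
  have hc := hz.continuous
  have hct := continuous_timeMap hc
  have hK := continuous_energyChange hg hz
  have hE := continuous_energyFun σ hg hz
  -- The argument stays on the unit interval: `energyFun`, and with it the right-hand side, is not
  -- known to be periodic until the energy change over one period is shown to vanish.
  have hzd : ∀ x ∈ Ioo (0 : ℝ) 1, HasDerivAt z (w x) x := by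
    intro x hx
    refine ((hasDerivAt_integral_of_continuous hwc 0 x).const_add (z 0)).congr_of_eventuallyEq ?_
    filter_upwards [Ioo_mem_nhds hx.1 hx.2] with y hy using hzw y (Ioo_subset_Icc_self hy)
  have hKw : ∀ τ ∈ Icc (0 : ℝ) 1, energyChange g z τ
      = ∫ s in (0 : ℝ)..τ, g (timeMap z s) * (2 * z s * w s) := by
    intro τ hτ
    rw [energyChange, intervalIntegral.integral_of_le hτ.1, intervalIntegral.integral_of_le hτ.1,
      integral_Ioc_eq_integral_Ioo, integral_Ioc_eq_integral_Ioo]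
    refine setIntegral_congr_fun measurableSet_Ioo fun x hx => ?_
    simp only [(hzd x ⟨hx.1, hx.2.trans_le hτ.2⟩).deriv]
  have hEd : ∀ x ∈ Ioo (0 : ℝ) 1, HasDerivAt (energyFun σ g z)
      (σ * (g (timeMap z x) * (2 * z x * w x))) x := by
    intro x hx
    have h1 : HasDerivAt (energyChange g z) (g (timeMap z x) * (2 * z x * w x)) x := by
      refine (hasDerivAt_integral_of_continuous
        (f := fun s => g (timeMap z s) * (2 * z s * w s)) (by fun_prop) 0 x).congr_of_eventuallyEq ?_
      filter_upwards [Ioo_mem_nhds hx.1 hx.2] with y hy using hKw y (Ioo_subset_Icc_self hy)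
    exact ((h1.sub_const _).const_mul σ).const_add _
  have hconst : ∀ τ ∈ Icc (0 : ℝ) 1, 2 * normSq z ^ 2 * w τ ^ 2 - energyFun σ g z τ * z τ ^ 2 =
      2 * normSq z ^ 2 * w 0 ^ 2 - energyFun σ g z 0 * z 0 ^ 2 := by
    intro τ hτ
    refine hasDerivAt_eq_zero_const
      (f := fun τ => 2 * normSq z ^ 2 * w τ ^ 2 - energyFun σ g z τ * z τ ^ 2) hτ.1
      (by fun_prop) fun x hx => ?_
    have hx' : x ∈ Ioo (0 : ℝ) 1 := ⟨hx.1, hx.2.trans_le hτ.2⟩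
    have h1 := (((hw x).pow 2).const_mul (2 * normSq z ^ 2)).sub
      ((hEd x hx').mul ((hzd x hx').pow 2))
    refine h1.congr_deriv ?_
    rw [eulerLagrange, Pi.pow_apply]
    field_simp
    push_cast
    ring
  refine ⟨w, hw, hw1, hzw, hKw, fun τ hτ => ?_⟩
  -- The conserved quantity equals its own mean; in it the terms `2 ‖z‖⁴ ‖z'‖²` cancel and `2`
  -- remains.
  have i1 := integral_energyFun_mul σ hg hz hm
  have i2 : ∫ τ in (0 : ℝ)..1, w τ ^ 2 = normSq (deriv z) := by
    rw [normSq, intervalIntegral.integral_of_le zero_le_one,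
      intervalIntegral.integral_of_le zero_le_one,
      integral_Ioc_eq_integral_Ioo, integral_Ioc_eq_integral_Ioo]
    refine setIntegral_congr_fun measurableSet_Ioo fun x hx => ?_
    simp only [(hzd x hx).deriv]
  have i3 : ∫ τ in (0 : ℝ)..1, (2 * normSq z ^ 2 * w τ ^ 2 - energyFun σ g z τ * z τ ^ 2) =
      ∫ τ in (0 : ℝ)..1, (2 * normSq z ^ 2 * w 0 ^ 2 - energyFun σ g z 0 * z 0 ^ 2) :=
    intervalIntegral.integral_congr fun x hx => hconst x (by rwa [uIcc_of_le zero_le_one] at hx)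
  rw [intervalIntegral.integral_sub (Continuous.intervalIntegrable (by fun_prop) _ _)
    (Continuous.intervalIntegrable (by fun_prop) _ _), intervalIntegral.integral_const_mul, i1, i2,
    intervalIntegral.integral_const] at i3
  simp only [sub_zero, one_smul] at i3
  rw [hconst τ hτ, ← i3]
  ring

/-- Classical solutions of the Euler-Lagrange equation, with velocity `w` and energy `E`. -/
structure IsClassical (σ : ℝ) (g z w E : ℝ → ℝ) : Prop where
  continuous_g : Continuous g
  periodic : Function.Periodic z 1
  periodic_energy : Function.Periodic E 1
  normSq_pos : 0 < normSq z
  hasDerivAt : ∀ τ, HasDerivAt z (w τ) τ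
  hasDerivAt_velocity : ∀ τ, HasDerivAt w
    ((E τ * z τ + σ * g (timeMap z τ) * z τ ^ 3) / (2 * normSq z ^ 2)) τ
  hasDerivAt_energy : ∀ τ, HasDerivAt E (σ * (g (timeMap z τ) * (2 * z τ * w τ))) τ
  energy : ∀ τ, 2 * normSq z ^ 2 * w τ ^ 2 - E τ * z τ ^ 2 = 2

theorem energyChange_add_one {g z : ℝ → ℝ} (hg : Continuous g) (hgp : Function.Periodic g 1)
    (hz : MemH1 z) (hm : 0 < normSq z) (τ : ℝ) :
    energyChange g z (τ + 1) = energyChange g z τ + energyChange g z 1 := by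
  have hp : Function.Periodic (fun σ => g (timeMap z σ) * (2 * z σ * deriv z σ)) 1 := fun x => by
    simp only [timeMap_add_one hz.continuous hz.1 hm, hgp (timeMap z x), hz.1 x,
      periodic_deriv hz.1 x]
  have := hp.intervalIntegral_add_eq τ 0
  rw [zero_add] at this
  rw [energyChange, ← intervalIntegral.integral_add_adjacent_intervals
    (hz.intervalIntegrable_energy hg 0 τ) (hz.intervalIntegrable_energy hg τ (τ + 1)), this]
  rfl

/-- Zero energy change over a period makes in turn the energy, the right-hand side, the velocity and
its primitive `Z` periodic. The periodic functions `z` and `Z` agree on the unit interval, hence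
everywhere. -/
theorem exists_isClassical {σ : ℝ} {g z w : ℝ → ℝ} (hg : Continuous g)
    (hgp : Function.Periodic g 1) (hz : MemH1 z) (hm : 0 < normSq z)
    (hK : energyChange g z 1 = 0) (hw : ∀ τ, HasDerivAt w (eulerLagrange σ g z τ) τ)
    (hw1 : w 1 = w 0) (hzw : ∀ τ ∈ Icc (0 : ℝ) 1, z τ = z 0 + ∫ s in (0 : ℝ)..τ, w s)
    (hen : ∀ τ ∈ Icc (0 : ℝ) 1,
      2 * normSq z ^ 2 * w τ ^ 2 - energyFun σ g z τ * z τ ^ 2 = 2) :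
    IsClassical σ g z w (energyFun σ g z) := by
  have hc := hz.continuous
  have hct := continuous_timeMap hc
  have hwc : Continuous w := continuous_iff_continuousAt.2 fun x => (hw x).continuousAt
  have hEp : Function.Periodic (energyFun σ g z) 1 := fun τ => by
    rw [energyFun, energyChange_add_one hg hgp hz hm, hK, add_zero, energyFun]
  have hbp : Function.Periodic (eulerLagrange σ g z) 1 := fun τ => by
    rw [eulerLagrange, hEp, hz.1, timeMap_add_one hc hz.1 hm, hgp, eulerLagrange]
  have hwp : Function.Periodic w 1 := fun τ => by
    have h := eq_of_hasDerivAt_eq_zero (f := fun τ => w (τ + 1) - w τ) (fun x => by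
      have := ((hw (x + 1)).comp_add_const x 1).sub (hw x)
      rwa [hbp, sub_self] at this) τ 0
    simp only [zero_add, hw1, sub_self] at h
    linarith
  set Z : ℝ → ℝ := fun τ => z 0 + ∫ s in (0 : ℝ)..τ, w s with hZ
  have hZd : ∀ τ, HasDerivAt Z (w τ) τ := fun τ =>
    (hasDerivAt_integral_of_continuous hwc 0 τ).const_add (z 0)
  have hZp : Function.Periodic Z 1 := fun τ => by
    have h := eq_of_hasDerivAt_eq_zero (f := fun τ => Z (τ + 1) - Z τ) (fun x => by
      have := ((hZd (x + 1)).comp_add_const x 1).sub (hZd x)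
      rwa [hwp, sub_self] at this) τ 0
    have h1 := hzw 1 (by simp)
    have h2 := hzw 0 (by simp)
    have h3 : z 1 = z 0 := by simpa using hz.1 0
    simp only [zero_add] at h
    change z 1 = Z 1 at h1
    change z 0 = Z 0 at h2
    linarith
  have hzZ : z = Z := funext fun τ => by
    rw [← periodic_fract hz.1, ← periodic_fract hZp]
    exact hzw _ ⟨Int.fract_nonneg τ, (Int.fract_lt_one τ).le⟩
  have hzd : ∀ τ, HasDerivAt z (w τ) τ := by rw [hzZ]; exact hZd
  refine ⟨hg, hz.1, hEp, hm, hzd, hw, fun τ => ?_, fun τ => ?_⟩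
  · have hd : deriv z = w := funext fun τ => (hzd τ).deriv
    have h1 : HasDerivAt (energyChange g z) (g (timeMap z τ) * (2 * z τ * w τ)) τ := by
      have : energyChange g z = fun τ => ∫ s in (0 : ℝ)..τ, g (timeMap z s) * (2 * z s * w s) := by
        funext τ; rw [energyChange, hd]
      rw [this]
      exact hasDerivAt_integral_of_continuous
        (f := fun s => g (timeMap z s) * (2 * z s * w s)) (by fun_prop) 0 τ
    exact ((h1.sub_const _).const_mul σ).const_add _
  · rw [← periodic_fract hwp, ← periodic_fract hEp, ← periodic_fract hz.1]
    exact hen _ ⟨Int.fract_nonneg τ, (Int.fract_lt_one τ).le⟩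

/-! ### Classical solutions are weak solutions. -/

namespace IsClassical

variable {σ : ℝ} {g z w E : ℝ → ℝ}

theorem continuous (S : IsClassical σ g z w E) : Continuous z :=
  continuous_iff_continuousAt.2 fun x => (S.hasDerivAt x).continuousAt

theorem continuous_velocity (S : IsClassical σ g z w E) : Continuous w :=
  continuous_iff_continuousAt.2 fun x => (S.hasDerivAt_velocity x).continuousAt

theorem continuous_energy (S : IsClassical σ g z w E) : Continuous E :=
  continuous_iff_continuousAt.2 fun x => (S.hasDerivAt_energy x).continuousAt

theorem deriv_eq (S : IsClassical σ g z w E) : deriv z = w := funext fun x => (S.hasDerivAt x).deriv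

theorem memH1 (S : IsClassical σ g z w E) : MemH1 z :=
  memH1_of_hasDerivAt S.periodic S.hasDerivAt S.continuous_velocity

theorem periodic_velocity (S : IsClassical σ g z w E) : Function.Periodic w 1 := by
  rw [← S.deriv_eq]; exact periodic_deriv S.periodic

/-- The two functions have the same derivative, so they differ by a constant. Integrating the energy
identity against `integral_energyFun_mul` shows that this constant is zero, so the local equation
with an unspecified `E` is already the nonlocal Euler-Lagrange equation. -/
theorem energy_eq (S : IsClassical σ g z w E) : E = energyFun σ g z := by
  have hc := S.continuous
  have hcw := S.continuous_velocity
  have hcE := S.continuous_energy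
  have hct := continuous_timeMap hc
  have hg := S.continuous_g
  have hm := S.normSq_pos
  have hK : ∀ τ, HasDerivAt (energyFun σ g z) (σ * (g (timeMap z τ) * (2 * z τ * w τ))) τ := by
    intro τ
    have h1 : HasDerivAt (energyChange g z) (g (timeMap z τ) * (2 * z τ * w τ)) τ := by
      have : energyChange g z = fun τ => ∫ s in (0 : ℝ)..τ, g (timeMap z s) * (2 * z s * w s) := by
        funext τ; rw [energyChange, S.deriv_eq]
      rw [this]
      exact hasDerivAt_integral_of_continuous
        (f := fun s => g (timeMap z s) * (2 * z s * w s)) (by fun_prop) 0 τ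
    exact ((h1.sub_const _).const_mul σ).const_add _
  have hcE' := continuous_energyFun σ hg S.memH1
  have hconst := eq_of_hasDerivAt_eq_zero (f := fun τ => E τ - energyFun σ g z τ) (fun x => by
    have := (S.hasDerivAt_energy x).sub (hK x)
    rwa [sub_self] at this)
  have i1 := integral_energyFun_mul σ hg S.memH1 hm
  have i2 : ∫ τ in (0 : ℝ)..1, (2 * normSq z ^ 2 * w τ ^ 2 - E τ * z τ ^ 2)
      = ∫ τ in (0 : ℝ)..1, (2 : ℝ) := intervalIntegral.integral_congr fun x _ => S.energy x
  rw [intervalIntegral.integral_sub (Continuous.intervalIntegrable (by fun_prop) _ _)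
    (Continuous.intervalIntegrable (by fun_prop) _ _), intervalIntegral.integral_const_mul] at i2
  have i3 : ∫ τ in (0 : ℝ)..1, w τ ^ 2 = normSq (deriv z) := by rw [S.deriv_eq]; rfl
  have i4 : ∫ τ in (0 : ℝ)..1, E τ * z τ ^ 2 = (∫ τ in (0 : ℝ)..1, energyFun σ g z τ * z τ ^ 2)
      + (E 0 - energyFun σ g z 0) * normSq z := by
    rw [normSq, ← intervalIntegral.integral_const_mul, ← intervalIntegral.integral_add
      (Continuous.intervalIntegrable (by fun_prop) _ _)
      (Continuous.intervalIntegrable (by fun_prop) _ _)]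
    refine intervalIntegral.integral_congr fun x _ => ?_
    have : E 0 - energyFun σ g z 0 = E x - energyFun σ g z x := hconst 0 x
    simp only [this]
    ring
  rw [i3, i4, i1, intervalIntegral.integral_const] at i2
  simp only [sub_zero, one_smul] at i2
  have i5 : (E 0 - energyFun σ g z 0) * normSq z = 0 := by linarith
  have i6 := (mul_eq_zero.1 i5).resolve_right hm.ne'
  funext τ
  have := hconst τ 0
  simp only [i6] at this
  linarith

theorem componentDeriv_eq_zero (S : IsClassical σ g z w E) {v : ℝ → ℝ} (hv : MemH1 v) :
    componentDeriv σ g z v = 0 := by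
  rw [componentDeriv_eq σ S.continuous_g S.memH1 S.normSq_pos hv]
  have hw : ∀ τ, HasDerivAt w (eulerLagrange σ g z τ) τ := by
    have := S.hasDerivAt_velocity
    rwa [S.energy_eq] at this
  have h := hv.integral_mul_deriv_eq hw (continuous_eulerLagrange σ S.continuous_g S.memH1)
  have h1 : v 1 = v 0 := by simpa using hv.1 0
  have h2 : w 1 = w 0 := by simpa using S.periodic_velocity 0
  rw [S.deriv_eq, h, h1, h2]
  ring

theorem neg (S : IsClassical σ g z w E) : IsClassical σ g (-z) (-w) E := by
  have hn : normSq (-z) = normSq z := by simp [normSq]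
  have ht : timeMap (-z) = timeMap z := by funext τ; simp [timeMap, hn]
  refine ⟨S.continuous_g, fun τ => by simp [S.periodic τ], S.periodic_energy, hn ▸ S.normSq_pos,
    fun τ => (S.hasDerivAt τ).neg, fun τ => ?_, fun τ => ?_, fun τ => ?_⟩
  · refine (S.hasDerivAt_velocity τ).neg.congr_deriv ?_
    rw [hn, ht, Pi.neg_apply]
    ring
  · refine (S.hasDerivAt_energy τ).congr_deriv ?_
    rw [ht, Pi.neg_apply, Pi.neg_apply]
    ring
  · rw [hn, Pi.neg_apply, Pi.neg_apply, neg_sq, neg_sq]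
    exact S.energy τ

end IsClassical

/-! ### Functions with isolated zeros -/

theorem finite_zeros_Icc {f : ℝ → ℝ} (h : ∀ τ, ∀ᶠ x in 𝓝[≠] τ, f x ≠ 0) (a b : ℝ) :
    ({x | f x = 0} ∩ Icc a b).Finite := by
  by_contra hinf
  obtain ⟨x, -, hx⟩ := Set.Infinite.exists_accPt_of_subset_isCompact hinf isCompact_Icc
    inter_subset_right
  have h2 := (accPt_iff_frequently_nhdsNE.1 hx)
  exact h2 ((h x).mono fun y hy hy2 => hy hy2.1)

theorem countable_zeros {f : ℝ → ℝ} (h : ∀ τ, ∀ᶠ x in 𝓝[≠] τ, f x ≠ 0) :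
    {x | f x = 0}.Countable := by
  refine (countable_iUnion fun n : ℕ => (finite_zeros_Icc h (-n) n).countable).mono ?_
  intro x hx
  obtain ⟨n, hn⟩ := exists_nat_ge |x|
  exact mem_iUnion.2 ⟨n, hx, abs_le.1 hn⟩

theorem finite_zeroSet {f : ℝ → ℝ} (h : ∀ τ, ∀ᶠ x in 𝓝[≠] τ, f x ≠ 0) : (zeroSet f).Finite :=
  (finite_zeros_Icc h 0 1).subset fun _ hx => ⟨hx.2, Ico_subset_Icc_self hx.1⟩

/-- A continuous function with isolated zeros whose derivative off the zeros extends continuously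
is differentiable. -/
theorem hasDerivAt_of_off_countable {f f' : ℝ → ℝ} {s : Set ℝ} (hs : s.Countable)
    (hf : Continuous f) (hf' : Continuous f') (h : ∀ x ∉ s, HasDerivAt f (f' x) x) (x : ℝ) :
    HasDerivAt f (f' x) x := by
  have : f = fun x => f 0 + ∫ y in (0 : ℝ)..x, f' y := by
    funext x
    rw [integral_eq_of_hasDerivAt_off_countable f f' hs hf.continuousOn (fun y hy => h y hy.2)
      (hf'.intervalIntegrable _ _)]
    ring
  rw [this]
  exact (hasDerivAt_integral_of_continuous hf' 0 x).const_add _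

/-! ### The inverse time change when the zeros are isolated. -/

section Inverse

variable {z : ℝ → ℝ}

theorem timeMap_strictMono (hz : Continuous z) (hm : 0 < normSq z)
    (h : ∀ τ, ∀ᶠ x in 𝓝[≠] τ, z x ≠ 0) : StrictMono (timeMap z) := by
  intro a b hab
  refine lt_of_le_of_ne (timeMap_mono hz hab.le) fun heq => ?_
  have hfin := finite_zeros_Icc h a b
  have : Icc a b ⊆ {x | z x = 0} ∩ Icc a b := fun x hx =>
    ⟨eq_zero_of_timeMap_eq hz hm hab heq hx, hx⟩
  exact Icc_infinite hab (hfin.subset this)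

theorem timeMap_invTimeMap (hz : Continuous z) (hp : Function.Periodic z 1) (hm : 0 < normSq z)
    (t : ℝ) : timeMap z (invTimeMap z t) = t :=
  Function.invFun_eq (timeMap_surjective hz hp hm t)

theorem invTimeMap_timeMap (hz : Continuous z) (hm : 0 < normSq z)
    (h : ∀ τ, ∀ᶠ x in 𝓝[≠] τ, z x ≠ 0) (τ : ℝ) : invTimeMap z (timeMap z τ) = τ :=
  Function.leftInverse_invFun (timeMap_strictMono hz hm h).injective τ

theorem invTimeMap_eq (hz : Continuous z) (hm : 0 < normSq z)
    (h : ∀ τ, ∀ᶠ x in 𝓝[≠] τ, z x ≠ 0) {t τ : ℝ} (ht : timeMap z τ = t) : invTimeMap z t = τ := by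
  rw [← ht, invTimeMap_timeMap hz hm h]

theorem invTimeMap_strictMono (hz : Continuous z) (hp : Function.Periodic z 1)
    (hm : 0 < normSq z) : StrictMono (invTimeMap z) := by
  intro a b hab
  by_contra hle
  have := timeMap_mono hz (not_lt.1 hle)
  rw [timeMap_invTimeMap hz hp hm, timeMap_invTimeMap hz hp hm] at this
  linarith

theorem continuous_invTimeMap (hz : Continuous z) (hp : Function.Periodic z 1)
    (hm : 0 < normSq z) (h : ∀ τ, ∀ᶠ x in 𝓝[≠] τ, z x ≠ 0) : Continuous (invTimeMap z) :=
  (invTimeMap_strictMono hz hp hm).monotone.continuous_of_surjective fun τ =>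
    ⟨timeMap z τ, invTimeMap_timeMap hz hm h τ⟩

theorem invTimeMap_add_one (hz : Continuous z) (hp : Function.Periodic z 1)
    (hm : 0 < normSq z) (h : ∀ τ, ∀ᶠ x in 𝓝[≠] τ, z x ≠ 0) (t : ℝ) :
    invTimeMap z (t + 1) = invTimeMap z t + 1 :=
  invTimeMap_eq hz hm h (by rw [timeMap_add_one hz hp hm, timeMap_invTimeMap hz hp hm])

theorem hasDerivAt_invTimeMap (hz : Continuous z) (hp : Function.Periodic z 1)
    (hm : 0 < normSq z) (h : ∀ τ, ∀ᶠ x in 𝓝[≠] τ, z x ≠ 0) {t : ℝ} (ht : leviCivita z t ≠ 0) :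
    HasDerivAt (invTimeMap z) (normSq z / leviCivita z t) t := by
  have h1 := HasDerivAt.of_local_left_inverse
    (continuous_invTimeMap hz hp hm h).continuousAt (hasDerivAt_timeMap hz (invTimeMap z t))
    (mul_ne_zero (inv_ne_zero hm.ne') ht) (Eventually.of_forall (timeMap_invTimeMap hz hp hm))
  refine h1.congr_deriv ?_
  rw [mul_inv, inv_inv, div_eq_mul_inv]
  rfl

theorem image_timeMap_zeroSet (hz : Continuous z) (hp : Function.Periodic z 1)
    (hm : 0 < normSq z) (h : ∀ τ, ∀ᶠ x in 𝓝[≠] τ, z x ≠ 0) :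
    timeMap z '' zeroSet z = zeroSet (leviCivita z) := by
  have hmono := timeMap_strictMono hz hm h
  ext t
  constructor
  · rintro ⟨τ, ⟨hτ, hz0⟩, rfl⟩
    refine ⟨⟨?_, ?_⟩, ?_⟩
    · rw [← timeMap_zero (z := z)]; exact hmono.monotone hτ.1
    · rw [← timeMap_one hm]; exact hmono hτ.2
    · rw [leviCivita_timeMap hz hm, hz0]; norm_num
  · rintro ⟨ht, h0⟩
    refine ⟨invTimeMap z t, ⟨⟨?_, ?_⟩, ?_⟩, timeMap_invTimeMap hz hp hm t⟩
    · by_contra hlt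
      have := hmono (not_le.1 hlt)
      rw [timeMap_invTimeMap hz hp hm, timeMap_zero] at this
      linarith [ht.1]
    · by_contra hge
      have := hmono.monotone (not_lt.1 hge)
      rw [timeMap_invTimeMap hz hp hm, timeMap_one hm] at this
      linarith [ht.2]
    · exact pow_eq_zero_iff two_ne_zero |>.1 h0

theorem ncard_zeroSet_leviCivita (hz : Continuous z) (hp : Function.Periodic z 1)
    (hm : 0 < normSq z) (h : ∀ τ, ∀ᶠ x in 𝓝[≠] τ, z x ≠ 0) :
    (zeroSet (leviCivita z)).ncard = (zeroSet z).ncard := by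
  rw [← image_timeMap_zeroSet hz hp hm h]
  exact ncard_image_of_injective _ (timeMap_strictMono hz hm h).injective

end Inverse

/-! ### Classical solutions solve the equations of motion -/

namespace IsClassical

variable {σ : ℝ} {g z w E : ℝ → ℝ}

theorem velocity_sq (S : IsClassical σ g z w E) (τ : ℝ) :
    w τ ^ 2 = (2 + E τ * z τ ^ 2) / (2 * normSq z ^ 2) := by
  have := S.normSq_pos
  rw [eq_div_iff (by positivity)]
  linarith [S.energy τ]

/-- At a zero the energy identity reduces to `normSq z ^ 2 * w τ ^ 2 = 1`; all zeros are therefore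
simple. -/
theorem velocity_ne_zero (S : IsClassical σ g z w E) {τ : ℝ} (h : z τ = 0) : w τ ≠ 0 := by
  intro hw
  have := S.energy τ
  rw [h, hw] at this
  norm_num at this

theorem eventually_ne (S : IsClassical σ g z w E) (τ : ℝ) : ∀ᶠ x in 𝓝[≠] τ, z x ≠ 0 := by
  by_cases h : z τ = 0
  · exact (S.hasDerivAt τ).eventually_ne (S.velocity_ne_zero h)
  · exact (S.continuous.continuousAt.eventually_ne h).filter_mono nhdsWithin_le_nhds

theorem ne_zero_of_leviCivita {t : ℝ} (ht : leviCivita z t ≠ 0) : z (invTimeMap z t) ≠ 0 :=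
  fun h => ht (by rw [leviCivita, h]; norm_num)

theorem continuous_inv (S : IsClassical σ g z w E) : Continuous (invTimeMap z) :=
  continuous_invTimeMap S.continuous S.periodic S.normSq_pos S.eventually_ne

theorem hasDerivAt_inv (S : IsClassical σ g z w E) {t : ℝ} (ht : leviCivita z t ≠ 0) :
    HasDerivAt (invTimeMap z) (normSq z / leviCivita z t) t :=
  hasDerivAt_invTimeMap S.continuous S.periodic S.normSq_pos S.eventually_ne ht

theorem continuous_leviCivita (S : IsClassical σ g z w E) : Continuous (leviCivita z) :=
  S.memH1.continuous_leviCivita S.normSq_pos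

theorem hasDerivAt_leviCivita (S : IsClassical σ g z w E) {t : ℝ} (ht : leviCivita z t ≠ 0) :
    HasDerivAt (leviCivita z) (2 * normSq z * w (invTimeMap z t) / z (invTimeMap z t)) t := by
  have h1 := ((S.hasDerivAt (invTimeMap z t)).comp t (S.hasDerivAt_inv ht)).pow 2
  refine h1.congr_deriv ?_
  have hz := ne_zero_of_leviCivita ht
  rw [leviCivita, Function.comp_apply]
  field_simp
  push_cast
  ring

theorem hasDerivAt_velocity_leviCivita (S : IsClassical σ g z w E) {t : ℝ}
    (ht : leviCivita z t ≠ 0) :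
    HasDerivAt (fun t => 2 * normSq z * w (invTimeMap z t) / z (invTimeMap z t))
      (σ * g t - 2 / leviCivita z t ^ 2) t := by
  have hz := ne_zero_of_leviCivita ht
  have hm := S.normSq_pos.ne'
  have h0 := S.hasDerivAt_inv ht
  have h1 := (S.hasDerivAt (invTimeMap z t)).comp t h0
  have h2 := (S.hasDerivAt_velocity (invTimeMap z t)).comp t h0
  refine ((h2.const_mul (2 * normSq z)).div h1 hz).congr_deriv ?_
  rw [timeMap_invTimeMap S.continuous S.periodic S.normSq_pos]
  -- The quotient rule leaves a term in `w²`. Eliminating it by the energy identity cancels the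
  -- terms with `E` and leaves the nuclear force `-2 / q²`.
  have h3 := S.velocity_sq (invTimeMap z t)
  rw [leviCivita]
  simp only [Function.comp_apply]
  field_simp at h3 ⊢
  linear_combination (-1 : ℝ) * h3

theorem deriv_leviCivita_eventuallyEq (S : IsClassical σ g z w E) {t : ℝ}
    (ht : leviCivita z t ≠ 0) : deriv (leviCivita z) =ᶠ[𝓝 t]
      fun t => 2 * normSq z * w (invTimeMap z t) / z (invTimeMap z t) := by
  filter_upwards [S.continuous_leviCivita.continuousAt.eventually_ne ht] with s hs
  exact (S.hasDerivAt_leviCivita hs).deriv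

theorem hasDerivAt_deriv_leviCivita (S : IsClassical σ g z w E) {t : ℝ}
    (ht : leviCivita z t ≠ 0) :
    HasDerivAt (deriv (leviCivita z)) (σ * g t - 2 / leviCivita z t ^ 2) t :=
  (S.hasDerivAt_velocity_leviCivita ht).congr_of_eventuallyEq (S.deriv_leviCivita_eventuallyEq ht)

theorem isOpen_ne_zero {q : ℝ → ℝ} (hq : Continuous q) : IsOpen {t | q t ≠ 0} :=
  isOpen_ne_fun hq continuous_const

theorem contDiffOn_two (S : IsClassical σ g z w E) :
    ContDiffOn ℝ 2 (leviCivita z) {t | leviCivita z t ≠ 0} := by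
  have ho := isOpen_ne_zero S.continuous_leviCivita
  rw [show (2 : WithTop ℕ∞) = 1 + 1 by norm_num, contDiffOn_succ_iff_deriv_of_isOpen ho]
  refine ⟨fun t ht => (S.hasDerivAt_leviCivita ht).differentiableAt.differentiableWithinAt,
    fun h => by simp at h, ?_⟩
  rw [show (1 : WithTop ℕ∞) = 0 + 1 by norm_num, contDiffOn_succ_iff_deriv_of_isOpen ho]
  refine ⟨fun t ht => (S.hasDerivAt_deriv_leviCivita ht).differentiableAt.differentiableWithinAt,
    fun h => by simp at h, ?_⟩
  rw [contDiffOn_zero]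
  have hc : ContinuousOn (fun t => σ * g t - 2 / leviCivita z t ^ 2) {t | leviCivita z t ≠ 0} :=
    (continuous_const.mul S.continuous_g).continuousOn.sub (continuousOn_const.div
      (S.continuous_leviCivita.pow 2).continuousOn fun t ht => pow_ne_zero 2 ht)
  exact hc.congr fun t ht => (S.hasDerivAt_deriv_leviCivita ht).deriv

theorem energy_leviCivita (S : IsClassical σ g z w E) {t : ℝ} (ht : leviCivita z t ≠ 0) :
    E (invTimeMap z t) = (deriv (leviCivita z) t) ^ 2 / 2 - 2 / leviCivita z t := by
  have hz := ne_zero_of_leviCivita ht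
  have h := S.energy (invTimeMap z t)
  rw [(S.hasDerivAt_leviCivita ht).deriv, leviCivita]
  field_simp
  linarith

theorem energyExtends (S : IsClassical σ g z w E) : EnergyExtends (leviCivita z) := by
  refine ⟨fun t => E (invTimeMap z t), S.continuous_energy.comp S.continuous_inv, fun t => ?_,
    fun t ht => S.energy_leviCivita ht⟩
  simp only
  rw [invTimeMap_add_one S.continuous S.periodic S.normSq_pos S.eventually_ne, S.periodic_energy]

theorem periodic_leviCivita (S : IsClassical σ g z w E) : Function.Periodic (leviCivita z) 1 :=
  leviCivita_periodic S.continuous S.periodic S.normSq_pos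

theorem eventually_leviCivita_ne (S : IsClassical σ g z w E) (t : ℝ) :
    ∀ᶠ x in 𝓝[≠] t, leviCivita z x ≠ 0 := by
  have h1 : Tendsto (invTimeMap z) (𝓝[≠] t) (𝓝[≠] (invTimeMap z t)) :=
    tendsto_nhdsWithin_iff.2 ⟨S.continuous_inv.continuousAt.tendsto.mono_left nhdsWithin_le_nhds,
      eventually_nhdsWithin_of_forall fun x hx h =>
        hx ((invTimeMap_strictMono S.continuous S.periodic S.normSq_pos).injective h)⟩
  exact (h1.eventually (S.eventually_ne _)).mono fun x hx => pow_ne_zero 2 hx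

end IsClassical

theorem memH1_of_off_countable {q : ℝ → ℝ} (hq : Continuous q) (hp : Function.Periodic q 1)
    {s : Set ℝ} (hs : s.Countable) (hd : ∀ t ∉ s, DifferentiableAt ℝ q t)
    (hi : IntervalIntegrable (fun t => deriv q t ^ 2) volume 0 1) : MemH1 q := by
  have hi1 : IntervalIntegrable (deriv q) volume 0 1 := by
    rw [intervalIntegrable_iff_integrableOn_Ioc_of_le zero_le_one] at hi ⊢
    have := (memLp_two_iff_integrable_sq (aestronglyMeasurable_deriv q _)).2 hi
    exact this.integrable one_le_two
  have hi' := (periodic_deriv hp).intervalIntegrable₀ one_ne_zero hi1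
  have : q = fun t => q 0 + ∫ x in (0 : ℝ)..t, deriv q x := by
    funext t
    rw [integral_eq_of_hasDerivAt_off_countable q (deriv q) hs hq.continuousOn
      (fun y hy => (hd y hy.2).hasDerivAt) (hi' _ _)]
    ring
  refine memH1_of_absolutelyContinuousOn hp ?_ hi
  rw [this]
  exact (contDiff_const.contDiffOn.absolutelyContinuousOnInterval).fun_add
    (hi1.absolutelyContinuousOnInterval_intervalIntegral (by simp))

/-- By the energy, `q'² = 2E + 4/q` off the zeros, and `1/q` is integrable because up to the factor
`normSq z` it is the derivative of the monotone function `invTimeMap z`. -/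
theorem IsClassical.memH1_leviCivita {σ : ℝ} {g z w E : ℝ → ℝ} (S : IsClassical σ g z w E) :
    MemH1 (leviCivita z) := by
  have hcount := countable_zeros S.eventually_leviCivita_ne
  refine memH1_of_off_countable S.continuous_leviCivita S.periodic_leviCivita
    hcount (fun t ht => (S.hasDerivAt_leviCivita ht).differentiableAt) ?_
  have i1 : IntervalIntegrable (deriv (invTimeMap z)) volume 0 1 :=
    ((invTimeMap_strictMono S.continuous S.periodic S.normSq_pos).monotone.monotoneOn
      _).intervalIntegrable_deriv
  have i2 : IntervalIntegrable (fun t => 2 * E (invTimeMap z t)) volume 0 1 :=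
    (continuous_const.mul (S.continuous_energy.comp S.continuous_inv)).intervalIntegrable _ _
  refine (i2.add (i1.const_mul (4 / normSq z))).congr_ae ?_
  refine ae_restrict_of_ae ?_
  filter_upwards [hcount.ae_notMem volume] with t ht
  have ht' : leviCivita z t ≠ 0 := ht
  have h1 := S.energy_leviCivita ht'
  have hm := S.normSq_pos.ne'
  rw [(S.hasDerivAt_inv ht').deriv, h1]
  field_simp
  ring

/-! ### Functions with simple zeros -/

theorem eventually_sign_eq {α : Type*} {l : Filter α} {f : α → ℝ} {a : ℝ}
    (h : Tendsto f l (𝓝 a)) (ha : a ≠ 0) :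
    ∀ᶠ x in l, SignType.sign (f x) = SignType.sign a := by
  have := (continuousAt_sign_of_ne_zero ha).tendsto.comp h
  rw [nhds_discrete, tendsto_pure] at this
  exact this

/-- The product of two functions with the same simple zeros has constant sign. -/
theorem pos_or_neg_of_simple_zeros {f f' p p' : ℝ → ℝ} (hf : ∀ x, HasDerivAt f (f' x) x ∨ f x ≠ 0)
    (hfc : Continuous f) (hp : ∀ x, HasDerivAt p (p' x) x) (hz : ∀ x, f x = 0 ↔ p x = 0)
    (hf0 : ∀ x, f x = 0 → f' x ≠ 0) (hp0 : ∀ x, p x = 0 → p' x ≠ 0) :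
    (∀ x, f x ≠ 0 → 0 < f x * p x) ∨ ∀ x, f x ≠ 0 → f x * p x < 0 := by
  classical
  have hpc : Continuous p := continuous_iff_continuousAt.2 fun x => (hp x).continuousAt
  -- Near a common zero `c` the product is `(x - c)²` times a product of slopes tending to `f' c *
  -- p' c`. Filling in this limit at the zeros gives a nowhere vanishing function of locally
  -- constant sign.
  let r : ℝ → ℝ := fun x => if f x = 0 then f' x * p' x else f x * p x
  have hr : ∀ x, r x ≠ 0 := by
    intro x
    by_cases h : f x = 0
    · simp only [r, h, if_true]
      exact mul_ne_zero (hf0 x h) (hp0 x ((hz x).1 h))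
    · simp only [r, h, if_false]
      exact mul_ne_zero h fun h' => h ((hz x).2 h')
  have hloc : IsLocallyConstant fun x => SignType.sign (r x) := by
    rw [IsLocallyConstant.iff_eventually_eq]
    intro c
    by_cases h : f c = 0
    · have hrc : r c = f' c * p' c := by simp [r, h]
      have hd := (hf c).resolve_right (fun h' => h' h)
      have h1 := (hasDerivAt_iff_tendsto_slope.1 hd).mul (hasDerivAt_iff_tendsto_slope.1 (hp c))
      have h2 := eventually_sign_eq h1 (by rw [← hrc]; exact hr c)
      rw [eventually_nhdsWithin_iff] at h2
      filter_upwards [h2] with x hx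
      by_cases hxc : x = c
      · rw [hxc]
      have h3 := hx hxc
      rw [← hrc] at h3
      have h4 : f x * p x = (x - c) ^ 2 * (slope f c x * slope p c x) := by
        rw [slope_def_field, slope_def_field, h, (hz c).1 h]
        have := sub_ne_zero.2 hxc
        field_simp
        ring
      have h5 : SignType.sign (f x * p x) = SignType.sign (r c) := by
        have h6 : 0 < (x - c) ^ 2 := by
          have := sub_ne_zero.2 hxc
          positivity
        rw [h4, sign_mul, sign_pos h6, one_mul, h3]
      have h7 : f x ≠ 0 := by
        intro h0
        rw [h0, zero_mul, sign_zero] at h5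
        exact hr c (sign_eq_zero_iff.1 h5.symm)
      simp only [r, h7, if_false]
      simpa only [r] using h5
    · have hrc : r c = f c * p c := by simp [r, h]
      have h1 := eventually_sign_eq (hfc.mul hpc).continuousAt.tendsto
        (show f c * p c ≠ 0 by rw [← hrc]; exact hr c)
      filter_upwards [h1, hfc.continuousAt.eventually_ne h] with x hx hx2
      rw [hrc]
      simpa [r, hx2] using hx
  have hconst := fun x => hloc.apply_eq_of_isPreconnected isPreconnected_univ
    (mem_univ x) (mem_univ (0 : ℝ))
  rcases lt_or_gt_of_ne (hr 0) with h0 | h0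
  · right
    intro x hx
    have := hconst x
    rw [sign_neg h0] at this
    have := sign_eq_neg_one_iff.1 this
    simpa [r, hx] using this
  · left
    intro x hx
    have := hconst x
    rw [sign_pos h0] at this
    have := sign_eq_one_iff.1 this
    simpa [r, hx] using this

theorem sin_pi_mul_eq_zero_iff {x : ℝ} : Real.sin (Real.pi * x) = 0 ↔ ∃ n : ℤ, x = n := by
  rw [Real.sin_eq_zero_iff]
  refine exists_congr fun n => ?_
  rw [mul_comm, mul_right_inj' Real.pi_ne_zero, eq_comm]

/-- A trigonometric product with prescribed simple zeros. -/
theorem exists_simple_zeros {f : ℝ → ℝ} (hf : Function.Periodic f 1) (hfin : (zeroSet f).Finite) :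
    ∃ p p' : ℝ → ℝ, (∀ x, HasDerivAt p (p' x) x) ∧ (∀ x, f x = 0 ↔ p x = 0) ∧
      (∀ x, p x = 0 → p' x ≠ 0) ∧ ∀ x, p (x + 1) = (-1) ^ (zeroSet f).ncard * p x := by
  classical
  set Z := hfin.toFinset with hZ
  have hd : ∀ c x : ℝ, HasDerivAt (fun x => Real.sin (Real.pi * (x - c)))
      (Real.cos (Real.pi * (x - c)) * Real.pi) x := by
    intro c x
    have := (((hasDerivAt_id x).sub_const c).const_mul Real.pi).sin
    simpa using this
  have hzero : ∀ x c, c ∈ Z → Real.sin (Real.pi * (x - c)) = 0 → c = Int.fract x := by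
    intro x c hc h
    obtain ⟨n, hn⟩ := sin_pi_mul_eq_zero_iff.1 h
    have hc' : c ∈ zeroSet f := by simpa [hZ] using hc
    have : x = c + n := by linarith
    rw [this, Int.fract_add_intCast, Int.fract_eq_self.2 ⟨hc'.1.1, hc'.1.2⟩]
  have hiff : ∀ x, f x = 0 ↔ ∏ c ∈ Z, Real.sin (Real.pi * (x - c)) = 0 := by
    intro x
    rw [Finset.prod_eq_zero_iff]
    constructor
    · intro h
      refine ⟨Int.fract x, ?_, sin_pi_mul_eq_zero_iff.2 ⟨⌊x⌋, Int.self_sub_fract x⟩⟩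
      rw [hZ, Finite.mem_toFinset]
      exact ⟨⟨Int.fract_nonneg x, Int.fract_lt_one x⟩, by rw [periodic_fract hf, h]⟩
    · rintro ⟨c, hc, h⟩
      have hc' : c ∈ zeroSet f := by simpa [hZ] using hc
      rw [← periodic_fract hf, ← hzero x c hc h]
      exact hc'.2
  refine ⟨fun x => ∏ c ∈ Z, Real.sin (Real.pi * (x - c)), _,
    fun x => HasDerivAt.fun_finsetProd fun c _ => hd c x, hiff, fun x hx => ?_, fun x => ?_⟩
  · obtain ⟨c, hc, h⟩ := Finset.prod_eq_zero_iff.1 hx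
    rw [Finset.sum_eq_single_of_mem c hc]
    · rw [smul_eq_mul]
      refine mul_ne_zero (Finset.prod_ne_zero_iff.2 fun d hd h' => ?_)
        (mul_ne_zero (fun hcos => ?_) Real.pi_ne_zero)
      · have h1 := hzero x c hc h
        have h2 := hzero x d (Finset.mem_of_mem_erase hd) h'
        exact Finset.ne_of_mem_erase hd (h2.trans h1.symm)
      · have := Real.sin_sq_add_cos_sq (Real.pi * (x - c))
        rw [h, hcos] at this
        norm_num at this
    · intro d hd hdc
      rw [Finset.prod_eq_zero (Finset.mem_erase.2 ⟨hdc.symm, hc⟩) h, zero_smul]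
  -- Each factor `sin (π (x - c))` changes sign under translation by `1`, so the product is periodic
  -- or antiperiodic according to the parity of the number of zeros.
  · rw [ncard_eq_toFinset_card _ hfin, ← Finset.prod_const, ← Finset.prod_mul_distrib]
    refine Finset.prod_congr rfl fun c _ => ?_
    rw [show Real.pi * (x + 1 - c) = Real.pi * (x - c) + Real.pi by ring, Real.sin_add_pi]
    ring

namespace IsClassical

variable {σ : ℝ} {g z w E : ℝ → ℝ}

theorem exists_ne_zero (S : IsClassical σ g z w E) : ∃ τ, z τ ≠ 0 := by
  by_contra! h
  have := S.normSq_pos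
  simp [normSq, h] at this

/-- `z` times the trigonometric product `p` with the same zeros has constant sign. An odd number of
zeros would make `p` antiperiodic and, as `z` is periodic, would reverse that sign after one period.
-/
theorem even_ncard_zeroSet (S : IsClassical σ g z w E) : Even (zeroSet z).ncard := by
  obtain ⟨p, p', hp, hz, hp0, hadd⟩ := exists_simple_zeros S.periodic (finite_zeroSet S.eventually_ne)
  obtain ⟨τ, hτ⟩ := S.exists_ne_zero
  have hτ' : z (τ + 1) ≠ 0 := by rwa [S.periodic]
  have h := pos_or_neg_of_simple_zeros (fun x => Or.inl (S.hasDerivAt x)) S.continuous hp hz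
    (fun x hx => S.velocity_ne_zero hx) hp0
  by_contra hodd
  rw [Nat.not_even_iff_odd] at hodd
  have e : z (τ + 1) * p (τ + 1) = -(z τ * p τ) := by
    rw [S.periodic, hadd, hodd.neg_one_pow]; ring
  rcases h with h | h
  · have h1 := h τ hτ
    have h2 := h _ hτ'
    linarith
  · have h1 := h τ hτ
    have h2 := h _ hτ'
    linarith

theorem zeros_leviCivita (S : IsClassical σ g z w E) :
    (zeroSet (leviCivita z)).Finite ∧ Even (zeroSet (leviCivita z)).ncard := by
  refine ⟨finite_zeroSet S.eventually_leviCivita_ne, ?_⟩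
  rw [ncard_zeroSet_leviCivita S.continuous S.periodic S.normSq_pos S.eventually_ne]
  exact S.even_ncard_zeroSet

end IsClassical

/-! ### Bootstrapping -/

/-- Only one of the two derivatives gained is kept, which is enough for an induction. -/
theorem contDiffOn_add_two {q : ℝ → ℝ} {U : Set ℝ} {n : ℕ} (hU : IsOpen U)
    (h1 : DifferentiableOn ℝ q U) (h2 : DifferentiableOn ℝ (deriv q) U)
    (h3 : ContDiffOn ℝ n (deriv (deriv q)) U) : ContDiffOn ℝ ((n : WithTop ℕ∞) + 1) q U := by
  have h4 : ContDiffOn ℝ ((n : WithTop ℕ∞) + 1) (deriv q) U :=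
    (contDiffOn_succ_iff_deriv_of_isOpen hU).2 ⟨h2, fun h => by simp at h, h3⟩
  exact (contDiffOn_succ_iff_deriv_of_isOpen hU).2
    ⟨h1, fun h => by simp at h, h4.of_le (by exact_mod_cast Nat.le_succ n)⟩

theorem contDiffOn_infty_of_equations {q₁ q₂ : ℝ → ℝ} {U : Set ℝ} (hU : IsOpen U)
    (h1 : ∀ t ∈ U, q₁ t ≠ 0) (h2 : ∀ t ∈ U, q₂ t ≠ 0) (h12 : ∀ t ∈ U, q₁ t - q₂ t ≠ 0)
    (d1 : ContDiffOn ℝ 2 q₁ U) (d2 : ContDiffOn ℝ 2 q₂ U)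
    (e1 : ∀ t ∈ U, deriv (deriv q₁) t = -(2 / q₁ t ^ 2) + 1 / (q₁ t - q₂ t) ^ 2)
    (e2 : ∀ t ∈ U, deriv (deriv q₂) t = -(2 / q₂ t ^ 2) - 1 / (q₁ t - q₂ t) ^ 2) :
    ContDiffOn ℝ ∞ q₁ U ∧ ContDiffOn ℝ ∞ q₂ U := by
  have hdiff : ∀ q : ℝ → ℝ, ContDiffOn ℝ 2 q U →
      DifferentiableOn ℝ q U ∧ DifferentiableOn ℝ (deriv q) U := by
    intro q hq
    rw [show (2 : WithTop ℕ∞) = 1 + 1 by norm_num, contDiffOn_succ_iff_deriv_of_isOpen hU] at hq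
    exact ⟨hq.1, hq.2.2.differentiableOn one_ne_zero⟩
  have key : ∀ n : ℕ, ContDiffOn ℝ n q₁ U ∧ ContDiffOn ℝ n q₂ U := by
    intro n
    induction n with
    | zero => exact ⟨d1.of_le (by simp), d2.of_le (by simp)⟩
    | succ n ih =>
      have r0 : ContDiffOn ℝ n (fun t => 1 / (q₁ t - q₂ t) ^ 2) U :=
        contDiffOn_const.div ((ih.1.sub ih.2).pow 2) fun t ht => pow_ne_zero 2 (h12 t ht)
      have r1 : ContDiffOn ℝ n (fun t => -(2 / q₁ t ^ 2)) U :=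
        (contDiffOn_const.div (ih.1.pow 2) fun t ht => pow_ne_zero 2 (h1 t ht)).neg
      have r2 : ContDiffOn ℝ n (fun t => -(2 / q₂ t ^ 2)) U :=
        (contDiffOn_const.div (ih.2.pow 2) fun t ht => pow_ne_zero 2 (h2 t ht)).neg
      push_cast
      exact ⟨contDiffOn_add_two hU (hdiff _ d1).1 (hdiff _ d1).2 ((r1.add r0).congr e1),
        contDiffOn_add_two hU (hdiff _ d2).1 (hdiff _ d2).2 ((r2.sub r0).congr e2)⟩
  exact ⟨contDiffOn_infty.2 fun n => (key n).1, contDiffOn_infty.2 fun n => (key n).2⟩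

/-! ### Critical points give generalized solutions -/

section Critical

variable {z : (ℝ → ℝ) × (ℝ → ℝ)}

theorem periodic_repulsion (hz : z ∈ Hin) : Function.Periodic (repulsion z) 1 := by
  obtain ⟨h1, h2, h3, h4, h5⟩ := mem_Hin_iff.1 hz
  intro t
  rw [repulsion, leviCivita_periodic h1.continuous h1.1 h3,
    leviCivita_periodic h2.continuous h2.1 h4, repulsion]

theorem leviCivita_fst_ne_zero (hz : z ∈ Hin) (t : ℝ) : leviCivita z.1 t ≠ 0 :=
  ((leviCivita_nonneg z.2 t).trans_lt ((mem_Hin_iff.1 hz).2.2.2.2 t)).ne'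

theorem fst_ne_zero (hz : z ∈ Hin) (τ : ℝ) : z.1 τ ≠ 0 := by
  obtain ⟨h1, h2, h3, h4, h5⟩ := mem_Hin_iff.1 hz
  intro h
  apply leviCivita_fst_ne_zero hz (timeMap z.1 τ)
  rw [leviCivita_timeMap h1.continuous h3, h]
  norm_num

/-- Comparing the energy identity at `0` and `1`, where position and velocity agree, gives
`energyChange 1 * z.1 0 ^ 2 = 0`. The outer electron never vanishes, so the energy closes up. -/
theorem exists_isClassical_fst (hz : z ∈ Hin)
    (h : ∀ v, MemH1 v → componentDeriv 1 (repulsion z) z.1 v = 0) :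
    energyChange (repulsion z) z.1 1 = 0 ∧ ∃ w E, IsClassical 1 (repulsion z) z.1 w E := by
  obtain ⟨h1, h2, h3, h4, h5⟩ := mem_Hin_iff.1 hz
  have hg := continuous_repulsion hz
  obtain ⟨w, hw, hw1, hzw, hKw, hen⟩ := exists_velocity hg h1 h3 h
  have hK : energyChange (repulsion z) z.1 1 = 0 := by
    have e0 := hen 0 (by simp)
    have e1 := hen 1 (by simp)
    have hp : z.1 1 = z.1 0 := by simpa using h1.1 0
    have hK0 : energyChange (repulsion z) z.1 0 = 0 := intervalIntegral.integral_same
    rw [hw1, hp, energyFun] at e1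
    rw [energyFun, hK0] at e0
    have h0 : energyChange (repulsion z) z.1 1 * z.1 0 ^ 2 = 0 := by linear_combination e0 - e1
    exact (mul_eq_zero.1 h0).resolve_right (pow_ne_zero 2 (fst_ne_zero hz 0))
  exact ⟨hK, w, _, exists_isClassical hg (periodic_repulsion hz) h1 h3 hK hw hw1 hzw hen⟩

/-- The comparison of end points fails for the inner electron, which may vanish at `0`. Instead, the
differential of the potential `1 / (q₁ - q₂)` is `g dq₂ - g dq₁` with `g` the repulsion; over one
period the potential returns to its value and `∫ g dq₁ = 0` by the outer equation. -/
theorem energyChange_snd_eq_zero (hz : z ∈ Hin) {w₁ E₁ w : ℝ → ℝ}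
    (S : IsClassical 1 (repulsion z) z.1 w₁ E₁) (hK : energyChange (repulsion z) z.1 1 = 0)
    (hw : Continuous w) (hzw : ∀ τ ∈ Icc (0 : ℝ) 1, z.2 τ = z.2 0 + ∫ s in (0 : ℝ)..τ, w s)
    (hKw : energyChange (repulsion z) z.2 1
        = ∫ s in (0 : ℝ)..1, repulsion z (timeMap z.2 s) * (2 * z.2 s * w s)) :
    energyChange (repulsion z) z.2 1 = 0 := by
  obtain ⟨h1, h2, h3, h4, h5⟩ := mem_Hin_iff.1 hz
  have hg := continuous_repulsion hz
  have hc1 := h1.continuous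
  have hc2 := h2.continuous
  have hct1 := continuous_timeMap hc1
  have hct2 := continuous_timeMap hc2
  have hcw1 := S.continuous_velocity
  have hinv := S.continuous_inv
  set q := leviCivita z.1 with hq
  set q' : ℝ → ℝ := fun t => 2 * normSq z.1 * w₁ (invTimeMap z.1 t) / z.1 (invTimeMap z.1 t)
    with hq'
  have hqd : ∀ t, HasDerivAt q (q' t) t := fun t =>
    S.hasDerivAt_leviCivita (leviCivita_fst_ne_zero hz t)
  have hqc : Continuous q' := by
    refine Continuous.div ?_ (hc1.comp hinv) fun t => fst_ne_zero hz _
    exact continuous_const.mul (hcw1.comp hinv)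
  have hqcont : Continuous q := continuous_iff_continuousAt.2 fun t => (hqd t).continuousAt
  have hsub1 := integral_comp_timeMap hc1 h3 (hg.mul hqc)
  have hsub2 := integral_comp_timeMap hc2 h4 (hg.mul hqc)
  have hK1 : ∫ τ in (0 : ℝ)..1, (repulsion z * q') (timeMap z.1 τ) *
      ((normSq z.1)⁻¹ * z.1 τ ^ 2) = 0 := by
    refine Eq.trans ?_ hK
    rw [energyChange, S.deriv_eq]
    refine intervalIntegral.integral_congr fun τ _ => ?_
    have hinvt := invTimeMap_timeMap hc1 h3 S.eventually_ne τ
    have hz0 := fst_ne_zero hz τ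
    simp only [Pi.mul_apply, hq', hinvt]
    field_simp
  have hzd : ∀ x ∈ Ioo (0 : ℝ) 1, HasDerivAt z.2 (w x) x := by
    intro x hx
    refine ((hasDerivAt_integral_of_continuous hw 0 x).const_add (z.2 0)).congr_of_eventuallyEq ?_
    filter_upwards [Ioo_mem_nhds hx.1 hx.2] with y hy using hzw y (Ioo_subset_Icc_self hy)
  have hpos : ∀ τ, 0 < q (timeMap z.2 τ) - z.2 τ ^ 2 := fun τ => by
    have := h5 (timeMap z.2 τ)
    rw [leviCivita_timeMap hc2 h4] at this
    exact sub_pos.2 this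
  -- The potential is followed in the inner electron's time, because `q₂` need not be differentiable
  -- in `t` at collisions. The part with `dq₁` is carried over to the outer electron's time by two
  -- substitutions.
  set F : ℝ → ℝ := fun τ => (q (timeMap z.2 τ) - z.2 τ ^ 2)⁻¹ with hF
  have hFc : Continuous F := Continuous.inv₀ (by fun_prop) fun τ => (hpos τ).ne'
  set F' : ℝ → ℝ := fun τ => repulsion z (timeMap z.2 τ) * (2 * z.2 τ * w τ) -
    (repulsion z * q') (timeMap z.2 τ) * ((normSq z.2)⁻¹ * z.2 τ ^ 2) with hF'
  have i1 : Continuous fun τ => repulsion z (timeMap z.2 τ) * (2 * z.2 τ * w τ) := by fun_prop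
  have i2 : Continuous fun τ => (repulsion z * q') (timeMap z.2 τ) *
      ((normSq z.2)⁻¹ * z.2 τ ^ 2) :=
    ((hg.mul hqc).comp hct2).mul (by fun_prop)
  have hint := integral_eq_of_hasDerivAt_off_countable F F' (a := 0) (b := 1)
    countable_empty hFc.continuousOn (fun x hx => by
      rw [min_eq_left zero_le_one, max_eq_right zero_le_one] at hx
      have d1 := ((hqd (timeMap z.2 x)).comp x (hasDerivAt_timeMap hc2 x)).sub
        ((hzd x hx.1).pow 2)
      refine (d1.inv (hpos x).ne').congr_deriv ?_
      have e1 : repulsion z (timeMap z.2 x) = 1 / (q (timeMap z.2 x) - z.2 x ^ 2) ^ 2 := by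
        rw [repulsion, leviCivita_timeMap hc2 h4]
      have e2 := (hpos x).ne'
      simp only [hF', Pi.mul_apply, e1, Pi.sub_apply, Function.comp_apply, Pi.pow_apply]
      field_simp
      push_cast
      ring) ((i1.sub i2).intervalIntegrable _ _)
  have hF1 : F 1 = F 0 := by
    have hp : z.2 1 = z.2 0 := by simpa using h2.1 0
    have hqp : q 1 = q 0 := by simpa using S.periodic_leviCivita 0
    simp only [hF, timeMap_one h4, timeMap_zero, hp, hqp]
  rw [hF1, sub_self, hF', intervalIntegral.integral_sub (i1.intervalIntegrable _ _)
    (i2.intervalIntegrable _ _), hsub2, ← hsub1, hK1, ← hKw, sub_zero] at hint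
  exact hint

theorem exists_isClassical_of_isCriticalPoint (h : IsCriticalPoint z) :
    (∃ w E, IsClassical 1 (repulsion z) z.1 w E) ∧
      ∃ w E, IsClassical (-1) (repulsion z) z.2 w E := by
  obtain ⟨hz, hd1, hd2⟩ := isCriticalPoint_iff.1 h
  obtain ⟨h1, h2, h3, h4, h5⟩ := mem_Hin_iff.1 hz
  have hg := continuous_repulsion hz
  obtain ⟨hK, w₁, E₁, S⟩ := exists_isClassical_fst hz hd1
  obtain ⟨w, hw, hw1, hzw, hKw, hen⟩ := exists_velocity hg h2 h4 hd2
  have hwc : Continuous w := continuous_iff_continuousAt.2 fun x => (hw x).continuousAt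
  have hK2 := energyChange_snd_eq_zero hz S hK hwc hzw (hKw 1 (by simp))
  exact ⟨⟨w₁, E₁, S⟩, w, _,
    exists_isClassical hg (periodic_repulsion hz) h2 h4 hK2 hw hw1 hzw hen⟩

theorem isGeneralizedSolution_of_isCriticalPoint (h : IsCriticalPoint z) :
    IsGeneralizedSolution (leviCivita₂ z) := by
  obtain ⟨⟨w₁, E₁, S₁⟩, w₂, E₂, S₂⟩ := exists_isClassical_of_isCriticalPoint h
  have hz := h.1
  have c1 := S₁.continuous_leviCivita
  have c2 := S₂.continuous_leviCivita
  have e1 : ∀ t, leviCivita z.1 t ≠ 0 → deriv (deriv (leviCivita z.1)) t =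
      -(2 / leviCivita z.1 t ^ 2) + 1 / (leviCivita z.1 t - leviCivita z.2 t) ^ 2 := by
    intro t ht
    rw [(S₁.hasDerivAt_deriv_leviCivita ht).deriv, repulsion]
    ring
  have e2 : ∀ t, leviCivita z.2 t ≠ 0 → deriv (deriv (leviCivita z.2)) t =
      -(2 / leviCivita z.2 t ^ 2) - 1 / (leviCivita z.1 t - leviCivita z.2 t) ^ 2 := by
    intro t ht
    rw [(S₂.hasDerivAt_deriv_leviCivita ht).deriv, repulsion]
    ring
  have hsmooth := contDiffOn_infty_of_equations
    (U := {t | leviCivita z.1 t ≠ 0 ∧ leviCivita z.2 t ≠ 0})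
    ((isOpen_ne_fun c1 continuous_const).inter (isOpen_ne_fun c2 continuous_const))
    (fun t ht => ht.1) (fun t ht => ht.2) (fun t _ => (sub_leviCivita_pos hz t).ne')
    (S₁.contDiffOn_two.mono fun t ht => ht.1) (S₂.contDiffOn_two.mono fun t ht => ht.2)
    (fun t ht => e1 t ht.1) (fun t ht => e2 t ht.2)
  exact ⟨S₁.memH1_leviCivita, S₂.memH1_leviCivita, leviCivita_nonneg _, leviCivita_nonneg _,
    (mem_Hin_iff.1 hz).2.2.2.2, S₁.zeros_leviCivita, S₂.zeros_leviCivita, S₁.contDiffOn_two,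
    S₂.contDiffOn_two, hsmooth.1, hsmooth.2, e1, e2, S₁.energyExtends, S₂.energyExtends⟩

end Critical

/-! ### Generalized solutions give classical solutions -/

/-- The conditions on one component of a generalized solution. -/
structure IsComponent (σ : ℝ) (g q E : ℝ → ℝ) : Prop where
  continuous_g : Continuous g
  memH1 : MemH1 q
  nonneg : ∀ t, 0 ≤ q t
  finite : (zeroSet q).Finite
  even : Even (zeroSet q).ncard
  contDiffOn : ContDiffOn ℝ 2 q {t | q t ≠ 0}
  equation : ∀ t, q t ≠ 0 → deriv (deriv q) t = σ * g t - 2 / q t ^ 2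
  continuous_energy : Continuous E
  periodic_energy : Function.Periodic E 1
  energy : ∀ t, q t ≠ 0 → E t = (deriv q t) ^ 2 / 2 - 2 / q t

theorem eventually_ne_of_finite {f : ℝ → ℝ} (hf : Function.Periodic f 1)
    (hfin : (zeroSet f).Finite) (t : ℝ) : ∀ᶠ x in 𝓝[≠] t, f x ≠ 0 := by
  obtain ⟨p, p', hp, hz, hp0, -⟩ := exists_simple_zeros hf hfin
  have : ∀ᶠ x in 𝓝[≠] t, p x ≠ 0 := by
    by_cases h : p t = 0
    · exact (hp t).eventually_ne (hp0 t h)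
    · exact ((hp t).continuousAt.eventually_ne h).filter_mono nhdsWithin_le_nhds
  exact this.mono fun x hx h => hx ((hz x).1 h)

namespace IsComponent

variable {σ : ℝ} {g q E : ℝ → ℝ}

theorem continuous (C : IsComponent σ g q E) : Continuous q := C.memH1.continuous

theorem eventually_ne (C : IsComponent σ g q E) (t : ℝ) : ∀ᶠ x in 𝓝[≠] t, q x ≠ 0 :=
  eventually_ne_of_finite C.memH1.1 C.finite t

theorem countable_zeros (C : IsComponent σ g q E) : {t | q t = 0}.Countable :=
  Helium.countable_zeros C.eventually_ne

theorem hasDerivAt (C : IsComponent σ g q E) {t : ℝ} (ht : q t ≠ 0) :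
    HasDerivAt q (deriv q t) t ∧ HasDerivAt (deriv q) (σ * g t - 2 / q t ^ 2) t := by
  have ho : IsOpen {t | q t ≠ 0} := isOpen_ne_fun C.continuous continuous_const
  have h := C.contDiffOn
  rw [show (2 : WithTop ℕ∞) = 1 + 1 by norm_num, contDiffOn_succ_iff_deriv_of_isOpen ho] at h
  have hn := ho.mem_nhds ht
  refine ⟨((h.1 t ht).differentiableAt hn).hasDerivAt, ?_⟩
  rw [← C.equation t ht]
  exact ((h.2.2.differentiableOn one_ne_zero t ht).differentiableAt hn).hasDerivAt

/-- Off the zeros the energy gives `1/q = q'²/4 - E/2`, and both terms are integrable over a period.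
-/
theorem intervalIntegrable_inv (C : IsComponent σ g q E) (a b : ℝ) :
    IntervalIntegrable (fun t => (q t)⁻¹) volume a b := by
  refine Function.Periodic.intervalIntegrable₀ (T := 1) (fun t => by simp only [C.memH1.1 t])
    one_ne_zero ?_ a b
  have i1 := C.memH1.intervalIntegrable_deriv_sq.const_mul (1 / 4)
  have i2 := (C.continuous_energy.intervalIntegrable (μ := volume) 0 1).const_mul (1 / 2)
  refine (i1.sub i2).congr_ae (ae_restrict_of_ae ?_)
  filter_upwards [C.countable_zeros.ae_notMem volume] with t ht
  have ht' : q t ≠ 0 := ht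
  rw [C.energy t ht']
  field_simp
  ring

theorem hasDerivAt_integral_inv (C : IsComponent σ g q E) {t : ℝ} (ht : q t ≠ 0) :
    HasDerivAt (fun t => ∫ s in (0 : ℝ)..t, (q s)⁻¹) (q t)⁻¹ t :=
  intervalIntegral.integral_hasDerivAt_right (C.intervalIntegrable_inv _ _)
    (C.continuous.measurable.inv.stronglyMeasurable.stronglyMeasurableAtFilter)
    (C.continuous.continuousAt.inv₀ ht)

theorem strictMono_integral_inv (C : IsComponent σ g q E) :
    StrictMono fun t => ∫ s in (0 : ℝ)..t, (q s)⁻¹ := by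
  have hmono : Monotone fun t => ∫ s in (0 : ℝ)..t, (q s)⁻¹ := by
    intro a b hab
    have h := intervalIntegral.integral_interval_sub_left (C.intervalIntegrable_inv 0 b)
      (C.intervalIntegrable_inv 0 a)
    have h2 : 0 ≤ ∫ s in a..b, (q s)⁻¹ :=
      intervalIntegral.integral_nonneg hab fun s _ => inv_nonneg.2 (C.nonneg s)
    simp only
    linarith
  intro a b hab
  refine lt_of_le_of_ne (hmono hab.le) fun heq => ?_
  obtain ⟨x, hx, hqx⟩ : ∃ x ∈ Ioo a b, q x ≠ 0 := by
    by_contra! h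
    exact Ioo_infinite hab ((finite_zeros_Icc C.eventually_ne a b).subset
      fun x hx => ⟨h x hx, Ioo_subset_Icc_self hx⟩)
  have h1 := C.hasDerivAt_integral_inv hqx
  have h2 : (fun t => ∫ s in (0 : ℝ)..t, (q s)⁻¹) =ᶠ[𝓝 x] fun _ => ∫ s in (0 : ℝ)..a, (q s)⁻¹ := by
    filter_upwards [Ioo_mem_nhds hx.1 hx.2] with y hy
    exact le_antisymm ((hmono hy.2.le).trans_eq heq.symm) (hmono hy.1.le)
  have h3 := h1.unique ((hasDerivAt_const x _).congr_of_eventuallyEq h2)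
  exact inv_ne_zero hqx h3

/-- The time change of a component. -/
theorem exists_timeChange (C : IsComponent σ g q E) : ∃ (m : ℝ) (s : ℝ → ℝ), 0 < m ∧
    StrictMono s ∧ Continuous s ∧ Function.Surjective s ∧ s 0 = 0 ∧ (∀ τ, s (τ + 1) = s τ + 1) ∧
    ∀ τ, HasDerivAt s (m⁻¹ * q (s τ)) τ := by
  -- Dividing by `c` makes the new period equal to `1`; its inverse `m = c⁻¹` will be the squared
  -- norm of the square root.
  set c := ∫ t in (0 : ℝ)..1, (q t)⁻¹ with hc
  have hc0 : 0 < c := by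
    have := C.strictMono_integral_inv (zero_lt_one' ℝ)
    simpa using this
  set T : ℝ → ℝ := fun t => c⁻¹ * ∫ s in (0 : ℝ)..t, (q s)⁻¹ with hT
  have hTmono : StrictMono T := C.strictMono_integral_inv.const_mul (inv_pos.2 hc0)
  have hTc : Continuous T :=
    continuous_const.mul (intervalIntegral.continuous_primitive C.intervalIntegrable_inv 0)
  have hTadd : ∀ t, T (t + 1) = T t + 1 := by
    intro t
    have hp : Function.Periodic (fun t => (q t)⁻¹) 1 := fun t => by simp only [C.memH1.1 t]
    have h := hp.intervalIntegral_add_eq t 0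
    rw [zero_add] at h
    simp only [hT]
    rw [← intervalIntegral.integral_add_adjacent_intervals (C.intervalIntegrable_inv 0 t)
      (C.intervalIntegrable_inv t (t + 1)), h, mul_add, inv_mul_cancel₀ hc0.ne']
  have hTsurj := surjective_of_continuous_of_add_one hTc hTadd
  set e := hTmono.orderIsoOfSurjective T hTsurj with he
  have hTe : ∀ τ, T (e.symm τ) = τ := e.apply_symm_apply
  have heT : ∀ t, e.symm (T t) = t := e.symm_apply_apply
  have hT0 : T 0 = 0 := by simp [hT]
  have hsadd : ∀ τ, e.symm (τ + 1) = e.symm τ + 1 := fun τ => by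
    apply hTmono.injective
    rw [hTe, hTadd, hTe]
  have hsc : Continuous e.symm := e.symm.continuous
  have hcount : {τ | q (e.symm τ) = 0}.Countable :=
    C.countable_zeros.preimage e.symm.injective
  refine ⟨c⁻¹, e.symm, inv_pos.2 hc0, e.symm.strictMono, hsc, e.symm.surjective, ?_, hsadd, ?_⟩
  · rw [← hT0, heT]
    exact hT0.symm
  -- The inverse function theorem applies only off collisions. The resulting derivative `m⁻¹ * q (s
  -- τ)` is continuous everywhere, so the formula persists at the countably many exceptional times.
  · refine hasDerivAt_of_off_countable hcount hsc
      (continuous_const.mul (C.continuous.comp hsc)) fun τ hτ => ?_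
    have hτ' : q (e.symm τ) ≠ 0 := hτ
    have h1 := HasDerivAt.of_local_left_inverse hsc.continuousAt
      ((C.hasDerivAt_integral_inv hτ').const_mul c⁻¹)
      (mul_ne_zero (inv_ne_zero hc0.ne') (inv_ne_zero hτ')) (Eventually.of_forall hTe)
    refine h1.congr_deriv ?_
    rw [mul_inv, inv_inv, inv_inv]

end IsComponent

/-- A square root with sign changes at the zeros of a nonnegative function. -/
theorem exists_signed_sqrt {y : ℝ → ℝ} (hyc : Continuous y) (hp : Function.Periodic y 1)
    (h0 : ∀ τ, 0 ≤ y τ) (hfin : (zeroSet y).Finite) (heven : Even (zeroSet y).ncard) :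
    ∃ z p p' : ℝ → ℝ, Continuous z ∧ Function.Periodic z 1 ∧ (∀ τ, z τ ^ 2 = y τ) ∧
      (∀ x, HasDerivAt p (p' x) x) ∧ (∀ x, y x = 0 ↔ p x = 0) ∧ (∀ x, p x = 0 → p' x ≠ 0) ∧
      (∀ x, SignType.sign (z x) = SignType.sign (p x)) ∧
      ∀ x y₁, y x ≠ 0 → HasDerivAt y y₁ x → HasDerivAt z (y₁ / (2 * z x)) x := by
  obtain ⟨p, p', hpd, hyp, hp0, hadd⟩ := exists_simple_zeros hp hfin
  rw [heven.neg_one_pow] at hadd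
  have hpc : Continuous p := continuous_iff_continuousAt.2 fun x => (hpd x).continuousAt
  set z : ℝ → ℝ := fun τ => (SignType.sign (p τ) : ℝ) * Real.sqrt (y τ) with hz
  have hsq : ∀ τ, p τ ≠ 0 → (SignType.sign (p τ) : ℝ) ^ 2 = 1 := by
    intro τ h
    rcases lt_or_gt_of_ne h with h | h
    · simp [sign_neg h]
    · simp [sign_pos h]
  have hz2 : ∀ τ, z τ ^ 2 = y τ := by
    intro τ
    rw [hz, mul_pow, Real.sq_sqrt (h0 τ)]
    by_cases h : p τ = 0
    · rw [(hyp τ).2 h, mul_zero]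
    · rw [hsq τ h, one_mul]
  have hloc : ∀ x, y x ≠ 0 → z =ᶠ[𝓝 x] fun τ => (SignType.sign (p x) : ℝ) * Real.sqrt (y τ) := by
    intro x hx
    filter_upwards [eventually_sign_eq hpc.continuousAt.tendsto fun h => hx ((hyp x).2 h)] with τ hτ
    rw [hz]
    simp only [hτ]
  refine ⟨z, p, p', ?_, fun τ => ?_, hz2, hpd, hyp, hp0, fun x => ?_, fun x y₁ hx hy => ?_⟩
  · refine continuous_iff_continuousAt.2 fun x => ?_
    by_cases hx : y x = 0
    · have hzx : z x = 0 := by rw [← sq_eq_zero_iff, hz2, hx]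
      have h1 : Tendsto (fun τ => |z τ|) (𝓝 x) (𝓝 0) := by
        have : (fun τ => |z τ|) = fun τ => Real.sqrt (y τ) := by
          funext τ
          rw [← hz2, Real.sqrt_sq_eq_abs]
        rw [this]
        have := (Real.continuous_sqrt.comp hyc).tendsto x
        simpa [hx, Function.comp_def] using this
      rw [ContinuousAt, hzx]
      exact (tendsto_zero_iff_abs_tendsto_zero _).2 h1
    · exact (ContinuousAt.congr (by fun_prop) (hloc x hx).symm)
  · simp only [hz, hadd, one_mul, hp τ]
  · by_cases h : p x = 0
    · simp [hz, h]
    · have hy : 0 < Real.sqrt (y x) :=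
        Real.sqrt_pos.2 (lt_of_le_of_ne (h0 x) fun h' => h ((hyp x).1 h'.symm))
      rw [hz, sign_mul, sign_pos hy, mul_one]
      rcases lt_or_gt_of_ne h with h | h
      · simp [sign_neg h]
      · simp [sign_pos h]
  · have h1 := ((hy.sqrt hx).const_mul (SignType.sign (p x) : ℝ)).congr_of_eventuallyEq (hloc x hx)
    refine h1.congr_deriv ?_
    have hpx : p x ≠ 0 := fun h => hx ((hyp x).2 h)
    have h2 := hsq x hpx
    have h3 : Real.sqrt (y x) ≠ 0 := Real.sqrt_ne_zero'.2 (lt_of_le_of_ne (h0 x) (Ne.symm hx))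
    have h4 : (SignType.sign (p x) : ℝ) ≠ 0 := fun h => by rw [h] at h2; norm_num at h2
    rw [hz]
    field_simp
    linear_combination y₁ * h2

theorem zeroSet_comp {q s : ℝ → ℝ} (hs : StrictMono s) (hsurj : Function.Surjective s)
    (h0 : s 0 = 0) (h1 : s 1 = 1) : s '' zeroSet (fun τ => q (s τ)) = zeroSet q := by
  ext t
  constructor
  · rintro ⟨τ, ⟨hτ, h⟩, rfl⟩
    exact ⟨⟨by rw [← h0]; exact hs.monotone hτ.1, by rw [← h1]; exact hs hτ.2⟩, h⟩
  · rintro ⟨ht, h⟩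
    obtain ⟨τ, rfl⟩ := hsurj t
    exact ⟨τ, ⟨⟨hs.le_iff_le.1 (by rw [h0]; exact ht.1), hs.lt_iff_lt.1 (by rw [h1]; exact ht.2)⟩,
      h⟩, rfl⟩

/-- In the time `s` with `s' = q(s)/m` all singular terms cancel. Each derivative is computed off
the collisions, rewritten without division by `y`, and extended across them by
`hasDerivAt_of_off_countable`. -/
theorem IsComponent.exists_isClassical {σ : ℝ} {g q E : ℝ → ℝ} (C : IsComponent σ g q E) :
    ∃ z w E', IsClassical σ g z w E' ∧ leviCivita z = q := by
  classical
  obtain ⟨m, s, hm, hsmono, hsc, hssurj, hs0, hsadd, hsd⟩ := C.exists_timeChange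
  have hs1 : s 1 = 1 := by simpa [hs0] using hsadd 0
  set y : ℝ → ℝ := fun τ => q (s τ) with hy
  set e : ℝ → ℝ := fun τ => E (s τ) with he
  set y₁ : ℝ → ℝ := fun τ => deriv q (s τ) * (m⁻¹ * y τ) with hy₁
  have hyc : Continuous y := C.continuous.comp hsc
  have hec : Continuous e := C.continuous_energy.comp hsc
  have hg := C.continuous_g
  have hyp : Function.Periodic y 1 := fun τ => by simp only [hy, hsadd, C.memH1.1 (s τ)]
  have hep : Function.Periodic e 1 := fun τ => by simp only [he, hsadd, C.periodic_energy (s τ)]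
  have hy0 : ∀ τ, 0 ≤ y τ := fun τ => C.nonneg _
  have himg := zeroSet_comp (q := q) hsmono hssurj hs0 hs1
  have hfin : (zeroSet y).Finite := by
    refine Set.Finite.of_finite_image ?_ hsmono.injective.injOn
    rw [himg]; exact C.finite
  have heven : Even (zeroSet y).ncard := by
    rw [← ncard_image_of_injective _ hsmono.injective, himg]; exact C.even
  have hcount : {τ | y τ = 0}.Countable := Helium.countable_zeros (eventually_ne_of_finite hyp hfin)
  have hen : ∀ τ, y τ ≠ 0 → deriv q (s τ) ^ 2 = 2 * e τ + 4 / y τ := fun τ hτ => by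
    have := C.energy (s τ) hτ
    simp only [he, hy]
    rw [this]
    ring
  -- The energy law multiplied by `(y / m)²` has no pole, and it forces `y₁` to tend to `0` at
  -- collisions.
  have hy₁sq : ∀ τ, y₁ τ ^ 2 = (2 * e τ * y τ ^ 2 + 4 * y τ) / m ^ 2 := by
    intro τ
    by_cases h : y τ = 0
    · simp [hy₁, h]
    · rw [hy₁, mul_pow, hen τ h]
      field_simp
  have hyd0 : ∀ τ, y τ ≠ 0 → HasDerivAt y (y₁ τ) τ := fun τ hτ =>
    (C.hasDerivAt hτ).1.comp τ (hsd τ)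
  have hqd0 : ∀ τ, y τ ≠ 0 → HasDerivAt (fun τ => deriv q (s τ))
      ((σ * g (s τ) - 2 / y τ ^ 2) * (m⁻¹ * y τ)) τ := fun τ hτ =>
    (C.hasDerivAt hτ).2.comp τ (hsd τ)
  have hy₁c : Continuous y₁ := by
    refine continuous_iff_continuousAt.2 fun x => ?_
    by_cases hx : y x = 0
    · have hy₁x : y₁ x = 0 := by simp [hy₁, hx]
      have h1 : (fun τ => |y₁ τ|) = fun τ => Real.sqrt ((2 * e τ * y τ ^ 2 + 4 * y τ) / m ^ 2) := by
        funext τ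
        rw [← hy₁sq, Real.sqrt_sq_eq_abs]
      have h2 : Continuous fun τ => Real.sqrt ((2 * e τ * y τ ^ 2 + 4 * y τ) / m ^ 2) := by
        fun_prop
      have h3 := h2.tendsto x
      rw [← h1] at h3
      rw [ContinuousAt, hy₁x]
      refine (tendsto_zero_iff_abs_tendsto_zero _).2 ?_
      simpa [hx, Function.comp_def] using h3
    · exact (hqd0 x hx).continuousAt.mul (by fun_prop)
  have hyd := hasDerivAt_of_off_countable hcount hyc hy₁c fun τ hτ => hyd0 τ hτ
  -- At a zero of `y` this second derivative is `2 / m ^ 2 > 0`; this nondegeneracy is what gives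
  -- `y` a differentiable signed root.
  have hy₁d := hasDerivAt_of_off_countable
    (f' := fun τ => (2 + σ * g (s τ) * y τ ^ 2 + 2 * e τ * y τ) / m ^ 2) hcount hy₁c
    (by fun_prop) fun τ hτ => by
      have hτ' : y τ ≠ 0 := hτ
      refine ((hqd0 τ hτ).mul ((hyd τ).const_mul m⁻¹)).congr_deriv ?_
      have h1 := hen τ hτ
      simp only [hy₁]
      field_simp at h1 ⊢
      linear_combination h1
  have hed := hasDerivAt_of_off_countable
    (f' := fun τ => σ * (g (s τ) * y₁ τ)) hcount hec
    (by fun_prop) fun τ hτ => by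
      have hτ' : y τ ≠ 0 := hτ
      have h1 : e =ᶠ[𝓝 τ] fun τ => (deriv q (s τ)) ^ 2 / 2 - 2 * (y τ)⁻¹ := by
        filter_upwards [hyc.continuousAt.eventually_ne hτ'] with x hx
        simp only [he, hy]
        rw [C.energy (s x) hx]
        ring
      have h2 := (((hqd0 τ hτ).pow 2).div_const 2).sub (((hyd τ).inv hτ').const_mul 2)
      refine (h2.congr_of_eventuallyEq h1).congr_deriv ?_
      simp only [hy₁]
      field_simp
      push_cast
      ring
  obtain ⟨z, p, p', hzc, hzp, hz2, hpd, hyp0, hp0, hsign, hzd0⟩ :=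
    exists_signed_sqrt hyc hyp hy0 hfin heven
  have hz0 : ∀ τ, y τ ≠ 0 → z τ ≠ 0 := fun τ hτ h => hτ (by rw [← hz2, h]; norm_num)
  -- At a zero the modulus `m⁻¹` is dictated by the energy identity, and the sign by the direction
  -- in which `p`, hence `z`, crosses zero.
  set w : ℝ → ℝ := fun τ => if y τ = 0 then (SignType.sign (p' τ) : ℝ) * m⁻¹ else y₁ τ / (2 * z τ)
    with hw
  have hw0 : ∀ τ, y τ ≠ 0 → w τ = y₁ τ / (2 * z τ) := fun τ hτ => by simp [hw, hτ]
  have hsg : ∀ τ, y τ = 0 → (SignType.sign (p' τ) : ℝ) ^ 2 = 1 := by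
    intro τ h
    rcases lt_or_gt_of_ne (hp0 τ ((hyp0 τ).1 h)) with h | h
    · simp [sign_neg h]
    · simp [sign_pos h]
  have hwsq : ∀ τ, w τ ^ 2 = (2 + e τ * y τ) / (2 * m ^ 2) := by
    intro τ
    by_cases h : y τ = 0
    · simp only [hw, h, if_true]
      rw [mul_pow, hsg τ h]
      field_simp
      ring
    · rw [hw0 τ h, div_pow, hy₁sq, mul_pow, hz2]
      field_simp
      ring
  have hwc : Continuous w := by
    refine continuous_iff_continuousAt.2 fun c => ?_
    by_cases hc : y c = 0
    · have hpc := (hyp0 c).1 hc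
      have hp'c := hp0 c hpc
      have hy₁c0 : y₁ c = 0 := by simp [hy₁, hc]
      have h1 := eventually_sign_eq (hasDerivAt_iff_tendsto_slope.1 (hpd c)) hp'c
      have h2 := eventually_sign_eq (hasDerivAt_iff_tendsto_slope.1 (hy₁d c))
        (by rw [hc]; simp [hm.ne'])
      -- The modulus of `w` is known from `hwsq`, so continuity at a collision only requires its
      -- sign to be constant near `c`.
      have h3 : w =ᶠ[𝓝 c] fun x =>
          (SignType.sign (p' c) : ℝ) * Real.sqrt ((2 + e x * y x) / (2 * m ^ 2)) := by
        have h2' := eventually_ne_of_finite hyp hfin c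
        rw [eventually_nhdsWithin_iff] at h1 h2 h2'
        filter_upwards [h1, h2, h2'] with x hx1 hx2 hx3
        rw [← hwsq, Real.sqrt_sq_eq_abs]
        have hws : SignType.sign (w x) = SignType.sign (p' c) := by
          by_cases hxc : x = c
          · rw [hxc]
            have hwcv : w c = (SignType.sign (p' c) : ℝ) * m⁻¹ := by simp [hw, hc]
            rw [hwcv, sign_mul, sign_pos (inv_pos.2 hm), mul_one]
            rcases lt_or_gt_of_ne hp'c with h | h
            · simp [sign_neg h]
            · simp [sign_pos h]
          · have hyx := hx3 hxc
            have a1 := hx1 hxc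
            have hne := sub_ne_zero.2 hxc
            rw [slope_def_field, hpc, sub_zero] at a1
            have hpos : 0 < (2 + σ * g (s c) * y c ^ 2 + 2 * e c * y c) / m ^ 2 := by
              rw [hc]
              simp only [ne_eq, OfNat.ofNat_ne_zero, not_false_eq_true, zero_pow, mul_zero,
                add_zero]
              positivity
            have a2 := (hx2 hxc).trans (sign_pos hpos)
            rw [slope_def_field, hy₁c0, sub_zero] at a2
            -- The first factor is positive near `c` because `y'' > 0` there, the second has the
            -- sign of `p' c`, and the third is positive because `z` and `p` have equal sign.
            have a3 : w x = (y₁ x / (x - c)) * (p x / (x - c)) *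
                ((x - c) ^ 2 * (2 * z x * p x)⁻¹) := by
              have hpx : p x ≠ 0 := fun h => hyx ((hyp0 x).2 h)
              have hzx := hz0 x hyx
              rw [hw0 x hyx]
              field_simp
            have a4 : 0 < z x * p x := by
              have hzx := hz0 x hyx
              rcases lt_or_gt_of_ne hzx with h | h
              · have h5 := hsign x
                rw [sign_neg h] at h5
                exact mul_pos_of_neg_of_neg h (sign_eq_neg_one_iff.1 h5.symm)
              · have h5 := hsign x
                rw [sign_pos h] at h5
                exact mul_pos h (sign_eq_one_iff.1 h5.symm)
            have a5 : 0 < (x - c) ^ 2 * (2 * z x * p x)⁻¹ := by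
              have : 0 < 2 * z x * p x := by linarith
              positivity
            rw [a3, sign_mul, sign_mul, a1, a2, sign_pos a5, one_mul, mul_one]
        rw [← hws]
        exact (sign_mul_abs (w x)).symm
      exact ContinuousAt.congr (by fun_prop) h3.symm
    · have h1 : w =ᶠ[𝓝 c] fun x => y₁ x / (2 * z x) := by
        filter_upwards [hyc.continuousAt.eventually_ne hc] with x hx using hw0 x hx
      refine ContinuousAt.congr ?_ h1.symm
      exact hy₁c.continuousAt.div (by fun_prop) (mul_ne_zero two_ne_zero (hz0 c hc))
  have hzd := hasDerivAt_of_off_countable hcount hzc hwc fun τ hτ => by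
    rw [hw0 τ hτ]
    exact hzd0 τ _ hτ (hyd τ)
  have hwd := hasDerivAt_of_off_countable
    (f' := fun τ => (e τ * z τ + σ * g (s τ) * z τ ^ 3) / (2 * m ^ 2)) hcount hwc
    (by fun_prop) fun τ hτ => by
      have hτ' : y τ ≠ 0 := hτ
      have hzτ := hz0 τ hτ'
      have h1 : w =ᶠ[𝓝 τ] fun x => y₁ x / (2 * z x) := by
        filter_upwards [hyc.continuousAt.eventually_ne hτ'] with x hx using hw0 x hx
      have h2 := (hy₁d τ).div ((hzd τ).const_mul 2) (mul_ne_zero two_ne_zero hzτ)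
      refine (h2.congr_of_eventuallyEq h1).congr_deriv ?_
      have h3 := hw0 τ hτ'
      have h4 : y₁ τ = 2 * z τ * w τ := by rw [h3]; field_simp
      have h5 := hwsq τ
      have h6 := hz2 τ
      rw [h4]
      rw [← h6] at h5 ⊢
      field_simp at h5 ⊢
      linear_combination (-1 : ℝ) * h5
  have hnorm : normSq z = m := by
    have h1 := integral_eq_of_hasDerivAt_off_countable s (fun τ => m⁻¹ * y τ) (a := 0) (b := 1)
      countable_empty hsc.continuousOn (fun x _ => hsd x)
      (Continuous.intervalIntegrable (by fun_prop) _ _)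
    rw [intervalIntegral.integral_const_mul, hs1, hs0, sub_zero] at h1
    simp only [normSq, hz2]
    field_simp at h1
    linarith
  have htime : timeMap z = s := by
    funext τ
    have h1 := integral_eq_of_hasDerivAt_off_countable s (fun τ => m⁻¹ * y τ) (a := 0) (b := τ)
      countable_empty hsc.continuousOn (fun x _ => hsd x)
      (Continuous.intervalIntegrable (by fun_prop) _ _)
    rw [intervalIntegral.integral_const_mul, hs0, sub_zero] at h1
    simp only [timeMap, hnorm, hz2, h1]
  have hmz : 0 < normSq z := by rw [hnorm]; exact hm
  refine ⟨z, w, e, ⟨C.continuous_g, hzp, hep, hmz, hzd, fun τ => ?_, fun τ => ?_, fun τ => ?_⟩, ?_⟩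
  · rw [htime, hnorm]
    exact hwd τ
  · rw [htime]
    refine (hed τ).congr_deriv ?_
    have h1 : y₁ τ = 2 * z τ * w τ := by
      have h2 : y = fun τ => z τ ^ 2 := funext fun τ => (hz2 τ).symm
      have h3 := hyd τ
      rw [h2] at h3
      have h4 := h3.unique ((hzd τ).fun_pow 2)
      rw [h4]
      push_cast
      ring
    rw [h1]
  · rw [hnorm, hwsq, hz2]
    field_simp
    ring
  · funext t
    obtain ⟨τ, rfl⟩ := hssurj t
    rw [← htime, leviCivita_timeMap hzc hmz, hz2, htime]

/-! ### Counting the preimages of a generalized solution -/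

theorem leviCivita_neg (z : ℝ → ℝ) : leviCivita (-z) = leviCivita z := by
  have h1 : normSq (-z) = normSq z := by simp [normSq]
  have h2 : timeMap (-z) = timeMap z := by
    funext τ
    simp [timeMap, h1]
  funext t
  simp [leviCivita, invTimeMap, h2]

theorem isComponent_fst {q : (ℝ → ℝ) × (ℝ → ℝ)} (hq : IsGeneralizedSolution q) :
    ∃ E, IsComponent 1 (fun t => 1 / (q.1 t - q.2 t) ^ 2) q.1 E := by
  obtain ⟨E, hEc, hEp, hE⟩ := hq.energy_fst
  have h1 := hq.memH1_fst.continuous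
  have h2 := hq.memH1_snd.continuous
  refine ⟨E, ⟨?_, hq.memH1_fst, hq.nonneg_fst, hq.zeros_fst.1, hq.zeros_fst.2, hq.contDiff_fst,
    fun t ht => ?_, hEc, hEp, hE⟩⟩
  · exact continuous_const.div (by fun_prop) fun t => pow_ne_zero 2 (sub_pos.2 (hq.lt t)).ne'
  · rw [hq.eq_fst t ht]
    ring

theorem isComponent_snd {q : (ℝ → ℝ) × (ℝ → ℝ)} (hq : IsGeneralizedSolution q) :
    ∃ E, IsComponent (-1) (fun t => 1 / (q.1 t - q.2 t) ^ 2) q.2 E := by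
  obtain ⟨E, hEc, hEp, hE⟩ := hq.energy_snd
  have h1 := hq.memH1_fst.continuous
  have h2 := hq.memH1_snd.continuous
  refine ⟨E, ⟨?_, hq.memH1_snd, hq.nonneg_snd, hq.zeros_snd.1, hq.zeros_snd.2, hq.contDiff_snd,
    fun t ht => ?_, hEc, hEp, hE⟩⟩
  · exact continuous_const.div (by fun_prop) fun t => pow_ne_zero 2 (sub_pos.2 (hq.lt t)).ne'
  · rw [hq.eq_snd t ht]
    ring

/-- `repulsion` depends on the pair only through its transforms, so for a given `q` the two
equations decouple and square roots of the components can be chosen independently. -/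
theorem IsClassical.isCriticalPoint {q : (ℝ → ℝ) × (ℝ → ℝ)} (hq : IsGeneralizedSolution q)
    {a b w₁ w₂ E₁ E₂ : ℝ → ℝ}
    (S₁ : IsClassical 1 (fun t => 1 / (q.1 t - q.2 t) ^ 2) a w₁ E₁)
    (S₂ : IsClassical (-1) (fun t => 1 / (q.1 t - q.2 t) ^ 2) b w₂ E₂)
    (ha : leviCivita a = q.1) (hb : leviCivita b = q.2) : IsCriticalPoint (a, b) := by
  have hr : repulsion (a, b) = fun t => 1 / (q.1 t - q.2 t) ^ 2 := by
    funext t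
    simp only [repulsion, ha, hb]
  refine isCriticalPoint_iff.2 ⟨mem_Hin_iff.2 ⟨S₁.memH1, S₂.memH1, S₁.normSq_pos, S₂.normSq_pos,
    fun t => ?_⟩, fun v hv => ?_, fun v hv => ?_⟩
  · simp only [ha, hb]
    exact hq.lt t
  · rw [hr]
    exact S₁.componentDeriv_eq_zero hv
  · rw [hr]
    exact S₂.componentDeriv_eq_zero hv

/-! ### Uniqueness of the square root up to sign. -/

namespace IsClassical

variable {σ σ' : ℝ} {g g' z z' w w' E E' : ℝ → ℝ}

theorem sq_eq_sq_of_leviCivita_eq (S : IsClassical σ g z w E) (S' : IsClassical σ' g' z' w' E')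
    (h : leviCivita z = leviCivita z') (τ : ℝ) : z τ ^ 2 = z' τ ^ 2 := by
  have hm := S.normSq_pos
  have hm' := S'.normSq_pos
  have h0 : ∀ {σ : ℝ} {g z w E : ℝ → ℝ}, IsClassical σ g z w E → invTimeMap z 0 = 0 := fun S =>
    invTimeMap_eq S.continuous S.normSq_pos S.eventually_ne timeMap_zero
  have h1 : ∀ {σ : ℝ} {g z w E : ℝ → ℝ}, IsClassical σ g z w E → invTimeMap z 1 = 1 := fun S =>
    invTimeMap_eq S.continuous S.normSq_pos S.eventually_ne (timeMap_one S.normSq_pos)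
  -- The derivative of `invTimeMap z / normSq z` is `1 / L(z)`, which depends on the transform
  -- alone. Both quotients vanish at `t = 0`, and equality at `t = 1`, where both inverses are `1`,
  -- identifies the norms.
  have hd := hasDerivAt_of_off_countable (f' := fun _ => (0 : ℝ))
    (f := fun t => invTimeMap z t / normSq z - invTimeMap z' t / normSq z')
    (countable_zeros S.eventually_leviCivita_ne)
    ((S.continuous_inv.div_const _).sub (S'.continuous_inv.div_const _)) continuous_const
    fun t ht => by
      have ht' : leviCivita z t ≠ 0 := ht
      refine (((S.hasDerivAt_inv ht').div_const (normSq z)).sub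
        ((S'.hasDerivAt_inv (h ▸ ht')).div_const (normSq z'))).congr_deriv ?_
      rw [← h]
      field_simp
      ring
  have key : ∀ t, invTimeMap z t / normSq z = invTimeMap z' t / normSq z' := fun t => by
    have := eq_of_hasDerivAt_eq_zero hd t 0
    simp only [h0 S, h0 S', zero_div, sub_zero] at this
    exact sub_eq_zero.1 this
  have hmm : normSq z = normSq z' := by
    have := key 1
    rw [h1 S, h1 S'] at this
    field_simp at this
    exact this.symm
  have hinv : ∀ t, invTimeMap z t = invTimeMap z' t := fun t => by
    have := key t
    rw [hmm] at this
    field_simp at this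
    exact this
  have htime : timeMap z' τ = timeMap z τ := by
    rw [← timeMap_invTimeMap S'.continuous S'.periodic hm' (timeMap z τ), ← hinv,
      invTimeMap_timeMap S.continuous hm S.eventually_ne]
  rw [← leviCivita_timeMap S.continuous hm, ← leviCivita_timeMap S'.continuous hm', h, htime]

/-- The Levi-Civita transform determines a classical solution up to sign. -/
theorem eq_or_eq_neg (S : IsClassical σ g z w E) (S' : IsClassical σ' g' z' w' E')
    (h : leviCivita z = leviCivita z') : z = z' ∨ z = -z' := by
  have hsq := S.sq_eq_sq_of_leviCivita_eq S' h
  have hz : ∀ x, z x = 0 ↔ z' x = 0 := fun x => by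
    rw [← sq_eq_zero_iff, hsq, sq_eq_zero_iff]
  rcases pos_or_neg_of_simple_zeros (fun x => Or.inl (S.hasDerivAt x)) S.continuous S'.hasDerivAt
    hz (fun x => S.velocity_ne_zero) (fun x => S'.velocity_ne_zero) with hs | hs
  · refine Or.inl (funext fun x => ?_)
    rcases sq_eq_sq_iff_eq_or_eq_neg.1 (hsq x) with h1 | h1
    · exact h1
    · by_cases hx : z x = 0
      · rw [hx, (hz x).1 hx]
      · have := hs x hx
        rw [h1] at this
        nlinarith [sq_nonneg (z' x)]
  · refine Or.inr (funext fun x => ?_)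
    rcases sq_eq_sq_iff_eq_or_eq_neg.1 (hsq x) with h1 | h1
    · by_cases hx : z x = 0
      · rw [Pi.neg_apply, hx, (hz x).1 hx, neg_zero]
      · have := hs x hx
        rw [h1] at this
        nlinarith [sq_nonneg (z' x)]
    · exact h1

theorem ne_neg (S : IsClassical σ g z w E) : z ≠ -z := by
  obtain ⟨τ, hτ⟩ := S.exists_ne_zero
  intro h
  have := congrFun h τ
  rw [Pi.neg_apply] at this
  exact hτ (by linarith)

end IsClassical

theorem encard_criticalPoints {q : (ℝ → ℝ) × (ℝ → ℝ)} (hq : IsGeneralizedSolution q) :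
    {z : (ℝ → ℝ) × (ℝ → ℝ) | IsCriticalPoint z ∧ leviCivita₂ z = q}.encard = 4 := by
  obtain ⟨F₁, C₁⟩ := isComponent_fst hq
  obtain ⟨F₂, C₂⟩ := isComponent_snd hq
  obtain ⟨a, w₁, E₁, S₁, ha⟩ := C₁.exists_isClassical
  obtain ⟨b, w₂, E₂, S₂, hb⟩ := C₂.exists_isClassical
  have ha' := (leviCivita_neg a).trans ha
  have hb' := (leviCivita_neg b).trans hb
  have hset : {z : (ℝ → ℝ) × (ℝ → ℝ) | IsCriticalPoint z ∧ leviCivita₂ z = q} =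
      ({a, -a} : Set (ℝ → ℝ)) ×ˢ ({b, -b} : Set (ℝ → ℝ)) := by
    ext ⟨x, y⟩
    simp only [mem_ofPred_eq, mem_prod, mem_insert_iff, mem_singleton_iff]
    constructor
    · rintro ⟨hc, rfl⟩
      obtain ⟨⟨_, _, T₁⟩, _, _, T₂⟩ := exists_isClassical_of_isCriticalPoint hc
      exact ⟨T₁.eq_or_eq_neg S₁ ha.symm, T₂.eq_or_eq_neg S₂ hb.symm⟩
    · rintro ⟨rfl | rfl, rfl | rfl⟩
      · exact ⟨S₁.isCriticalPoint hq S₂ ha hb, Prod.ext ha hb⟩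
      · exact ⟨S₁.isCriticalPoint hq S₂.neg ha hb', Prod.ext ha hb'⟩
      · exact ⟨S₁.neg.isCriticalPoint hq S₂ ha' hb, Prod.ext ha' hb⟩
      · exact ⟨S₁.neg.isCriticalPoint hq S₂.neg ha' hb', Prod.ext ha' hb'⟩
  rw [hset, Set.encard_prod, encard_pair S₁.ne_neg, encard_pair S₂.ne_neg]
  norm_num

end Helium

end

/-- The Levi-Civita transformation, with separate time changes for the two electrons, is defined
on all critical points of `B_in` (their components have finitely many zeroes), maps them to
generalized solutions of the helium equations, and every generalized solution has exactly four
critical points as preimages. -/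
theorem mainTheorem7 :
    (∀ z : (ℝ → ℝ) × (ℝ → ℝ), Helium.IsCriticalPoint z →
      (Helium.zeroSet z.1).Finite ∧ (Helium.zeroSet z.2).Finite ∧
        Helium.IsGeneralizedSolution (Helium.leviCivita₂ z)) ∧
    (∀ q : (ℝ → ℝ) × (ℝ → ℝ), Helium.IsGeneralizedSolution q →
      {z : (ℝ → ℝ) × (ℝ → ℝ) | Helium.IsCriticalPoint z ∧ Helium.leviCivita₂ z = q}.encard
        = 4) := by
  refine ⟨fun z hz => ?_, fun q hq => Helium.encard_criticalPoints hq⟩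
  obtain ⟨⟨_, _, S₁⟩, _, _, S₂⟩ := Helium.exists_isClassical_of_isCriticalPoint hz
  exact ⟨Helium.finite_zeroSet S₁.eventually_ne, Helium.finite_zeroSet S₂.eventually_ne,
    Helium.isGeneralizedSolution_of_isCriticalPoint hz⟩
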